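/- **Model.** One observes $n$ i.i.d. pairs $Z_i=(Y_i,X_{i\cdot})\in\mathbb R\times\mathbb R^p$ with $X_{i\cdot}\sim\mathcal N(0,\Sigma)$ and $Y_i=X_{i\cdot}^\top\beta+\varepsilon_i$, where $\varepsilon_i\sim\mathcal N(0,\sigma^2)$ is independent of $X_{i\cdot}$. Write $\theta=(\beta,\Sigma,\sigma)$ and let $\mathbb P_\theta,\mathbb E_\theta$ refer to the law of the data. For fixed $M_1>1$, $M_2>0$ let $$\Theta(k)=\{\theta:\ \|\beta\|_0\le k,\ 1/M_1\le\lambda_{\min}(\Sigma)\le\lambda_{\max}(\Sigma)\le M_1,\ 0<\sigma\le M_2\},$$ and for $\xi\in\mathbb R^p$, $t_0\in\mathbb R$, $\tau>0$ let $\Theta(k;\xi,t_0)=\{\theta\in\Theta(k):\xi^\top\beta=t_0\}$ and $\Theta_{\pm\tau}(k;\xi,t_0)=\{\theta\in\Theta(k):|\xi^\top\beta-t_0|\ge\tau\}$. Let $\Psi_\alpha(\Theta)$ be the set of measurable $[0,1]$-valued functions $\psi$ of the data with $\sup_{\theta\in\Theta}\mathbb E_\theta\psi\le\alpha$. For fixed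 $\alpha,\eta\in(0,1)$ the adaptive separation distance is $$\tau_{\rm adap}(k_u,k;\xi)=\inf\Big\{\tau>0:\ \sup_{\psi\in\Psi_\alpha(\Theta(k_u;\xi,t_0))}\ \inf_{\theta\in\Theta_{\pm\tau}(k;\xi,t_0)}\mathbb E_\theta\psi\ \ge 1-\eta\Big\}\in[0,\infty].$$ **Loading.** Let $\xi\in\mathbb R^p$ be nonzero with $|\xi_1|\ge\dots\ge|\xi_p|$, put $\xi_{p+1}=0$, $k_\xi=\|\xi\|_0$, and $H(t;\xi)=\big(\sum_{j\le\lceil t\rceil\wedge p}\xi_j^2\big)^{1/2}$. For $0\le m\le p$ put $$R_m=H(m;\xi)\Big(\frac1{\sqrt n}+\frac{k_u\log p}{n}\Big)+|\xi_{m+1}|\,k_u\sqrt{\frac{\log p}{n}}.$$ Let $\zeta\in\mathbb R$ be the unique solution of $$\frac{\sum_{j=1}^{k_\xi}|\xi_j|\exp(-\zeta/\xi_j^2)}{\sqrt{\sum_{j=1}^{k_\xi}\xi_j^2\exp(-\zeta/\xi_j^2)}}=\frac{k_u}{2},$$ and set $\lambda=\sqrt{\max(\zeta,0)}$, $\nu_1=\lambda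 k_u+\sqrt{\sum_{j=1}^{k_\xi}\xi_j^2\exp(-\lambda^2/\xi_j^2)}$ and $\nu_2=H(k_u;\xi)$. **Mixed test.** Let $\hat\Sigma=n^{-1}X^\top X$. Given estimators $\hat\beta,\hat\sigma$ and constants $C_\xi,A_1,A_2,A_3>0$, for $v\in\mathbb R^p$ let $\hat u_v$ minimize $u^\top\hat\Sigma u$ subject to $\|\hat\Sigma u-v\|_\infty\le C_\xi\|v\|_2\sqrt{\log p/n}$ ($\hat u_v=0$ if this is infeasible). The debiased interval ${\rm CI}_{\rm db}(v)$ has centre $v^\top\hat\beta+\hat u_v^\top\frac1nX^\top(Y-X\hat\beta)$ and radius $\hat\sigma\big(A_1\sqrt{\hat u_v^\top\hat\Sigma\hat u_v}/\sqrt n+A_2\|v\|_2k_u\log p/n\big)$; the plug-in interval ${\rm CI}_{\rm pi}(v)$ has centre $v^\top\hat\beta$ and radius $A_3\hat\sigma\|v\|_\infty k_u\sqrt{\log p/n}$. With $\xi^{(1)}=(\xi_1,\dots,\xi_m,0,\dots,0)$ and $\xi^{(2)}=\xi-\xi^{(1)}$, the mixed test with cutoff $m$ is $\psi_m=\mathbf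 1\{t_0\notin{\rm CI}_{\rm db}(\xi^{(1)})+{\rm CI}_{\rm pi}(\xi^{(2)})\}$ (Minkowski sum). **Theorem.** Fix $M_1>1$, $M_2>0$, $\gamma\in[0,1/2)$, $C_0>0$ and $\alpha,\eta\in(0,1)$. There is a constant $c>0$ such that the following hold, where "in the regime $N$" means: for all $n,p,k_u\ge N$ with $k_u\le C_0p^\gamma$ and $n\ge c\,k_u\log p$. All constants depend only on $M_1,M_2,\gamma,C_0,\alpha,\eta$. 1. *Upper bound.* There are $C>0$ and $N$ such that in the regime $N$, for all $\xi$ as above, all $t_0\in\mathbb R$ and all $1\le k\le k_u$, $$\tau_{\rm adap}(k_u,k;\xi)\le C\min_{0\le m\le p}R_m.$$ 2. *Lower bound.* If $\alpha+\eta<1$, there are $C'>0$ and $N$ such that in the regime $N$, for all $\xi$ as above, all $t_0\in\mathbb R$ and all $1\le k\le k_u$, $$\tau_{\rm adap}(k_u,k;\xi)\ge C'\Big(\frac{\nu_1}{\sqrt n}\vee\nu_2\frac{k_u\log p}{n}\Big).$$ 3. *Attainment by the mixed test.* There are constants $c_\beta,C_\beta,C_\xi,A_1,A_2,A_3,C>0$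 and measurable estimators $\hat\beta,\hat\sigma$, depending on the data and on $n,p,k_u$ but not on $\xi,t_0,k$, such that (a) for every $\delta>0$ there is $N$ such that in the regime $N$, for every $\theta\in\Theta(k_u)$, with $\mathbb P_\theta$-probability at least $1-\delta$: $0.9\hat\sigma<\sigma<1.1\hat\sigma$, $\|\hat\beta-\beta\|_1\le c_\beta\sigma k_u\sqrt{\log p/n}$ and $\|\hat\beta-\beta\|_2\le C_\beta\sigma\sqrt{k_u\log p/n}$; (b) there is $N$ such that in the regime $N$, for all $\xi$ as above, all $t_0\in\mathbb R$ and all $0\le m\le p$, one has $\psi_m\in\Psi_\alpha(\Theta(k_u;\xi,t_0))$ and $\mathbb E_\theta\psi_m\ge1-\eta$ for all $1\le k\le k_u$ and all $\theta\in\Theta_{\pm C R_m}(k;\xi,t_0)$. In particular the upper bound is attained by $\psi_m$ with $m$ minimizing $R_m$. -/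

import Mathlib

open MeasureTheory ProbabilityTheory
open scoped ENNReal Pointwise Matrix

noncomputable section

namespace AdaptiveSep

/-! ### The model -/

/-- The parameter `θ = (β, Σ, σ)`: signal, design covariance, noise level. -/
structure Param (p : ℕ) where
  beta : Fin p → ℝ
  Sig : Matrix (Fin p) (Fin p) ℝ
  sigma : ℝ

/-- The data: `n` observations `Z_i = (Y_i, X_i)` in `ℝ × ℝ^p`. -/
abbrev Data (n p : ℕ) : Type := Fin n → ℝ × (Fin p → ℝ)

/-- Law of one observation: `X ~ N(0, Σ)` and `Y = ⟨X, β⟩ + ε` with `ε ~ N(0, σ²)` independent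
of `X`. -/
def obsLaw {p : ℕ} (θ : Param p) : Measure (ℝ × (Fin p → ℝ)) :=
  ((multivariateGaussian 0 θ.Sig).prod (gaussianReal 0 (θ.sigma ^ 2).toNNReal)).map
    (fun q => (q.1.ofLp ⬝ᵥ θ.beta + q.2, q.1.ofLp))

/-- Law of the data: `n` i.i.d. observations. -/
def dataLaw {p : ℕ} (n : ℕ) (θ : Param p) : Measure (Data n p) :=
  Measure.pi (fun _ : Fin n => obsLaw θ)

theorem measurable_obs {p : ℕ} (β : Fin p → ℝ) :
    Measurable (fun q : EuclideanSpace ℝ (Fin p) × ℝ =>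
      ((q.1.ofLp ⬝ᵥ β + q.2, q.1.ofLp) : ℝ × (Fin p → ℝ))) := by
  have h : Continuous (fun q : EuclideanSpace ℝ (Fin p) × ℝ => q.1.ofLp) :=
    (PiLp.continuous_ofLp 2 _).comp continuous_fst
  refine Measurable.prodMk ?_ h.measurable
  refine Continuous.measurable ?_
  unfold dotProduct
  fun_prop

instance {p : ℕ} (θ : Param p) : IsProbabilityMeasure (obsLaw θ) :=
  Measure.isProbabilityMeasure_map (measurable_obs θ.beta).aemeasurable

instance {p : ℕ} (n : ℕ) (θ : Param p) : IsProbabilityMeasure (dataLaw n θ) := by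
  unfold dataLaw; infer_instance

/-- Number of nonzero entries of a vector. -/
def l0 {p : ℕ} (v : Fin p → ℝ) : ℕ := (Finset.univ.filter (fun j => v j ≠ 0)).card

/-- `ℓ₁` norm. -/
def l1 {p : ℕ} (v : Fin p → ℝ) : ℝ := ∑ j, |v j|

/-- Euclidean norm. -/
def l2 {p : ℕ} (v : Fin p → ℝ) : ℝ := √(∑ j, v j ^ 2)

/-- Maximum norm. -/
def linf {p : ℕ} (v : Fin p → ℝ) : ℝ := ⨆ j, |v j|

/-- The parameter space `Θ(k)`: `‖β‖₀ ≤ k`, `Σ` symmetric with all eigenvalues in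
`[1/M₁, M₁]`, and `0 < σ ≤ M₂`. -/
def paramSpace (p : ℕ) (M₁ M₂ : ℝ) (k : ℕ) : Set (Param p) :=
  {θ | l0 θ.beta ≤ k ∧
    (∃ h : θ.Sig.IsHermitian, ∀ i, 1 / M₁ ≤ h.eigenvalues i ∧ h.eigenvalues i ≤ M₁) ∧
    0 < θ.sigma ∧ θ.sigma ≤ M₂}

/-- The null space `Θ(k; ξ, t₀)`. -/
def nullSpace {p : ℕ} (M₁ M₂ : ℝ) (k : ℕ) (ξ : Fin p → ℝ) (t₀ : ℝ) : Set (Param p) :=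
  {θ | θ ∈ paramSpace p M₁ M₂ k ∧ ξ ⬝ᵥ θ.beta = t₀}

/-- The alternative space `Θ_{±τ}(k; ξ, t₀)`. -/
def altSpace {p : ℕ} (M₁ M₂ : ℝ) (k : ℕ) (ξ : Fin p → ℝ) (t₀ τ : ℝ) : Set (Param p) :=
  {θ | θ ∈ paramSpace p M₁ M₂ k ∧ τ ≤ |ξ ⬝ᵥ θ.beta - t₀|}

/-! ### Tests and the adaptive separation distance -/

/-- The expectation `E_θ ψ` of a (randomized) test. -/
def power {n p : ℕ} (ψ : Data n p → ℝ≥0∞) (θ : Param p) : ℝ≥0∞ := ∫⁻ z, ψ z ∂(dataLaw n θ)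

/-- `Ψ_α(Θ)`: measurable maps from the data to `[0, 1]` with `sup_{θ ∈ Θ} E_θ ψ ≤ α`. -/
def tests (n : ℕ) {p : ℕ} (α : ℝ) (Θ : Set (Param p)) : Set (Data n p → ℝ≥0∞) :=
  {ψ | Measurable ψ ∧ (∀ z, ψ z ≤ 1) ∧ ⨆ θ ∈ Θ, power ψ θ ≤ ENNReal.ofReal α}

/-- The adaptive separation distance `τ_adap(k_u, k; ξ)`: the infimum (in `[0, ∞]`, so that it is
`∞` if there is no such `τ`) of the `τ > 0` with
`sup_{ψ ∈ Ψ_α(Θ(k_u; ξ, t₀))} inf_{θ ∈ Θ_{±τ}(k; ξ, t₀)} E_θ ψ ≥ 1 - η`. -/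
def tauAdap (n : ℕ) {p : ℕ} (M₁ M₂ α η : ℝ) (ku k : ℕ) (ξ : Fin p → ℝ) (t₀ : ℝ) : ℝ≥0∞ :=
  ⨅ (τ : ℝ) (_ : 0 < τ) (_ : ENNReal.ofReal (1 - η) ≤
      ⨆ ψ ∈ tests n α (nullSpace M₁ M₂ ku ξ t₀), ⨅ θ ∈ altSpace M₁ M₂ k ξ t₀ τ, power ψ θ),
    ENNReal.ofReal τ

/-! ### The loading vector and the rates -/

/-- The top-`⌈t⌉` norm `H(t; ξ)` of a loading vector with `|ξ_1| ≥ |ξ_2| ≥ ⋯`. -/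
def topNorm {p : ℕ} (t : ℝ) (ξ : Fin p → ℝ) : ℝ :=
  √(∑ j ∈ Finset.univ.filter (fun j : Fin p => (j : ℕ) < ⌈t⌉₊), ξ j ^ 2)

/-- `|ξ_{m+1}|`, with `ξ_{p+1} = 0` (indices in `Fin p` start at `0`). -/
def nextAbs {p : ℕ} (ξ : Fin p → ℝ) (m : ℕ) : ℝ := if h : m < p then |ξ ⟨m, h⟩| else 0

/-- `H(m; ξ) (1/√n + k_u log p / n) + |ξ_{m+1}| k_u √(log p / n)`. -/
def mixedRate (n : ℕ) {p : ℕ} (ku : ℕ) (ξ : Fin p → ℝ) (m : ℕ) : ℝ :=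
  topNorm m ξ * (1 / √n + ku * Real.log p / n) + nextAbs ξ m * ku * √(Real.log p / n)

/-- The upper rate: the minimum of `mixedRate` over `0 ≤ m ≤ p`. -/
def upperRate (n : ℕ) {p : ℕ} (ku : ℕ) (ξ : Fin p → ℝ) : ℝ :=
  ⨅ m : Fin (p + 1), mixedRate n ku ξ m

/-- `∑_{j ∈ supp ξ} |ξ_j| exp(-ζ/ξ_j²) / √(∑_{j ∈ supp ξ} ξ_j² exp(-ζ/ξ_j²))`. -/
def profile {p : ℕ} (ξ : Fin p → ℝ) (ζ : ℝ) : ℝ :=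
  (∑ j ∈ Finset.univ.filter (fun j => ξ j ≠ 0), |ξ j| * Real.exp (-ζ / ξ j ^ 2)) /
    √(∑ j ∈ Finset.univ.filter (fun j => ξ j ≠ 0), ξ j ^ 2 * Real.exp (-ζ / ξ j ^ 2))

theorem profile_sums_pos {p : ℕ} {ξ : Fin p → ℝ} (hξ : ξ ≠ 0) (ζ : ℝ) :
    0 < (∑ j ∈ Finset.univ.filter (fun j => ξ j ≠ 0), |ξ j| * Real.exp (-ζ / ξ j ^ 2)) ∧
    0 < (∑ j ∈ Finset.univ.filter (fun j => ξ j ≠ 0), ξ j ^ 2 * Real.exp (-ζ / ξ j ^ 2)) := by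
  obtain ⟨i, hi⟩ := Function.ne_iff.mp hξ
  have hne : (Finset.univ.filter (fun j => ξ j ≠ 0)).Nonempty :=
    ⟨i, Finset.mem_filter.2 ⟨Finset.mem_univ _, hi⟩⟩
  constructor
  · refine Finset.sum_pos (fun j hj => ?_) hne
    have hj' : ξ j ≠ 0 := (Finset.mem_filter.1 hj).2
    positivity
  · refine Finset.sum_pos (fun j hj => ?_) hne
    have hj' : ξ j ≠ 0 := (Finset.mem_filter.1 hj).2
    positivity

theorem chebyshev_aux {ι : Type*} (s : Finset ι) (μ a r : ι → ℝ) (hμ : ∀ i ∈ s, 0 ≤ μ i)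
    (h : ∀ i ∈ s, ∀ j ∈ s, 0 ≤ (a i - a j) * (r i - r j)) :
    (∑ i ∈ s, μ i * a i) * (∑ i ∈ s, μ i * r i) ≤
      (∑ i ∈ s, μ i) * (∑ i ∈ s, μ i * (a i * r i)) := by
  have h1 : 0 ≤ ∑ i ∈ s, ∑ j ∈ s, μ i * μ j * ((a i - a j) * (r i - r j)) :=
    Finset.sum_nonneg fun i hi => Finset.sum_nonneg fun j hj =>
      mul_nonneg (mul_nonneg (hμ i hi) (hμ j hj)) (h i hi j hj)
  have h2 : ∑ i ∈ s, ∑ j ∈ s, μ i * μ j * ((a i - a j) * (r i - r j)) =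
      2 * ((∑ i ∈ s, μ i) * (∑ i ∈ s, μ i * (a i * r i)))
        - 2 * ((∑ i ∈ s, μ i * a i) * (∑ i ∈ s, μ i * r i)) := by
    have e1 : ∑ i ∈ s, ∑ j ∈ s, μ i * μ j * ((a i - a j) * (r i - r j)) =
        ∑ i ∈ s, ∑ j ∈ s, ((μ i * (a i * r i)) * μ j + μ i * (μ j * (a j * r j))
          - (μ i * a i) * (μ j * r j) - (μ i * r i) * (μ j * a j)) :=
      Finset.sum_congr rfl fun i _ => Finset.sum_congr rfl fun j _ => by ring
    rw [e1]
    simp only [Finset.sum_sub_distrib, Finset.sum_add_distrib, ← Finset.sum_mul_sum]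
    ring
  linarith

theorem profile_strictAnti {p : ℕ} {ξ : Fin p → ℝ} (hξ : ξ ≠ 0) : StrictAnti (profile ξ) := by
  intro x y hxy
  obtain ⟨hAx, hBx⟩ := profile_sums_pos hξ x
  obtain ⟨hAy, hBy⟩ := profile_sums_pos hξ y
  set s := Finset.univ.filter (fun j => ξ j ≠ 0) with hs
  let μ : Fin p → ℝ := fun j => |ξ j| * Real.exp (-x / ξ j ^ 2)
  let r : Fin p → ℝ := fun j => Real.exp (-(y - x) / ξ j ^ 2)
  have hexp : ∀ j, Real.exp (-y / ξ j ^ 2) = Real.exp (-x / ξ j ^ 2) * r j := by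
    intro j
    simp only [r]
    rw [← Real.exp_add]; congr 1; ring
  have eAy : ∑ j ∈ s, |ξ j| * Real.exp (-y / ξ j ^ 2) = ∑ j ∈ s, μ j * r j :=
    Finset.sum_congr rfl fun j _ => by rw [hexp]; simp only [μ]; ring
  have eBx : ∑ j ∈ s, ξ j ^ 2 * Real.exp (-x / ξ j ^ 2) = ∑ j ∈ s, μ j * |ξ j| :=
    Finset.sum_congr rfl fun j _ => by simp only [μ]; rw [← sq_abs (ξ j)]; ring
  have eBy : ∑ j ∈ s, ξ j ^ 2 * Real.exp (-y / ξ j ^ 2) = ∑ j ∈ s, μ j * (|ξ j| * r j) :=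
    Finset.sum_congr rfl fun j _ => by rw [hexp]; simp only [μ]; rw [← sq_abs (ξ j)]; ring
  have hne : s.Nonempty := by
    obtain ⟨i, hi⟩ := Function.ne_iff.mp hξ
    exact ⟨i, Finset.mem_filter.2 ⟨Finset.mem_univ _, hi⟩⟩
  have hμ : ∀ j ∈ s, 0 < μ j := fun j hj => by
    have hj' : ξ j ≠ 0 := (Finset.mem_filter.1 hj).2
    simp only [μ]; positivity
  have hr : ∀ j ∈ s, r j < 1 := fun j hj => by
    have hj' : ξ j ≠ 0 := (Finset.mem_filter.1 hj).2
    simp only [r]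
    rw [Real.exp_lt_one_iff]
    have : 0 < ξ j ^ 2 := by positivity
    exact div_neg_of_neg_of_pos (by linarith) this
  have hlt : ∑ j ∈ s, μ j * r j < ∑ j ∈ s, μ j :=
    Finset.sum_lt_sum_of_nonempty hne fun j hj => by
      have := hμ j hj; have := hr j hj; nlinarith
  have hmono : ∀ i ∈ s, ∀ j ∈ s, |ξ i| ≤ |ξ j| → r i ≤ r j := fun i hi j hj hij => by
    have hi' : ξ i ≠ 0 := (Finset.mem_filter.1 hi).2
    have hj' : ξ j ≠ 0 := (Finset.mem_filter.1 hj).2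
    simp only [r]
    apply Real.exp_le_exp.2
    have h1 : ξ i ^ 2 ≤ ξ j ^ 2 := sq_le_sq.2 hij
    have h2 : 0 < ξ i ^ 2 := by positivity
    have h3 : (y - x) / ξ j ^ 2 ≤ (y - x) / ξ i ^ 2 :=
      div_le_div_of_nonneg_left (by linarith) h2 h1
    rw [neg_div, neg_div]; linarith
  have hch := chebyshev_aux s μ (fun j => |ξ j|) r (fun j hj => (hμ j hj).le)
    (fun i hi j hj => by
      rcases le_total |ξ i| |ξ j| with h | h
      · exact mul_nonneg_of_nonpos_of_nonpos (by linarith) (by linarith [hmono i hi j hj h])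
      · exact mul_nonneg (by linarith) (by linarith [hmono j hj i hi h]))
  unfold profile
  rw [← hs]
  rw [div_lt_div_iff₀ (Real.sqrt_pos.2 hBy) (Real.sqrt_pos.2 hBx)]
  apply lt_of_pow_lt_pow_left₀ 2 (by positivity)
  rw [mul_pow, mul_pow, Real.sq_sqrt hBx.le, Real.sq_sqrt hBy.le, eAy, eBx, eBy]
  rw [eAy] at hAy
  rw [eBx] at hBx
  change 0 < ∑ j ∈ s, μ j at hAx
  change _ < (∑ j ∈ s, μ j) ^ 2 * _
  calc (∑ j ∈ s, μ j * r j) ^ 2 * ∑ j ∈ s, μ j * |ξ j|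
      = (∑ j ∈ s, μ j * r j) * ((∑ j ∈ s, μ j * |ξ j|) * (∑ j ∈ s, μ j * r j)) := by ring
    _ < (∑ j ∈ s, μ j) * ((∑ j ∈ s, μ j * |ξ j|) * (∑ j ∈ s, μ j * r j)) :=
        mul_lt_mul_of_pos_right hlt (mul_pos hBx hAy)
    _ ≤ (∑ j ∈ s, μ j) * ((∑ j ∈ s, μ j) * (∑ j ∈ s, μ j * (|ξ j| * r j))) :=
        mul_le_mul_of_nonneg_left hch hAx.le
    _ = _ := by ring

theorem continuous_profile {p : ℕ} {ξ : Fin p → ℝ} (hξ : ξ ≠ 0) : Continuous (profile ξ) := by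
  unfold profile
  refine Continuous.div ?_ ?_ (fun ζ => (Real.sqrt_pos.2 (profile_sums_pos hξ ζ).2).ne')
  · exact continuous_finsetSum _ fun j _ => by fun_prop
  · exact Real.continuous_sqrt.comp (continuous_finsetSum _ fun j _ => by fun_prop)

/-- The equation defining `ζ` has exactly one solution. -/
theorem existsUnique_profile_eq {p : ℕ} {ξ : Fin p → ℝ} (hξ : ξ ≠ 0) {K : ℝ} (hK : 0 < K) :
    ∃! ζ, profile ξ ζ = K := by
  set s := Finset.univ.filter (fun j => ξ j ≠ 0) with hs
  have hS : 0 ≤ ∑ j ∈ s, ξ j ^ 2 := Finset.sum_nonneg fun j _ => sq_nonneg _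
  -- a point where the profile is at most `K`
  have hlow : ∃ ζ, profile ξ ζ ≤ K := by
    set S := ∑ j ∈ s, ξ j ^ 2
    let ζ := (S + 1) / K ^ 2
    have hζ : 0 < ζ := by simp only [ζ]; positivity
    refine ⟨ζ, ?_⟩
    obtain ⟨hA, hB⟩ := profile_sums_pos hξ ζ
    unfold profile
    rw [← hs] at hA hB ⊢
    rw [div_le_iff₀ (Real.sqrt_pos.2 hB)]
    refine (pow_le_pow_iff_left₀ hA.le (by positivity) two_ne_zero).1 ?_
    rw [mul_pow, Real.sq_sqrt hB.le]
    have hcs := Finset.sum_mul_sq_le_sq_mul_sq s (fun j => √(Real.exp (-ζ / ξ j ^ 2)))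
      (fun j => |ξ j| * √(Real.exp (-ζ / ξ j ^ 2)))
    have e0 : ∀ j, √(Real.exp (-ζ / ξ j ^ 2)) ^ 2 = Real.exp (-ζ / ξ j ^ 2) := fun j =>
      Real.sq_sqrt (Real.exp_pos _).le
    have e1 : ∑ j ∈ s, √(Real.exp (-ζ / ξ j ^ 2)) * (|ξ j| * √(Real.exp (-ζ / ξ j ^ 2))) =
        ∑ j ∈ s, |ξ j| * Real.exp (-ζ / ξ j ^ 2) :=
      Finset.sum_congr rfl fun j _ => by rw [← e0 j]; simp; ring
    have e2 : ∑ j ∈ s, (|ξ j| * √(Real.exp (-ζ / ξ j ^ 2))) ^ 2 =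
        ∑ j ∈ s, ξ j ^ 2 * Real.exp (-ζ / ξ j ^ 2) :=
      Finset.sum_congr rfl fun j _ => by rw [mul_pow, e0, sq_abs]
    rw [e1, e2] at hcs
    simp only [e0] at hcs
    refine hcs.trans (mul_le_mul_of_nonneg_right ?_ hB.le)
    have hb : ∀ j ∈ s, Real.exp (-ζ / ξ j ^ 2) ≤ ξ j ^ 2 / ζ := fun j hj => by
      have hj' : ξ j ≠ 0 := (Finset.mem_filter.1 hj).2
      have hp : 0 < ξ j ^ 2 := by positivity
      have h1 : ζ / ξ j ^ 2 ≤ Real.exp (ζ / ξ j ^ 2) := by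
        linarith [Real.add_one_le_exp (ζ / ξ j ^ 2)]
      rw [neg_div, Real.exp_neg]
      have h2 : ξ j ^ 2 / ζ = (ζ / ξ j ^ 2)⁻¹ := by rw [inv_div]
      rw [h2]
      exact inv_anti₀ (by positivity) h1
    calc ∑ j ∈ s, Real.exp (-ζ / ξ j ^ 2) ≤ ∑ j ∈ s, ξ j ^ 2 / ζ := Finset.sum_le_sum hb
      _ = S / ζ := by rw [← Finset.sum_div]
      _ ≤ K ^ 2 := by
        rw [div_le_iff₀ hζ]
        simp only [ζ]
        rw [mul_div_cancel₀ _ (by positivity : K ^ 2 ≠ 0)]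
        linarith
  -- a point where the profile is at least `K`
  have hhigh : ∃ ζ, K ≤ profile ξ ζ := by
    obtain ⟨i, hi⟩ := Function.ne_iff.mp hξ
    have hi : ξ i ≠ 0 := hi
    have his : i ∈ s := Finset.mem_filter.2 ⟨Finset.mem_univ _, hi⟩
    set T := ∑ j ∈ s, |ξ j| with hT
    have hTi : ∀ j ∈ s, |ξ j| ≤ T := fun j hj =>
      Finset.single_le_sum (f := fun j => |ξ j|) (fun j _ => abs_nonneg _) hj
    have hT0 : 0 ≤ T := (abs_nonneg _).trans (hTi i his)
    let ζ := -(K ^ 2 * T * |ξ i|)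
    refine ⟨ζ, ?_⟩
    obtain ⟨hA, hB⟩ := profile_sums_pos hξ ζ
    unfold profile
    rw [← hs] at hA hB ⊢
    rw [le_div_iff₀ (Real.sqrt_pos.2 hB)]
    refine (pow_le_pow_iff_left₀ (by positivity) hA.le two_ne_zero).1 ?_
    rw [mul_pow, Real.sq_sqrt hB.le]
    set A := ∑ j ∈ s, |ξ j| * Real.exp (-ζ / ξ j ^ 2)
    have h1 : ∑ j ∈ s, ξ j ^ 2 * Real.exp (-ζ / ξ j ^ 2) ≤ T * A := by
      rw [Finset.mul_sum]
      refine Finset.sum_le_sum fun j hj => ?_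
      rw [← sq_abs, sq, mul_assoc]
      exact mul_le_mul_of_nonneg_right (hTi j hj) (by positivity)
    have h2 : K ^ 2 * T ≤ A := by
      have h3 : |ξ i| * Real.exp (-ζ / ξ i ^ 2) ≤ A :=
        Finset.single_le_sum (f := fun j => |ξ j| * Real.exp (-ζ / ξ j ^ 2))
          (fun j _ => by positivity) his
      have hpos : 0 < |ξ i| := abs_pos.2 hi
      have h4 : -ζ / ξ i ^ 2 ≤ Real.exp (-ζ / ξ i ^ 2) := by
        linarith [Real.add_one_le_exp (-ζ / ξ i ^ 2)]
      have h5 : |ξ i| * (-ζ / ξ i ^ 2) = K ^ 2 * T := by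
        have h6 : |ξ i| * |ξ i| = ξ i ^ 2 := by rw [← sq, sq_abs]
        have h7 : ξ i ^ 2 ≠ 0 := pow_ne_zero 2 hi
        simp only [ζ]
        rw [neg_neg, mul_div_assoc', div_eq_iff h7, ← h6]
        ring
      calc K ^ 2 * T = |ξ i| * (-ζ / ξ i ^ 2) := h5.symm
        _ ≤ |ξ i| * Real.exp (-ζ / ξ i ^ 2) := mul_le_mul_of_nonneg_left h4 hpos.le
        _ ≤ A := h3
    calc K ^ 2 * ∑ j ∈ s, ξ j ^ 2 * Real.exp (-ζ / ξ j ^ 2) ≤ K ^ 2 * (T * A) :=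
          mul_le_mul_of_nonneg_left h1 (by positivity)
      _ = (K ^ 2 * T) * A := by ring
      _ ≤ A * A := mul_le_mul_of_nonneg_right h2 hA.le
      _ = A ^ 2 := by ring
  obtain ⟨ζ, hζ⟩ := mem_range_of_exists_le_of_exists_ge (continuous_profile hξ) hlow hhigh
  exact ⟨ζ, hζ, fun y hy => (profile_strictAnti hξ).injective (hy.trans hζ.symm)⟩

open Classical in
/-- The solution `ζ` of `profile ξ ζ = k_u / 2`; it exists and is unique for `ξ ≠ 0`, `k_u ≥ 1`. -/
def zeta {p : ℕ} (ku : ℕ) (ξ : Fin p → ℝ) : ℝ :=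
  if h : ∃ ζ, profile ξ ζ = ku / 2 then h.choose else 0

theorem profile_zeta {p : ℕ} {ku : ℕ} (hku : 1 ≤ ku) {ξ : Fin p → ℝ} (hξ : ξ ≠ 0) :
    profile ξ (zeta ku ξ) = ku / 2 := by
  have hK : (0 : ℝ) < ku / 2 := by
    have : (1 : ℝ) ≤ ku := by exact_mod_cast hku
    linarith
  have h : ∃ ζ, profile ξ ζ = ku / 2 := (existsUnique_profile_eq hξ hK).exists
  unfold zeta
  rw [dif_pos h]
  exact h.choose_spec

/-- `λ = √(ζ₊)`. -/
def lam {p : ℕ} (ku : ℕ) (ξ : Fin p → ℝ) : ℝ := √(max (zeta ku ξ) 0)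

/-- `ν₁ = λ k_u + √(∑_{j ∈ supp ξ} ξ_j² exp(-λ²/ξ_j²))`. -/
def nu1 {p : ℕ} (ku : ℕ) (ξ : Fin p → ℝ) : ℝ :=
  lam ku ξ * ku + √(∑ j ∈ Finset.univ.filter (fun j => ξ j ≠ 0),
    ξ j ^ 2 * Real.exp (-(lam ku ξ) ^ 2 / ξ j ^ 2))

/-- `ν₂ = H(k_u; ξ)`. -/
def nu2 {p : ℕ} (ku : ℕ) (ξ : Fin p → ℝ) : ℝ := topNorm ku ξ

/-- The lower rate `ν₁/√n ∨ ν₂ k_u log p / n`. -/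
def lowerRate (n : ℕ) {p : ℕ} (ku : ℕ) (ξ : Fin p → ℝ) : ℝ :=
  max (nu1 ku ξ / √n) (nu2 ku ξ * (ku * Real.log p / n))

/-- `ξ` is a nonzero loading vector with `|ξ_1| ≥ |ξ_2| ≥ ⋯ ≥ |ξ_p|`. -/
def IsLoading {p : ℕ} (ξ : Fin p → ℝ) : Prop := ξ ≠ 0 ∧ Antitone (fun j => |ξ j|)

/-- The asymptotic regime: `n, p, k_u ≥ N`, `k_u ≤ C₀ p^γ` and `n ≥ c k_u log p`. -/
def Regime (C₀ γ c : ℝ) (N n p ku : ℕ) : Prop :=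
  N ≤ n ∧ N ≤ p ∧ N ≤ ku ∧ (ku : ℝ) ≤ C₀ * (p : ℝ) ^ γ ∧ c * ku * Real.log p ≤ n

/-! ### The mixed test -/

/-- The design matrix `X`, with rows `X_i`. -/
def design {n p : ℕ} (z : Data n p) : Matrix (Fin n) (Fin p) ℝ := Matrix.of fun i => (z i).2

/-- The response vector `Y`. -/
def response {n p : ℕ} (z : Data n p) : Fin n → ℝ := fun i => (z i).1

/-- `Σ̂ = n⁻¹ Xᵀ X`. -/
def sampleCov {n p : ℕ} (z : Data n p) : Matrix (Fin p) (Fin p) ℝ :=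
  (n : ℝ)⁻¹ • ((design z)ᵀ * design z)

/-- Feasibility for the projection direction: `‖Σ̂ u - v‖_∞ ≤ Cξ ‖v‖₂ √(log p / n)`. -/
def Feasible {n p : ℕ} (Cξ : ℝ) (z : Data n p) (v u : Fin p → ℝ) : Prop :=
  ∀ j, |(sampleCov z *ᵥ u - v) j| ≤ Cξ * l2 v * √(Real.log p / n)

/-- `u` minimizes `uᵀ Σ̂ u` among feasible vectors. -/
def IsDirection {n p : ℕ} (Cξ : ℝ) (z : Data n p) (v u : Fin p → ℝ) : Prop :=
  Feasible Cξ z v u ∧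
    ∀ u', Feasible Cξ z v u' → u ⬝ᵥ sampleCov z *ᵥ u ≤ u' ⬝ᵥ sampleCov z *ᵥ u'

open Classical in
/-- The projection direction `û`: a minimizer of `uᵀ Σ̂ u` over the feasible set, and `0` if the
feasible set is empty. -/
def direction {n p : ℕ} (Cξ : ℝ) (z : Data n p) (v : Fin p → ℝ) : Fin p → ℝ :=
  if h : ∃ u, IsDirection Cξ z v u then h.choose else 0

/-- The debiased interval for `vᵀ β`, from a pilot estimate `b` of `β` and `s` of `σ`: centre
`vᵀ b + n⁻¹ ûᵀ Xᵀ (Y - X b)`, radius `s (A₁ √(ûᵀ Σ̂ û) / √n + A₂ ‖v‖₂ k_u log p / n)`. -/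
def debiasedCI {n p : ℕ} (Cξ A₁ A₂ : ℝ) (ku : ℕ) (b : Fin p → ℝ) (s : ℝ) (z : Data n p)
    (v : Fin p → ℝ) : Set ℝ :=
  let u := direction Cξ z v
  let L := v ⬝ᵥ b + u ⬝ᵥ ((n : ℝ)⁻¹ • ((design z)ᵀ *ᵥ (response z - design z *ᵥ b)))
  let r := s * (A₁ * √(u ⬝ᵥ sampleCov z *ᵥ u) / √n + A₂ * l2 v * (ku * Real.log p / n))
  Set.Icc (L - r) (L + r)

/-- The plug-in interval for `vᵀ β`: centre `vᵀ b`, radius `A₃ s ‖v‖_∞ k_u √(log p / n)`. -/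
def plugInCI (n : ℕ) {p : ℕ} (A₃ : ℝ) (ku : ℕ) (b : Fin p → ℝ) (s : ℝ) (v : Fin p → ℝ) :
    Set ℝ :=
  let r := A₃ * s * linf v * ku * √(Real.log p / n)
  Set.Icc (v ⬝ᵥ b - r) (v ⬝ᵥ b + r)

/-- `(ξ_1, …, ξ_m, 0, …, 0)`. -/
def head {p : ℕ} (ξ : Fin p → ℝ) (m : ℕ) : Fin p → ℝ := fun j => if (j : ℕ) < m then ξ j else 0

open Classical in
/-- The mixed test with cutoff `m`: it rejects when `t₀` is outside the Minkowski sum of the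
debiased interval for the `m` leading coordinates of the loading vector and the plug-in interval
for the remaining ones. -/
def mixedTest {n p : ℕ} (Cξ A₁ A₂ A₃ : ℝ) (ku : ℕ) (bhat : Data n p → Fin p → ℝ)
    (shat : Data n p → ℝ) (ξ : Fin p → ℝ) (t₀ : ℝ) (m : ℕ) : Data n p → ℝ≥0∞ :=
  fun z =>
    if t₀ ∈ debiasedCI Cξ A₁ A₂ ku (bhat z) (shat z) z (head ξ m) +
        plugInCI n A₃ ku (bhat z) (shat z) (ξ - head ξ m)
    then 0 else 1

/-- The event that the pilot estimates are accurate: `0.9 σ̂ < σ < 1.1 σ̂`,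
`‖β̂ - β‖₁ ≤ c_β σ k_u √(log p / n)` and `‖β̂ - β‖₂ ≤ C_β σ √(k_u log p / n)`. -/
def accurate {n p : ℕ} (cβ Cβ : ℝ) (ku : ℕ) (bhat : Data n p → Fin p → ℝ)
    (shat : Data n p → ℝ) (θ : Param p) : Set (Data n p) :=
  {z | 0.9 * shat z < θ.sigma ∧ θ.sigma < 1.1 * shat z ∧
    l1 (bhat z - θ.beta) ≤ cβ * θ.sigma * ku * √(Real.log p / n) ∧
    l2 (bhat z - θ.beta) ≤ Cβ * θ.sigma * √(ku * Real.log p / n)}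

end AdaptiveSep

end

open AdaptiveSep

namespace AdaptiveSep

/-! ### Quadratic forms -/

/-! Upper bound and attainment. Put q = σ√(k_u log p / n). With high probability the Gram matrix is
bounded below on 2k_u-sparse vectors, the correlations of the columns with the noise are O(σ√(n log
p)), and the squared norm of the noise is close to nσ² (`GoodDesign`). Expanding the residual sum of
squares around β then shows that a near-minimizer over k_u-sparse vectors is within O(q) of β in ℓ₂,
hence within O(√k_u q) in ℓ₁, and that its residual estimates σ (`accurate_of_goodDesign`). For the
debiased interval, Σ⁻¹v is feasible with high probability (`measure_not_feasible`), so û exists and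
‖Xû‖₂ = O(√n ‖v‖₂). The error of the centre is a bias, at most ‖Σ̂û - v‖_∞ ‖β̂ - β‖₁, plus a noise
term that is Gaussian given the design (`measure_noise_gt`). The plug-in error is bounded by
Hölder's inequality, and since |ξ| is decreasing the sup norm of the tail of ξ is |ξ_{m+1}|. The
radii add up to O(R_m) (`mixedTest_analysis`).

Lower bound. A test of level α on all nulls with power 1 - η at one alternative separates that
alternative from every mixture of nulls, which is impossible if the χ² divergence is small
(`lintegral_le_of_chiSq`, `le_tauAdap_of_prior`). The alternative has a one-sparse β and identity
covariance, so it lies in Θ(k) for every k ≥ 1; the nulls use all k_u coordinates. They arise by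
shearing the standard Gaussian vector (ε, X) by x ↦ x + (g·x)d with |g| = 1 and g ⊥ d. A shear
preserves volume, the result is again a Gaussian linear model with modified β, Σ, σ
(`map_obsMap_shear`), and the product of two likelihood ratios integrates to at most exp(2 d·d')
(`lintegral_shearLR_mul`).

Two choices of (g, d) give the two terms. If g is the noise coordinate, β can be shifted by a
prescribed δ. One coordinate is drawn from each of several groups, with entry proportional to 1/ξ_j
so that ξ·δ does not depend on the draw. The sampling weights proportional to |ξ_j| exp(-λ²/ξ_j²)
balance the χ² cost, and grouping them greedily into blocks of mass in [1, 2] gives the order ν₁/√n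
(`le_tauAdap_nu1`). If g is split equally between the noise and the head of ξ, then regressing the
noise on the sheared design moves β along the head by an amount of order |d|², whereas d itself is
orthogonal to ξ and hidden among many orthogonal candidates. Taking |d|² ≍ k_u log p / n gives the
ν₂ term (`le_tauAdap_nu2`). Hiding d needs k_u² to be smaller than p by a power of p, which is where
γ < 1/2 enters. -/

theorem quadForm_eq_sum {p : ℕ} {S : Matrix (Fin p) (Fin p) ℝ} (h : S.IsHermitian)
    (x : EuclideanSpace ℝ (Fin p)) :
    x.ofLp ⬝ᵥ S *ᵥ x.ofLp = ∑ i, h.eigenvalues i * inner ℝ (h.eigenvectorBasis i) x ^ 2 := by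
  have h1 : x.ofLp ⬝ᵥ S *ᵥ x.ofLp = inner ℝ x (WithLp.toLp 2 (S *ᵥ x.ofLp)) := by
    simp [EuclideanSpace.inner_eq_star_dotProduct, dotProduct_comm]
  rw [h1, ← h.eigenvectorBasis.sum_inner_mul_inner]
  refine Finset.sum_congr rfl fun i _ => ?_
  have h2 : inner ℝ (h.eigenvectorBasis i) (WithLp.toLp 2 (S *ᵥ x.ofLp)) =
      h.eigenvalues i * inner ℝ (h.eigenvectorBasis i) x := by
    have h3 := h.mulVec_eigenvectorBasis i
    have hT : Sᵀ = S := by simpa [Matrix.IsHermitian] using h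
    simp only [EuclideanSpace.inner_eq_star_dotProduct, star_trivial]
    rw [dotProduct_comm, Matrix.dotProduct_mulVec, ← Matrix.mulVec_transpose, hT, h3,
      smul_dotProduct, dotProduct_comm, smul_eq_mul]
  rw [h2, real_inner_comm]; ring

theorem dot_self_eq_sum {p : ℕ} {S : Matrix (Fin p) (Fin p) ℝ} (h : S.IsHermitian)
    (x : EuclideanSpace ℝ (Fin p)) :
    x.ofLp ⬝ᵥ x.ofLp = ∑ i, inner ℝ (h.eigenvectorBasis i) x ^ 2 := by
  have h1 : x.ofLp ⬝ᵥ x.ofLp = inner ℝ x x := by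
    rw [EuclideanSpace.inner_eq_star_dotProduct, star_trivial]
  rw [h1, ← h.eigenvectorBasis.sum_inner_mul_inner]
  exact Finset.sum_congr rfl fun i _ => by rw [real_inner_comm]; ring

theorem quadForm_bounds {p : ℕ} {S : Matrix (Fin p) (Fin p) ℝ} {l u : ℝ} (h : S.IsHermitian)
    (hS : ∀ i, l ≤ h.eigenvalues i ∧ h.eigenvalues i ≤ u) (v : Fin p → ℝ) :
    l * (v ⬝ᵥ v) ≤ v ⬝ᵥ S *ᵥ v ∧ v ⬝ᵥ S *ᵥ v ≤ u * (v ⬝ᵥ v) := by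
  have h1 := quadForm_eq_sum h (WithLp.toLp 2 v)
  have h2 := dot_self_eq_sum h (WithLp.toLp 2 v)
  simp only at h1 h2
  rw [h1, h2, Finset.mul_sum, Finset.mul_sum]
  exact ⟨Finset.sum_le_sum fun i _ => mul_le_mul_of_nonneg_right (hS i).1 (sq_nonneg _),
    Finset.sum_le_sum fun i _ => mul_le_mul_of_nonneg_right (hS i).2 (sq_nonneg _)⟩

/-- Testing the form on unit eigenvectors. This direction places the parameters of the lower bound
in the parameter space. -/
theorem eigenvalues_bounds {p : ℕ} {S : Matrix (Fin p) (Fin p) ℝ} {l u : ℝ} (h : S.IsHermitian)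
    (hS : ∀ v, l * (v ⬝ᵥ v) ≤ v ⬝ᵥ S *ᵥ v ∧ v ⬝ᵥ S *ᵥ v ≤ u * (v ⬝ᵥ v)) (i : Fin p) :
    l ≤ h.eigenvalues i ∧ h.eigenvalues i ≤ u := by
  have h1 := h.eigenvalues_eq i
  have h2 : (h.eigenvectorBasis i).ofLp ⬝ᵥ (h.eigenvectorBasis i).ofLp = 1 := by
    have h3 := h.eigenvectorBasis.inner_eq_one i
    rwa [EuclideanSpace.inner_eq_star_dotProduct, star_trivial] at h3
  have h4 := hS (h.eigenvectorBasis i).ofLp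
  rw [h2] at h4
  simp only [star_trivial, RCLike.re_to_real] at h1
  rw [← h1] at h4
  simpa using h4

theorem posSemidef_of_bounds {p : ℕ} {S : Matrix (Fin p) (Fin p) ℝ} (h : S.IsHermitian)
    (hS : ∀ v, 0 ≤ v ⬝ᵥ S *ᵥ v) : S.PosSemidef :=
  Matrix.PosSemidef.of_dotProduct_mulVec_nonneg h fun x => by simpa using hS x

theorem dot_self_nonneg {ι : Type*} [Fintype ι] (v : ι → ℝ) : 0 ≤ v ⬝ᵥ v :=
  Finset.sum_nonneg fun _ _ => mul_self_nonneg _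

/-- Consequences of membership in the parameter space, in terms of quadratic forms. -/
theorem paramSpace_quadForm {p : ℕ} {M₁ M₂ : ℝ} {k : ℕ} (hM : 1 < M₁) {θ : Param p}
    (hθ : θ ∈ paramSpace p M₁ M₂ k) :
    θ.Sig.PosSemidef ∧ ∀ v, 1 / M₁ * (v ⬝ᵥ v) ≤ v ⬝ᵥ θ.Sig *ᵥ v ∧
      v ⬝ᵥ θ.Sig *ᵥ v ≤ M₁ * (v ⬝ᵥ v) := by
  obtain ⟨-, ⟨h, hS⟩, -⟩ := hθ
  have hb := quadForm_bounds h hS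
  refine ⟨posSemidef_of_bounds h fun v => le_trans ?_ (hb v).1, hb⟩
  exact mul_nonneg (by positivity) (dot_self_nonneg v)

/-! ### Linear functionals of one observation -/

theorem map_dot_multivariateGaussian {p : ℕ} {S : Matrix (Fin p) (Fin p) ℝ} (hS : S.PosSemidef)
    (a : Fin p → ℝ) :
    (multivariateGaussian 0 S).map (fun x => a ⬝ᵥ x.ofLp) =
      gaussianReal 0 (a ⬝ᵥ S *ᵥ a).toNNReal := by
  have hm : Measurable (fun x : EuclideanSpace ℝ (Fin p) => a ⬝ᵥ x.ofLp) := by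
    refine Continuous.measurable ?_
    unfold dotProduct
    fun_prop
  have : IsProbabilityMeasure ((multivariateGaussian 0 S).map (fun x => a ⬝ᵥ x.ofLp)) :=
    Measure.isProbabilityMeasure_map hm.aemeasurable
  have h0 : 0 ≤ a ⬝ᵥ S *ᵥ a := by simpa using hS.dotProduct_mulVec_nonneg a
  refine Measure.ext_of_charFun ?_
  ext t
  have h1 := charFun_multivariateGaussian (μ := 0) hS (WithLp.toLp 2 (t • a))
  rw [charFun_apply] at h1
  rw [charFun_apply_real, integral_map hm.aemeasurable (by fun_prop), charFun_gaussianReal]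
  have h2 : ∀ x : EuclideanSpace ℝ (Fin p), inner ℝ x (WithLp.toLp 2 (t • a)) =
      t * (a ⬝ᵥ x.ofLp) := fun x => by
    simp [EuclideanSpace.inner_eq_star_dotProduct]
  simp only [h2] at h1
  push_cast at h1
  rw [h1]
  congr 1
  simp only [inner_zero_right, Complex.ofReal_zero, zero_mul, Matrix.mulVec_smul,
    smul_dotProduct, dotProduct_smul, smul_eq_mul, mul_zero, zero_sub, Real.coe_toNNReal _ h0]
  push_cast
  ring

/-- The residual recovers the noise, so the functional is a sum of two independent Gaussians.
Second-moment concentration and the identification of sheared laws both reduce to these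
one-dimensional projections. -/
theorem map_linear_obsLaw {p : ℕ} {θ : Param p} (hS : θ.Sig.PosSemidef) (a : Fin p → ℝ) (b : ℝ) :
    (obsLaw θ).map (fun q => a ⬝ᵥ q.2 + b * (q.1 - q.2 ⬝ᵥ θ.beta)) =
      gaussianReal 0 (a ⬝ᵥ θ.Sig *ᵥ a + b ^ 2 * θ.sigma ^ 2).toNNReal := by
  have hm : Measurable (fun q : ℝ × (Fin p → ℝ) => a ⬝ᵥ q.2 + b * (q.1 - q.2 ⬝ᵥ θ.beta)) := by
    refine Continuous.measurable ?_
    unfold dotProduct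
    fun_prop
  have hm1 : Measurable (fun x : EuclideanSpace ℝ (Fin p) => a ⬝ᵥ x.ofLp) := by
    refine Continuous.measurable ?_
    unfold dotProduct
    fun_prop
  have h0 : 0 ≤ a ⬝ᵥ θ.Sig *ᵥ a := by simpa using hS.dotProduct_mulVec_nonneg a
  unfold obsLaw
  rw [Measure.map_map hm (measurable_obs θ.beta)]
  have h1 : ((fun q : ℝ × (Fin p → ℝ) => a ⬝ᵥ q.2 + b * (q.1 - q.2 ⬝ᵥ θ.beta)) ∘
      fun q : EuclideanSpace ℝ (Fin p) × ℝ => (q.1.ofLp ⬝ᵥ θ.beta + q.2, q.1.ofLp)) =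
      (fun q : ℝ × ℝ => q.1 + q.2) ∘ Prod.map (fun x => a ⬝ᵥ x.ofLp) (fun e => b * e) := by
    ext q; simp
  rw [h1, ← Measure.map_map (by fun_prop) (by fun_prop), ← Measure.map_prod_map _ _ hm1 (by fun_prop),
    map_dot_multivariateGaussian hS, gaussianReal_map_const_mul]
  have h2 := gaussianReal_conv_gaussianReal (m₁ := 0) (m₂ := b * 0)
    (v₁ := (a ⬝ᵥ θ.Sig *ᵥ a).toNNReal) (v₂ := NNReal.mk (b ^ 2) (sq_nonneg b) * (θ.sigma ^ 2).toNNReal)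
  unfold Measure.conv at h2
  rw [h2]
  congr 1
  · simp
  · rw [Real.toNNReal_add h0 (by positivity), Real.toNNReal_mul (by positivity)]
    congr 2
    exact (Real.toNNReal_of_nonneg _).symm

end AdaptiveSep

namespace AdaptiveSep

/-! ### Products and chi-square concentration -/

theorem lintegral_pi_prod {ι : Type*} [Fintype ι] {E : ι → Type*} [∀ i, MeasurableSpace (E i)]
    (μ : ∀ i, Measure (E i)) [∀ i, IsProbabilityMeasure (μ i)] {f : ∀ i, E i → ℝ≥0∞}
    (hf : ∀ i, Measurable (f i)) :
    ∫⁻ x, ∏ i, f i (x i) ∂(Measure.pi μ) = ∏ i, ∫⁻ x, f i x ∂(μ i) := by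
  have h := iIndepFun_pi (μ := μ) (X := f) fun i => (hf i).aemeasurable
  rw [lintegral_prod_eq_prod_lintegral_of_indepFun Finset.univ _ h
    fun i => (hf i).comp (measurable_pi_apply i)]
  exact Finset.prod_congr rfl fun i _ =>
    (measurePreserving_eval μ i).lintegral_comp (hf i)

/-- This is log(1 - u) ≥ -u - u² in exponential form. At u = 2l it bounds the Laplace transform (1 -
2l)^(-1/2) of a squared standard Gaussian by exp(l + 2l²). -/
theorem one_le_mul_exp {u : ℝ} (h₁ : -(1 / 2) ≤ u) (h₂ : u ≤ 1 / 2) :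
    1 ≤ (1 - u) * Real.exp (u + u ^ 2) := by
  rcases le_total 0 u with hu | hu
  · have h := Real.quadratic_le_exp_of_nonneg (x := u + u ^ 2) (by positivity)
    have h' : 1 ≤ (1 - u) * (1 + (u + u ^ 2) + (u + u ^ 2) ^ 2 / 2) := by
      have : (1 - u) * (1 + (u + u ^ 2) + (u + u ^ 2) ^ 2 / 2) - 1 =
        u ^ 2 / 2 * (1 - u - u ^ 2 - u ^ 3) := by ring
      have : 0 ≤ u ^ 2 / 2 * (1 - u - u ^ 2 - u ^ 3) := by
        have h2 : u ^ 2 ≤ (1 / 2) ^ 2 := pow_le_pow_left₀ hu h₂ 2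
        have h3 : u ^ 3 ≤ (1 / 2) ^ 3 := pow_le_pow_left₀ hu h₂ 3
        exact mul_nonneg (by positivity) (by linarith)
      linarith
    exact h'.trans (mul_le_mul_of_nonneg_left h (by linarith))
  · have hy : |-(u + u ^ 2)| ≤ 1 := abs_le.2 ⟨by nlinarith, by nlinarith⟩
    have h := (abs_le.1 (Real.abs_exp_sub_one_sub_id_le hy)).2
    have h2 : Real.exp (-(u + u ^ 2)) ≤ 1 - u := by
      have : 0 ≤ u ^ 3 * (-2 - u) := mul_nonneg_of_nonpos_of_nonpos
        (Odd.pow_nonpos (by decide) hu) (by linarith)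
      nlinarith
    have h3 : Real.exp (-(u + u ^ 2)) * Real.exp (u + u ^ 2) = 1 := by
      rw [← Real.exp_add]; simp
    exact h3.symm.le.trans (mul_le_mul_of_nonneg_right h2 (Real.exp_pos _).le)

theorem lintegral_exp_sq_gaussian_le {l : ℝ} (h₁ : -(1 / 4) ≤ l) (h₂ : l ≤ 1 / 4) :
    ∫⁻ x, ENNReal.ofReal (Real.exp (l * x ^ 2)) ∂(gaussianReal 0 1) ≤
      ENNReal.ofReal (Real.exp (l + 2 * l ^ 2)) := by
  have hb : 0 < 1 / 2 - l := by linarith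
  rw [gaussianReal_of_var_ne_zero 0 one_ne_zero,
    lintegral_withDensity_eq_lintegral_mul _ (measurable_gaussianPDF 0 1) (by fun_prop)]
  have h : ∀ x : ℝ, (gaussianPDF 0 1 * fun x => ENNReal.ofReal (Real.exp (l * x ^ 2))) x =
      ENNReal.ofReal ((√(2 * Real.pi))⁻¹ * Real.exp (-(1 / 2 - l) * x ^ 2)) := fun x => by
    simp only [Pi.mul_apply, gaussianPDF, gaussianPDFReal]
    rw [← ENNReal.ofReal_mul (by positivity), mul_assoc, ← Real.exp_add]
    congr 3
    · simp
    · simp; ring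
  simp only [h]
  rw [← ofReal_integral_eq_lintegral_ofReal ((integrable_exp_neg_mul_sq hb).const_mul _)
    (Filter.Eventually.of_forall fun x => by positivity), integral_const_mul, integral_gaussian]
  refine ENNReal.ofReal_le_ofReal ?_
  have h3 := one_le_mul_exp (u := 2 * l) (by linarith) (by linarith)
  have hp := Real.pi_pos
  rw [inv_mul_le_iff₀ (by positivity)]
  rw [← Real.sqrt_sq (Real.exp_pos (l + 2 * l ^ 2)).le, ← Real.sqrt_mul (by positivity)]
  refine Real.sqrt_le_sqrt ?_
  rw [div_le_iff₀ hb, ← Real.exp_nat_mul]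
  have h4 : ((2 : ℕ) : ℝ) * (l + 2 * l ^ 2) = 2 * l + (2 * l) ^ 2 := by push_cast; ring
  rw [h4]
  calc Real.pi ≤ Real.pi * ((1 - 2 * l) * Real.exp (2 * l + (2 * l) ^ 2)) :=
        le_mul_of_one_le_right hp.le h3
    _ = _ := by ring

variable {α : Type*} [MeasurableSpace α]

theorem lintegral_exp_sq_le {ν : Measure α} {g : α → ℝ} (hg : Measurable g) {v : ℝ} (hv : 0 < v)
    (hlaw : ν.map g = gaussianReal 0 v.toNNReal) {l : ℝ} (h₁ : -(1 / 4) ≤ l) (h₂ : l ≤ 1 / 4) :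
    ∫⁻ z, ENNReal.ofReal (Real.exp (l * (g z ^ 2 / v))) ∂ν ≤
      ENNReal.ofReal (Real.exp (l + 2 * l ^ 2)) := by
  have h : (ν.map g).map (fun x => (√v)⁻¹ * x) = gaussianReal 0 1 := by
    rw [hlaw, gaussianReal_map_const_mul, mul_zero]
    congr 1
    ext
    simp [Real.sq_sqrt hv.le, hv.le, hv.ne']
  refine le_trans (le_of_eq ?_) (lintegral_exp_sq_gaussian_le h₁ h₂)
  rw [← h, Measure.map_map (by fun_prop) hg, lintegral_map (by fun_prop) (by fun_prop)]
  refine lintegral_congr fun z => ?_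
  simp only [Function.comp]
  rw [mul_pow, inv_pow, Real.sq_sqrt hv.le]
  congr 3
  field_simp

/-- Chernoff bounds for a sum of squares of i.i.d. centred Gaussians. -/
theorem chernoff_sq {n : ℕ} {ν : Measure α} [IsProbabilityMeasure ν] {g : α → ℝ}
    (hg : Measurable g) {v : ℝ} (hv : 0 < v) (hlaw : ν.map g = gaussianReal 0 v.toNNReal)
    {l r : ℝ} (h₁ : -(1 / 4) ≤ l) (h₂ : l ≤ 1 / 4) :
    Measure.pi (fun _ : Fin n => ν) {z | l * r ≤ l * ∑ i, g (z i) ^ 2 / v} ≤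
      ENNReal.ofReal (Real.exp (n * (l + 2 * l ^ 2) - l * r)) := by
  have hm : ∀ _ : Fin n, Measurable fun z => ENNReal.ofReal (Real.exp (l * (g z ^ 2 / v))) :=
    fun _ => by fun_prop
  have h := mul_meas_ge_le_lintegral (μ := Measure.pi (fun _ : Fin n => ν))
    (f := fun z => ∏ i, ENNReal.ofReal (Real.exp (l * (g (z i) ^ 2 / v))))
    (Finset.measurable_prod _ fun i _ => (hm i).comp (measurable_pi_apply i))
    (ENNReal.ofReal (Real.exp (l * r)))
  rw [lintegral_pi_prod (fun _ : Fin n => ν) hm] at h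
  have hset : {z : Fin n → α | l * r ≤ l * ∑ i, g (z i) ^ 2 / v} ⊆
      {z | ENNReal.ofReal (Real.exp (l * r)) ≤
        ∏ i, ENNReal.ofReal (Real.exp (l * (g (z i) ^ 2 / v)))} := fun z hz => by
    simp only [Set.mem_ofPred_eq] at hz ⊢
    rw [← ENNReal.ofReal_prod_of_nonneg fun i _ => (Real.exp_pos _).le, ← Real.exp_sum,
      ← Finset.mul_sum]
    exact ENNReal.ofReal_le_ofReal (Real.exp_le_exp.2 hz)
  refine (measure_mono hset).trans ?_
  have h2 : ∏ _i : Fin n, ∫⁻ z, ENNReal.ofReal (Real.exp (l * (g z ^ 2 / v))) ∂ν ≤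
      ENNReal.ofReal (Real.exp (n * (l + 2 * l ^ 2))) := by
    rw [Finset.prod_const, Finset.card_univ, Fintype.card_fin, Real.exp_nat_mul,
      ENNReal.ofReal_pow (Real.exp_pos _).le]
    exact pow_le_pow_left₀ (zero_le) (lintegral_exp_sq_le hg hv hlaw h₁ h₂) n
  rw [Real.exp_sub, ENNReal.ofReal_div_of_pos (Real.exp_pos _),
    ENNReal.le_div_iff_mul_le (Or.inl (by simp [Real.exp_pos])) (Or.inl ENNReal.ofReal_ne_top),
    mul_comm]
  exact h.trans h2

theorem measure_sum_sq_ge {n : ℕ} {ν : Measure α} [IsProbabilityMeasure ν] {g : α → ℝ}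
    (hg : Measurable g) {v : ℝ} (hv : 0 < v) (hlaw : ν.map g = gaussianReal 0 v.toNNReal)
    {t : ℝ} (h₁ : 0 ≤ t) (h₂ : t ≤ 1) :
    Measure.pi (fun _ : Fin n => ν) {z | n * v * (1 + t) ≤ ∑ i, g (z i) ^ 2} ≤
      ENNReal.ofReal (Real.exp (-(n * t ^ 2 / 8))) := by
  -- At l = t/4 the exponent n(l + 2l²) - l n(1 + t) equals -nt²/8.
  have h := chernoff_sq (n := n) hg hv hlaw (l := t / 4) (r := n * (1 + t)) (by linarith)
    (by linarith)
  refine le_trans (measure_mono fun z hz => ?_) (h.trans (ENNReal.ofReal_le_ofReal ?_))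
  · simp only [Set.mem_ofPred_eq] at hz ⊢
    refine mul_le_mul_of_nonneg_left ?_ (by linarith)
    rw [← Finset.sum_div, le_div_iff₀ hv]
    linarith
  · exact Real.exp_le_exp.2 (by nlinarith)

theorem measure_sum_sq_le {n : ℕ} {ν : Measure α} [IsProbabilityMeasure ν] {g : α → ℝ}
    (hg : Measurable g) {v : ℝ} (hv : 0 < v) (hlaw : ν.map g = gaussianReal 0 v.toNNReal)
    {t : ℝ} (h₁ : 0 ≤ t) (h₂ : t ≤ 1) :
    Measure.pi (fun _ : Fin n => ν) {z | ∑ i, g (z i) ^ 2 ≤ n * v * (1 - t)} ≤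
      ENNReal.ofReal (Real.exp (-(n * t ^ 2 / 8))) := by
  have h := chernoff_sq (n := n) hg hv hlaw (l := -(t / 4)) (r := n * (1 - t)) (by linarith)
    (by linarith)
  refine le_trans (measure_mono fun z hz => ?_) (h.trans (ENNReal.ofReal_le_ofReal ?_))
  · simp only [Set.mem_ofPred_eq] at hz ⊢
    refine mul_le_mul_of_nonpos_left ?_ (by linarith)
    rw [← Finset.sum_div, div_le_iff₀ hv]
    linarith
  · exact Real.exp_le_exp.2 (by nlinarith)

end AdaptiveSep

namespace AdaptiveSep

/-! ### Second moments of linear functionals of the data -/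

/-- The scale s may exceed the variance v, and v may vanish: the polarization argument below applies
this to a sum and a difference whose variances are only known to lie in [0, 4]. -/
theorem measure_abs_sum_sq_sub_ge {α : Type*} [MeasurableSpace α] {n : ℕ} {ν : Measure α}
    [IsProbabilityMeasure ν] {g : α → ℝ} (hg : Measurable g) {v s : ℝ} (hv : 0 ≤ v) (hvs : v ≤ s)
    (hs : 0 < s) (hn : 0 < n) (hlaw : ν.map g = gaussianReal 0 v.toNNReal) {t : ℝ} (h₁ : 0 < t)
    (h₂ : t ≤ 1) :
    Measure.pi (fun _ : Fin n => ν) {z | n * s * t ≤ |∑ i, g (z i) ^ 2 - n * v|} ≤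
      2 * ENNReal.ofReal (Real.exp (-(n * t ^ 2 / 8))) := by
  rcases hv.eq_or_lt with hv0 | hv0
  · have h0 : ∀ᵐ x ∂ν, g x = 0 := by
      rw [← hv0, Real.toNNReal_zero, gaussianReal_zero_var] at hlaw
      have h : ∀ᵐ y ∂(ν.map g), y = 0 := by
        rw [hlaw, ae_dirac_eq]; rfl
      exact ae_of_ae_map hg.aemeasurable h
    have h1 : ∀ᵐ z ∂(Measure.pi (fun _ : Fin n => ν)), ∀ i, g (z i) = 0 :=
      ae_all_iff.2 fun i => (measurePreserving_eval (fun _ : Fin n => ν) i).quasiMeasurePreserving.ae h0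
    have h2 : Measure.pi (fun _ : Fin n => ν) {z | n * s * t ≤ |∑ i, g (z i) ^ 2 - n * v|} = 0 := by
      refine measure_mono_null (fun z hz => ?_) (ae_iff.1 h1)
      simp only [Set.mem_ofPred_eq] at hz ⊢
      intro hz'
      have : |∑ i, g (z i) ^ 2 - n * v| = 0 := by simp [hz', ← hv0]
      have : (0 : ℝ) < n * s * t := by positivity
      linarith
    rw [h2]
    exact zero_le
  · have hA := measure_sum_sq_ge (n := n) hg hv0 hlaw h₁.le h₂
    have hB := measure_sum_sq_le (n := n) hg hv0 hlaw h₁.le h₂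
    refine (measure_mono (fun z hz => ?_)).trans ((measure_union_le _ _).trans
      ((add_le_add hA hB).trans (by rw [two_mul])))
    simp only [Set.mem_ofPred_eq, Set.mem_union] at hz ⊢
    have h3 : n * v * t ≤ n * s * t := by gcongr
    rcases le_abs.1 hz with h | h
    · left; linarith
    · right; linarith

variable {p : ℕ}

/-- The linear functional `⟨a, X⟩ + b ε` of one observation. -/
def linFun (θ : Param p) (a : Fin p → ℝ) (b : ℝ) (q : ℝ × (Fin p → ℝ)) : ℝ :=
  a ⬝ᵥ q.2 + b * (q.1 - q.2 ⬝ᵥ θ.beta)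

/-- The covariance of `⟨a, X⟩ + b ε` and `⟨a', X⟩ + b' ε`. -/
def linCov (θ : Param p) (a : Fin p → ℝ) (b : ℝ) (a' : Fin p → ℝ) (b' : ℝ) : ℝ :=
  a ⬝ᵥ θ.Sig *ᵥ a' + b * b' * θ.sigma ^ 2

theorem continuous_linFun (θ : Param p) (a : Fin p → ℝ) (b : ℝ) : Continuous (linFun θ a b) := by
  unfold linFun dotProduct
  fun_prop

theorem map_linFun {θ : Param p} (hS : θ.Sig.PosSemidef) (a : Fin p → ℝ) (b : ℝ) :
    (obsLaw θ).map (linFun θ a b) = gaussianReal 0 (linCov θ a b a b).toNNReal := by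
  have h := map_linear_obsLaw hS a b
  rw [sq b] at h
  exact h

theorem linCov_self_nonneg {θ : Param p} (hS : θ.Sig.PosSemidef) (a : Fin p → ℝ) (b : ℝ) :
    0 ≤ linCov θ a b a b := by
  have h0 : 0 ≤ a ⬝ᵥ θ.Sig *ᵥ a := by simpa using hS.dotProduct_mulVec_nonneg a
  unfold linCov
  have : 0 ≤ b * b * θ.sigma ^ 2 := mul_nonneg (mul_self_nonneg b) (sq_nonneg _)
  linarith

theorem dot_mulVec_comm {S : Matrix (Fin p) (Fin p) ℝ} (hS : S.IsHermitian) (a b : Fin p → ℝ) :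
    a ⬝ᵥ S *ᵥ b = b ⬝ᵥ S *ᵥ a := by
  have hT : Sᵀ = S := by simpa [Matrix.IsHermitian] using hS
  rw [Matrix.dotProduct_mulVec, ← Matrix.mulVec_transpose, hT, dotProduct_comm]

theorem linCov_combo {θ : Param p} (hS : θ.Sig.PosSemidef) (a a' : Fin p → ℝ) (b b' s t : ℝ) :
    linCov θ (s • a + t • a') (s * b + t * b') (s • a + t • a') (s * b + t * b') =
      s ^ 2 * linCov θ a b a b + t ^ 2 * linCov θ a' b' a' b' + 2 * s * t * linCov θ a b a' b' := by
  have h := dot_mulVec_comm hS.1 a' a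
  unfold linCov
  simp only [Matrix.mulVec_add, Matrix.mulVec_smul, add_dotProduct, dotProduct_add, smul_dotProduct,
    dotProduct_smul, smul_eq_mul, h]
  ring

theorem linFun_combo (θ : Param p) (a a' : Fin p → ℝ) (b b' s t : ℝ) (q : ℝ × (Fin p → ℝ)) :
    linFun θ (s • a + t • a') (s * b + t * b') q = s * linFun θ a b q + t * linFun θ a' b' q := by
  unfold linFun
  simp only [add_dotProduct, smul_dotProduct, smul_eq_mul]
  ring

/-- Concentration of the empirical covariance of two linear functionals. -/
theorem measure_abs_sum_mul_sub_ge {n : ℕ} (hn : 0 < n) {θ : Param p} (hS : θ.Sig.PosSemidef)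
    (a a' : Fin p → ℝ) (b b' : ℝ) (hv : 0 < linCov θ a b a b) (hv' : 0 < linCov θ a' b' a' b')
    {t : ℝ} (h₁ : 0 < t) (h₂ : t ≤ 1) :
    dataLaw n θ {z | 2 * n * t * (√(linCov θ a b a b) * √(linCov θ a' b' a' b')) <
        |∑ i, linFun θ a b (z i) * linFun θ a' b' (z i) - n * linCov θ a b a' b'|} ≤
      4 * ENNReal.ofReal (Real.exp (-(n * t ^ 2 / 8))) := by
  set v := linCov θ a b a b
  set v' := linCov θ a' b' a' b'
  set κ := linCov θ a b a' b' with hκ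
  set s := (√v)⁻¹ with hs
  set s' := (√v')⁻¹ with hs'
  have hsv : s ^ 2 * v = 1 := by
    rw [hs, inv_pow, Real.sq_sqrt hv.le, inv_mul_cancel₀ hv.ne']
  have hsv' : s' ^ 2 * v' = 1 := by
    rw [hs', inv_pow, Real.sq_sqrt hv'.le, inv_mul_cancel₀ hv'.ne']
  -- Polarization: the normalized sum and difference have nonnegative variances w and w' with w + w'
  -- = 4, so each is at most 4, and the product is a quarter of the difference of their squares.
  have hw := linCov_combo hS a a' b b' s s'
  have hw' := linCov_combo hS a a' b b' s (-s')
  have hn0 := linCov_self_nonneg hS (s • a + s' • a') (s * b + s' * b')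
  have hn0' := linCov_self_nonneg hS (s • a + (-s') • a') (s * b + (-s') * b')
  set w := linCov θ (s • a + s' • a') (s * b + s' * b') (s • a + s' • a') (s * b + s' * b') with hwd
  set w' := linCov θ (s • a + (-s') • a') (s * b + (-s') * b') (s • a + (-s') • a')
    (s * b + (-s') * b') with hwd'
  have hA := measure_abs_sum_sq_sub_ge (n := n) (continuous_linFun θ (s • a + s' • a') (s * b + s' * b')).measurable
    hn0 (show w ≤ 4 by change w = s ^ 2 * v + s' ^ 2 * v' + _ at hw; change w' = s ^ 2 * v + (-s') ^ 2 * v' + _ at hw'; nlinarith) (by norm_num) hn (map_linFun hS _ _) h₁ h₂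
  have hB := measure_abs_sum_sq_sub_ge (n := n)
    (continuous_linFun θ (s • a + (-s') • a') (s * b + (-s') * b')).measurable
    hn0' (show w' ≤ 4 by change w = s ^ 2 * v + s' ^ 2 * v' + _ at hw; change w' = s ^ 2 * v + (-s') ^ 2 * v' + _ at hw'; nlinarith) (by norm_num) hn (map_linFun hS _ _) h₁ h₂
  refine (measure_mono (fun z hz => ?_)).trans ((measure_union_le _ _).trans
      ((add_le_add hA hB).trans (by rw [← add_mul]; norm_num)))
  simp only [Set.mem_ofPred_eq, Set.mem_union] at hz ⊢
  by_contra hcon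
  rw [not_or, not_le, not_le] at hcon
  obtain ⟨hc1, hc2⟩ := hcon
  simp only [linFun_combo] at hc1 hc2
  have hss : 0 < s * s' := by positivity
  have e1 : (∑ i, (s * linFun θ a b (z i) + s' * linFun θ a' b' (z i)) ^ 2 - n * w) -
      (∑ i, (s * linFun θ a b (z i) + -s' * linFun θ a' b' (z i)) ^ 2 - n * w') =
      4 * (s * s') * (∑ i, linFun θ a b (z i) * linFun θ a' b' (z i) - n * κ) := by
    rw [hw, hw', sub_sub_sub_comm, ← Finset.sum_sub_distrib, mul_sub, Finset.mul_sum]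
    congr 1
    · exact Finset.sum_congr rfl fun i _ => by ring
    · ring
  have e2 : |4 * (s * s') * (∑ i, linFun θ a b (z i) * linFun θ a' b' (z i) - n * κ)| < 8 * n * t := by
    rw [← e1]
    exact (abs_sub _ _).trans_lt (by linarith)
  rw [abs_mul, abs_of_pos (by positivity)] at e2
  have e3 : √v * √v' * (s * s') = 1 := by
    rw [hs, hs']
    have := (Real.sqrt_pos.2 hv).ne'
    have := (Real.sqrt_pos.2 hv').ne'
    field_simp
  have e4 := mul_lt_mul_of_pos_left hz (show 0 < 4 * (s * s') by positivity)
  have e5 : 4 * (s * s') * (2 * n * t * (√v * √v')) = 8 * n * t * (√v * √v' * (s * s')) := by ring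
  rw [e5, e3] at e4
  linarith

end AdaptiveSep

namespace AdaptiveSep
variable {p : ℕ}

/-! ### A finite net of sparse vectors and the restricted eigenvalue property -/

open Classical in
/-- The vector on the grid of mesh `1 / K` with prescribed support and values. -/
noncomputable def netVec (K s : ℕ) (f : (Fin s → Fin p) × (Fin s → Fin (2 * K + 1))) : Fin p → ℝ := fun j =>
  if h : ∃ i, f.1 i = j then (((f.2 h.choose : ℕ) : ℝ) - K) / K else 0

/-- The enumeration may repeat indices or leave T. This is harmless for the net, where a surplus
index receives the rounded value of a zero entry, namely 0. -/
theorem exists_fin_cover {s : ℕ} (hp : 0 < p) (T : Finset (Fin p)) (hT : T.card ≤ s) :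
    ∃ e : Fin s → Fin p, ∀ j ∈ T, ∃ i, e i = j := by
  refine ⟨fun i => if h : (i : ℕ) < T.card then (T.equivFin.symm ⟨i, h⟩ : Fin p) else ⟨0, hp⟩,
    fun j hj => ⟨⟨T.equivFin ⟨j, hj⟩, (T.equivFin ⟨j, hj⟩).2.trans_le hT⟩, ?_⟩⟩
  simp

theorem exists_netVec_near {K s : ℕ} (hp : 0 < p) (hK : 0 < K) {h : Fin p → ℝ} (hs : l0 h ≤ s)
    (h1 : ∀ j, |h j| ≤ 1) : ∃ f, ∀ j, |h j - netVec K s f j| ≤ 1 / K := by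
  obtain ⟨e, he⟩ := exists_fin_cover hp _ hs
  have hK' : (0 : ℝ) < K := by exact_mod_cast hK
  have hb : ∀ j, 0 ≤ ⌊K * h j⌋ + K ∧ ⌊K * h j⌋ + K < 2 * K + 1 := fun j => by
    obtain ⟨h2, h3⟩ := abs_le.1 (h1 j)
    have h4 : -(K : ℤ) ≤ ⌊K * h j⌋ := Int.le_floor.2 (by push_cast; nlinarith)
    have h5 : ⌊K * h j⌋ ≤ (K : ℤ) := by
      have : (⌊K * h j⌋ : ℝ) ≤ K := (Int.floor_le _).trans (by nlinarith)
      exact_mod_cast this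
    omega
  refine ⟨(e, fun i => ⟨(⌊K * h (e i)⌋ + K).toNat, by have := hb (e i); omega⟩), fun j => ?_⟩
  unfold netVec
  split_ifs with hj
  · have hj' := hj.choose_spec
    simp only at hj' ⊢
    rw [hj']
    have h6 : (((⌊K * h j⌋ + K).toNat : ℕ) : ℝ) = ⌊K * h j⌋ + K := by
      have := Int.toNat_of_nonneg (hb j).1
      exact_mod_cast this
    rw [h6, add_sub_cancel_right]
    have h7 := Int.floor_le (K * h j)
    have h8 := Int.lt_floor_add_one (K * h j)
    have h9 : h j - ⌊K * h j⌋ / K = (K * h j - ⌊K * h j⌋) / K := by field_simp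
    rw [h9, abs_div, abs_of_pos hK', abs_of_nonneg (by linarith)]
    gcongr
    linarith
  · have : h j = 0 := by
      by_contra hne
      exact hj (he j (Finset.mem_filter.2 ⟨Finset.mem_univ _, hne⟩))
    rw [this, sub_zero, abs_zero]
    positivity

theorem dot_sq_le (x r : Fin p → ℝ) : (x ⬝ᵥ r) ^ 2 ≤ (x ⬝ᵥ x) * (r ⬝ᵥ r) := by
  have := Finset.sum_mul_sq_le_sq_mul_sq Finset.univ x r
  simpa [dotProduct, sq] using this

/-- Passing from a net to all sparse vectors. -/
theorem restricted_eigenvalue_of_net {n s : ℕ} {M₁ : ℝ} (hM : 1 < M₁) (hp : 8 * M₁ ≤ p)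
    (z : Data n p)
    (hnet : ∀ f, netVec (p ^ 2) s f ≠ 0 → n * (netVec (p ^ 2) s f ⬝ᵥ netVec (p ^ 2) s f) / (2 * M₁) ≤
      ∑ i, (netVec (p ^ 2) s f ⬝ᵥ (z i).2) ^ 2)
    (hdiag : ∀ j, ∑ i, (z i).2 j ^ 2 ≤ 2 * n * M₁) (h : Fin p → ℝ) (hs : l0 h ≤ s) :
    n * (h ⬝ᵥ h) / (16 * M₁) ≤ ∑ i, (h ⬝ᵥ (z i).2) ^ 2 := by
  have hp0 : (8 : ℝ) ≤ p := by linarith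
  have hpp : 0 < p := by
    rcases Nat.eq_zero_or_pos p with h0 | h0
    · subst h0; norm_num at hp0
    · exact h0
  -- unit vectors
  have unit : ∀ h : Fin p → ℝ, l0 h ≤ s → h ⬝ᵥ h = 1 → n / (16 * M₁) ≤ ∑ i, (h ⬝ᵥ (z i).2) ^ 2 := by
    intro h hs h1
    have habs : ∀ j, |h j| ≤ 1 := fun j => by
      rw [← sq_le_one_iff_abs_le_one, ← h1, sq]
      exact Finset.single_le_sum (f := fun j => h j * h j) (fun j _ => mul_self_nonneg _)
        (Finset.mem_univ j)
    obtain ⟨f, hf⟩ := exists_netVec_near (K := p ^ 2) hpp (by positivity) hs habs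
    set g := netVec (p ^ 2) s f
    set r := h - g with hr
    have hrr : r ⬝ᵥ r ≤ 1 / p ^ 3 := by
      have h2 : ∀ j ∈ Finset.univ, r j * r j ≤ (1 / ((p ^ 2 : ℕ) : ℝ)) ^ 2 := fun j _ => by
        have := hf j
        rw [← sq, ← sq_abs]
        exact pow_le_pow_left₀ (abs_nonneg _) this 2
      refine (Finset.sum_le_sum h2).trans (le_of_eq ?_)
      rw [Finset.sum_const, Finset.card_univ, Fintype.card_fin, nsmul_eq_mul]
      push_cast
      field_simp
    -- The mesh p⁻² makes ‖r‖² ≤ p⁻³, so small that Cauchy–Schwarz with the trace of the Gram matrix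
    -- suffices; neither sparsity of r nor an operator norm bound is needed.
    have hXr : ∑ i, (r ⬝ᵥ (z i).2) ^ 2 ≤ 2 * n * M₁ / p ^ 2 := by
      calc ∑ i, (r ⬝ᵥ (z i).2) ^ 2 ≤ ∑ i, (r ⬝ᵥ r) * ((z i).2 ⬝ᵥ (z i).2) :=
            Finset.sum_le_sum fun i _ => dot_sq_le _ _
        _ = (r ⬝ᵥ r) * ∑ j, ∑ i, (z i).2 j ^ 2 := by
            rw [← Finset.mul_sum, Finset.sum_comm]
            simp only [dotProduct, sq]
        _ ≤ (1 / p ^ 3) * ∑ _j : Fin p, 2 * n * M₁ := by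
            refine mul_le_mul hrr (Finset.sum_le_sum fun j _ => hdiag j)
              (Finset.sum_nonneg fun j _ => Finset.sum_nonneg fun i _ => sq_nonneg _) (by positivity)
        _ = _ := by
            rw [Finset.sum_const, Finset.card_univ, Fintype.card_fin, nsmul_eq_mul]
            field_simp
    have hgg : 1 / 2 - 1 / p ^ 3 ≤ g ⬝ᵥ g := by
      have h3 : h ⬝ᵥ h ≤ 2 * (g ⬝ᵥ g) + 2 * (r ⬝ᵥ r) := by
        simp only [dotProduct, Finset.mul_sum, ← Finset.sum_add_distrib]
        refine Finset.sum_le_sum fun j _ => ?_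
        simp only [hr, Pi.sub_apply]
        nlinarith [sq_nonneg (h j - 2 * g j)]
      linarith
    have hXh : ∑ i, (g ⬝ᵥ (z i).2) ^ 2 ≤
        2 * ∑ i, (h ⬝ᵥ (z i).2) ^ 2 + 2 * ∑ i, (r ⬝ᵥ (z i).2) ^ 2 := by
      simp only [Finset.mul_sum, ← Finset.sum_add_distrib]
      refine Finset.sum_le_sum fun i _ => ?_
      have : g ⬝ᵥ (z i).2 = h ⬝ᵥ (z i).2 - r ⬝ᵥ (z i).2 := by
        rw [← sub_dotProduct, hr, sub_sub_cancel]
      rw [this]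
      nlinarith [sq_nonneg (h ⬝ᵥ (z i).2 + r ⬝ᵥ (z i).2)]
    have hp3 : (1 : ℝ) / p ^ 3 ≤ 1 / 8 := by
      refine one_div_le_one_div_of_le (by norm_num) (hp0.trans ?_)
      exact le_self_pow₀ (by linarith) (by norm_num)
    have hg0 : g ≠ 0 := fun h0 => by
      rw [h0, zero_dotProduct] at hgg; linarith
    have h5 := hnet f hg0
    have h6 : (n : ℝ) * (3 / 8) / (2 * M₁) ≤ n * (g ⬝ᵥ g) / (2 * M₁) := by
      gcongr; linarith
    have h7 : 2 * n * M₁ / (p : ℝ) ^ 2 ≤ n / (32 * M₁) := by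
      rw [div_le_div_iff₀ (by positivity) (by positivity)]
      have : (8 * M₁) ^ 2 ≤ (p : ℝ) ^ 2 := pow_le_pow_left₀ (by linarith) hp 2
      have hn : (0 : ℝ) ≤ n := by positivity
      nlinarith
    have e1 : (n : ℝ) * (3 / 8) / (2 * M₁) = 6 * (n / (32 * M₁)) := by field_simp; ring
    have e2 : (n : ℝ) / (16 * M₁) = 2 * (n / (32 * M₁)) := by field_simp; ring
    change _ ≤ ∑ i, (g ⬝ᵥ (z i).2) ^ 2 at h5
    linarith
  rcases (dot_self_nonneg h).eq_or_lt with h0 | h0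
  · rw [← h0, mul_zero, zero_div]
    exact Finset.sum_nonneg fun i _ => sq_nonneg _
  · set N := √(h ⬝ᵥ h) with hN
    have hN0 : 0 < N := Real.sqrt_pos.2 h0
    have hN2 : N ^ 2 = h ⬝ᵥ h := Real.sq_sqrt h0.le
    have h1 := unit (N⁻¹ • h) ?_ ?_
    · have h2 : ∑ i, (N⁻¹ • h ⬝ᵥ (z i).2) ^ 2 = (N ^ 2)⁻¹ * ∑ i, (h ⬝ᵥ (z i).2) ^ 2 := by
        rw [Finset.mul_sum]
        exact Finset.sum_congr rfl fun i _ => by rw [smul_dotProduct, smul_eq_mul]; ring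
      rw [h2, hN2, le_inv_mul_iff₀ h0] at h1
      calc _ = h ⬝ᵥ h * (n / (16 * M₁)) := by ring
        _ ≤ _ := h1
    · refine le_trans (le_of_eq ?_) hs
      unfold l0
      congr 1
      ext j
      simp [hN0.ne']
    · rw [smul_dotProduct, dotProduct_smul, smul_eq_mul, smul_eq_mul, ← hN2]
      field_simp

theorem linCov_zero_right (θ : Param p) (a : Fin p → ℝ) : linCov θ a 0 a 0 = a ⬝ᵥ θ.Sig *ᵥ a := by
  unfold linCov; ring

theorem linFun_zero_right (θ : Param p) (a : Fin p → ℝ) (q : ℝ × (Fin p → ℝ)) :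
    linFun θ a 0 q = a ⬝ᵥ q.2 := by
  unfold linFun; ring

theorem dot_self_pos {a : Fin p → ℝ} (ha : a ≠ 0) : 0 < a ⬝ᵥ a :=
  (dot_self_nonneg a).lt_of_ne fun h => ha (dotProduct_self_eq_zero.1 h.symm)

theorem single_dot_self (j : Fin p) : (Pi.single j (1 : ℝ) : Fin p → ℝ) ⬝ᵥ Pi.single j 1 = 1 := by
  simp

/-- The restricted eigenvalue property fails with exponentially small probability. -/
theorem measure_not_restricted_eigenvalue {n s k : ℕ} {M₁ M₂ : ℝ} (hM : 1 < M₁) (hp : 8 * M₁ ≤ p)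
    {θ : Param p} (hθ : θ ∈ paramSpace p M₁ M₂ k) :
    dataLaw n θ {z | ¬ ∀ h : Fin p → ℝ, l0 h ≤ s →
        n * (h ⬝ᵥ h) / (16 * M₁) ≤ ∑ i, (h ⬝ᵥ (z i).2) ^ 2} ≤
      ((p * (2 * p ^ 2 + 1)) ^ s + p : ℕ) * ENNReal.ofReal (Real.exp (-(n / 32))) := by
  obtain ⟨hS, hb⟩ := paramSpace_quadForm hM hθ
  have hM0 : 0 < M₁ := by linarith
  have hnet : ∀ f : (Fin s → Fin p) × (Fin s → Fin (2 * p ^ 2 + 1)),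
      dataLaw n θ {z | netVec (p ^ 2) s f ≠ 0 ∧ ∑ i, (netVec (p ^ 2) s f ⬝ᵥ (z i).2) ^ 2 <
        n * (netVec (p ^ 2) s f ⬝ᵥ netVec (p ^ 2) s f) / (2 * M₁)} ≤
      ENNReal.ofReal (Real.exp (-(n / 32))) := fun f => by
    by_cases hg : netVec (p ^ 2) s f = 0
    · simp [hg]
    set g := netVec (p ^ 2) s f
    have hv : 0 < linCov θ g 0 g 0 := by
      rw [linCov_zero_right]
      exact lt_of_lt_of_le (mul_pos (by positivity) (dot_self_pos hg)) (hb g).1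
    have h := measure_sum_sq_le (n := n) (continuous_linFun θ g 0).measurable hv (map_linFun hS g 0)
      (t := 1 / 2) (by norm_num) (by norm_num)
    refine (measure_mono fun z hz => ?_).trans (h.trans (le_of_eq (by congr 3; ring)))
    have hz2 := hz.2
    simp only [Set.mem_ofPred_eq, linFun_zero_right, linCov_zero_right]
    refine hz2.le.trans ?_
    have h1 := mul_le_mul_of_nonneg_left (hb g).1 (Nat.cast_nonneg (α := ℝ) n)
    calc _ = (n : ℝ) * (1 / M₁ * (g ⬝ᵥ g)) * (1 / 2) := by ring
      _ ≤ _ := by nlinarith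
  have hdiag : ∀ j : Fin p, dataLaw n θ {z | 2 * n * M₁ < ∑ i, (z i).2 j ^ 2} ≤
      ENNReal.ofReal (Real.exp (-(n / 32))) := fun j => by
    set e : Fin p → ℝ := Pi.single j 1
    have hv : 0 < linCov θ e 0 e 0 := by
      rw [linCov_zero_right]
      refine lt_of_lt_of_le ?_ (hb e).1
      rw [single_dot_self]; positivity
    have h := measure_sum_sq_ge (n := n) (continuous_linFun θ e 0).measurable hv (map_linFun hS e 0)
      (t := 1) (by norm_num) (by norm_num)
    refine (measure_mono fun z hz => ?_).trans (h.trans (ENNReal.ofReal_le_ofReal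
      (Real.exp_le_exp.2 ?_)))
    · simp only [Set.mem_ofPred_eq, linFun_zero_right, linCov_zero_right] at hz ⊢
      have h1 := (hb e).2
      rw [single_dot_self] at h1
      have h2 := mul_le_mul_of_nonneg_left h1 (Nat.cast_nonneg (α := ℝ) n)
      have h3 : ∀ i, e ⬝ᵥ (z i).2 = (z i).2 j := fun i => by simp [e]
      simp only [h3]
      linarith
    · have : (0 : ℝ) ≤ n := by positivity
      linarith
  have hsub : {z : Data n p | ¬ ∀ h : Fin p → ℝ, l0 h ≤ s →
        n * (h ⬝ᵥ h) / (16 * M₁) ≤ ∑ i, (h ⬝ᵥ (z i).2) ^ 2} ⊆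
      (⋃ f : (Fin s → Fin p) × (Fin s → Fin (2 * p ^ 2 + 1)),
        {z | netVec (p ^ 2) s f ≠ 0 ∧ ∑ i, (netVec (p ^ 2) s f ⬝ᵥ (z i).2) ^ 2 <
        n * (netVec (p ^ 2) s f ⬝ᵥ netVec (p ^ 2) s f) / (2 * M₁)}) ∪
      ⋃ j : Fin p, {z | 2 * n * M₁ < ∑ i, (z i).2 j ^ 2} := by
    intro z hz
    by_contra hcon
    simp only [Set.mem_union, Set.mem_iUnion, Set.mem_ofPred_eq, not_or, not_exists, not_and,
      not_lt] at hcon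
    exact hz fun h hs => restricted_eigenvalue_of_net hM hp z hcon.1 hcon.2 h hs
  refine (measure_mono hsub).trans ((measure_union_le _ _).trans ?_)
  push_cast
  rw [add_mul]
  refine add_le_add ((measure_iUnion_fintype_le _ _).trans ((Finset.sum_le_sum fun f _ => hnet f).trans
    (le_of_eq ?_))) ((measure_iUnion_fintype_le _ _).trans ((Finset.sum_le_sum fun j _ =>
    hdiag j).trans (le_of_eq ?_)))
  · rw [Finset.sum_const, Finset.card_univ, nsmul_eq_mul]
    congr 1
    simp [mul_pow]
  · rw [Finset.sum_const, Finset.card_univ, nsmul_eq_mul]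
    simp

end AdaptiveSep

namespace AdaptiveSep
variable {n p : ℕ}

/-! ### The pilot estimators -/

/-- Residual sum of squares. -/
def rss (z : Data n p) (b : Fin p → ℝ) : ℝ := ∑ i, ((z i).1 - (z i).2 ⬝ᵥ b) ^ 2

theorem rss_nonneg (z : Data n p) (b : Fin p → ℝ) : 0 ≤ rss z b :=
  Finset.sum_nonneg fun _ _ => sq_nonneg _

theorem continuous_rss : Continuous fun q : Data n p × (Fin p → ℝ) => rss q.1 q.2 := by
  unfold rss dotProduct
  fun_prop

/-- The `k`-sparse vectors. -/
abbrev Sparse (p k : ℕ) : Type := {b : Fin p → ℝ // l0 b ≤ k}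

instance (p k : ℕ) : Nonempty (Sparse p k) := ⟨⟨0, by simp [l0]⟩⟩

/-- A dense sequence of `k`-sparse vectors. -/
noncomputable def sparseSeq (p k : ℕ) : ℕ → Sparse p k := TopologicalSpace.denseSeq (Sparse p k)

/-- The infimum of the residual sum of squares over `k`-sparse vectors. -/
noncomputable def minRss (k : ℕ) (z : Data n p) : ℝ := ⨅ i, rss z (sparseSeq p k i)

theorem bddBelow_rss (k : ℕ) (z : Data n p) :
    BddBelow (Set.range fun i => rss z (sparseSeq p k i)) :=
  ⟨0, by rintro _ ⟨i, rfl⟩; exact rss_nonneg _ _⟩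

/-- The residual sum of squares is continuous, so a dense sequence of sparse vectors has the same
infimum. Countability is what makes the infimum and the selected near-minimizer measurable. -/
theorem minRss_le (k : ℕ) (z : Data n p) {b : Fin p → ℝ} (hb : l0 b ≤ k) : minRss k z ≤ rss z b := by
  refine (TopologicalSpace.denseRange_denseSeq (Sparse p k)).induction_on
    (p := fun b : Sparse p k => minRss k z ≤ rss z b.1) ⟨b, hb⟩ ?_ fun i => ciInf_le (bddBelow_rss k z) i
  refine isClosed_le continuous_const ?_
  exact continuous_rss.comp (by fun_prop : Continuous fun b : Sparse p k => (z, b.1))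

theorem measurable_minRss (k : ℕ) : Measurable (minRss k : Data n p → ℝ) := by
  refine Measurable.iInf fun i => ?_
  exact (continuous_rss.comp (by fun_prop :
    Continuous fun z : Data n p => (z, (sparseSeq p k i).1))).measurable

/-- Acceptance of the `i`-th sparse vector as a near-minimizer of the residual sum of squares. -/
def NearMin (k : ℕ) (i : ℕ) (z : Data n p) : Prop :=
  rss z (sparseSeq p k i) ≤ (1 + k * Real.log p / n) * minRss k z ∨
    k * Real.log p / n * minRss k z ≤ 0

/-- The infimum need not be attained along the sequence, so a relative slack k log p / n is granted.
When this slack vanishes every index is accepted, so that a least accepted index always exists. -/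
theorem exists_nearMin (k : ℕ) (z : Data n p) : ∃ i, NearMin k i z := by
  by_cases h : k * Real.log p / n * minRss k z ≤ 0
  · exact ⟨0, Or.inr h⟩
  · obtain ⟨i, hi⟩ := exists_lt_of_ciInf_lt
      (show ⨅ i, rss z (sparseSeq p k i) < (1 + k * Real.log p / n) * minRss k z by
        change minRss k z < _
        linarith)
    exact ⟨i, Or.inl hi.le⟩

open Classical in
/-- The pilot estimator of `β`: a near-minimizer of the residual sum of squares over `k`-sparse
vectors. -/
noncomputable def betaHat (n p k : ℕ) (z : Data n p) : Fin p → ℝ :=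
  sparseSeq p k (Nat.find (exists_nearMin k z))

/-- The pilot estimator of `σ`. -/
noncomputable def sigmaHat (n p k : ℕ) (z : Data n p) : ℝ := √(rss z (betaHat n p k z) / n)

theorem measurable_betaHat (n p k : ℕ) : Measurable (betaHat n p k) := by
  classical
  have hm : ∀ i, MeasurableSet {z : Data n p | NearMin k i z} := fun i => by
    have h1 : Measurable fun z : Data n p => rss z (sparseSeq p k i).1 :=
      (continuous_rss.comp (by fun_prop :
        Continuous fun z : Data n p => (z, (sparseSeq p k i).1))).measurable
    have h2 := measurable_minRss (n := n) (p := p) k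
    exact (measurableSet_le h1 (h2.const_mul _)).union
      (measurableSet_le (h2.const_mul _) measurable_const)
  exact Measurable.find (f := fun i (_ : Data n p) => (sparseSeq p k i).1) (p := NearMin k)
    (fun i => measurable_const) hm (exists_nearMin k)

theorem measurable_sigmaHat (n p k : ℕ) : Measurable (sigmaHat n p k) := by
  unfold sigmaHat
  exact ((continuous_rss.measurable.comp
    (measurable_id.prodMk (measurable_betaHat n p k))).div_const _).sqrt

theorem l0_betaHat (k : ℕ) (z : Data n p) : l0 (betaHat n p k z) ≤ k := (sparseSeq p k _).2

theorem rss_betaHat (k : ℕ) (z : Data n p) (h : 0 < k * Real.log p / n * minRss k z) :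
    rss z (betaHat n p k z) ≤ (1 + k * Real.log p / n) * minRss k z := by
  classical
  exact (Nat.find_spec (exists_nearMin k z)).resolve_right (not_le.2 h)

/-! ### Deterministic accuracy -/

/-- The event on which the pilot estimators are analysed. -/
structure GoodDesign (M₁ : ℝ) (k : ℕ) (θ : Param p) (z : Data n p) : Prop where
  noise : |rss z θ.beta - n * θ.sigma ^ 2| ≤ n * θ.sigma ^ 2 / 20
  cross : ∀ j, |∑ i, (z i).2 j * ((z i).1 - (z i).2 ⬝ᵥ θ.beta)| ≤
    8 * √M₁ * θ.sigma * √(n * Real.log p)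
  restricted : ∀ h : Fin p → ℝ, l0 h ≤ 2 * k → n * (h ⬝ᵥ h) / (16 * M₁) ≤ ∑ i, (h ⬝ᵥ (z i).2) ^ 2

theorem l0_sub_le (a b : Fin p → ℝ) : l0 (a - b) ≤ l0 a + l0 b := by
  classical
  unfold l0
  refine (Finset.card_le_card fun j hj => ?_).trans (Finset.card_union_le _ _)
  simp only [Finset.mem_filter, Finset.mem_union, Finset.mem_univ, true_and, Pi.sub_apply] at hj ⊢
  by_contra hcon
  rw [not_or, not_not, not_not] at hcon
  exact hj (by rw [hcon.1, hcon.2, sub_zero])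

theorem l2_sq (v : Fin p → ℝ) : l2 v ^ 2 = v ⬝ᵥ v := by
  unfold l2
  rw [Real.sq_sqrt (Finset.sum_nonneg fun _ _ => sq_nonneg _)]
  simp [dotProduct, sq]

theorem l2_nonneg (v : Fin p → ℝ) : 0 ≤ l2 v := Real.sqrt_nonneg _

theorem l1_nonneg (v : Fin p → ℝ) : 0 ≤ l1 v := Finset.sum_nonneg fun _ _ => abs_nonneg _

theorem l1_le_sqrt_mul_l2 {s : ℕ} {v : Fin p → ℝ} (hv : l0 v ≤ s) : l1 v ≤ √s * l2 v := by
  have h1 : l1 v = ∑ j ∈ Finset.univ.filter (fun j => v j ≠ 0), |v j| := by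
    unfold l1
    rw [Finset.sum_filter]
    refine Finset.sum_congr rfl fun j _ => ?_
    split_ifs with h
    · rfl
    · rw [not_not.1 h, abs_zero]
  have h2 := Finset.sum_mul_sq_le_sq_mul_sq (Finset.univ.filter (fun j => v j ≠ 0))
    (fun _ => (1 : ℝ)) (fun j => |v j|)
  simp only [one_mul, one_pow, Finset.sum_const, nsmul_eq_mul, mul_one, sq_abs] at h2
  rw [← h1] at h2
  refine (pow_le_pow_iff_left₀ (l1_nonneg v) (mul_nonneg (Real.sqrt_nonneg _) (l2_nonneg v)) two_ne_zero).1 ?_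
  rw [mul_pow, Real.sq_sqrt (by positivity), l2_sq]
  refine h2.trans (mul_le_mul (by exact_mod_cast hv) ?_ (Finset.sum_nonneg fun _ _ => sq_nonneg _)
    (by positivity))
  simp only [dotProduct, ← sq]
  exact Finset.sum_le_sum_of_subset_of_nonneg (Finset.filter_subset _ _) fun _ _ _ => sq_nonneg _

theorem rss_expand (z : Data n p) (β b : Fin p → ℝ) :
    rss z b = rss z β - 2 * ∑ j, (b - β) j * ∑ i, (z i).2 j * ((z i).1 - (z i).2 ⬝ᵥ β) +
      ∑ i, ((b - β) ⬝ᵥ (z i).2) ^ 2 := by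
  have h1 : ∑ j, (b - β) j * ∑ i, (z i).2 j * ((z i).1 - (z i).2 ⬝ᵥ β) =
      ∑ i, ((b - β) ⬝ᵥ (z i).2) * ((z i).1 - (z i).2 ⬝ᵥ β) := by
    simp only [Finset.mul_sum, dotProduct, Finset.sum_mul]
    rw [Finset.sum_comm]
    exact Finset.sum_congr rfl fun i _ => Finset.sum_congr rfl fun j _ => by ring
  rw [h1]
  unfold rss
  rw [Finset.mul_sum, ← Finset.sum_sub_distrib, ← Finset.sum_add_distrib]
  refine Finset.sum_congr rfl fun i _ => ?_
  have h2 : (z i).2 ⬝ᵥ b = (z i).2 ⬝ᵥ β + (b - β) ⬝ᵥ (z i).2 := by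
    rw [dotProduct_comm (b - β), dotProduct_sub]; ring
  rw [h2]
  ring

/-- The difference h is 2k-sparse. The restricted eigenvalue bounds the quadratic term from below;
the cross term is at most ‖h‖₁ times the largest noise correlation, and ‖h‖₁ ≤ √(2k) ‖h‖₂. The
factor √M₁ is relaxed to 2M₁. -/
theorem rss_lower {M₁ : ℝ} (hM : 1 < M₁) {k : ℕ} {θ : Param p} {z : Data n p} (hσ : 0 < θ.sigma)
    (hβ : l0 θ.beta ≤ k) (hz : GoodDesign M₁ k θ z) {b : Fin p → ℝ} (hb : l0 b ≤ k) :
    rss z θ.beta - 32 * M₁ * θ.sigma * √(2 * k) * √(n * Real.log p) * l2 (b - θ.beta) +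
      n * l2 (b - θ.beta) ^ 2 / (16 * M₁) ≤ rss z b := by
  set h := b - θ.beta with hh
  have hs : l0 h ≤ 2 * k := (l0_sub_le _ _).trans (by omega)
  have h1 := hz.restricted h hs
  rw [← l2_sq] at h1
  have h2 : ∑ j, h j * ∑ i, (z i).2 j * ((z i).1 - (z i).2 ⬝ᵥ θ.beta) ≤
      l1 h * (8 * √M₁ * θ.sigma * √(n * Real.log p)) := by
    unfold l1
    rw [Finset.sum_mul]
    refine Finset.sum_le_sum fun j _ => (le_abs_self _).trans ?_
    rw [abs_mul]
    exact mul_le_mul_of_nonneg_left (hz.cross j) (abs_nonneg _)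
  have h3 := l1_le_sqrt_mul_l2 hs
  have h4 : √M₁ ≤ 2 * M₁ := (Real.sqrt_le_left (by linarith)).2 (by nlinarith)
  have h5 : l1 h * (8 * √M₁ * θ.sigma * √(n * Real.log p)) ≤
      √(2 * k) * l2 h * (8 * (2 * M₁) * θ.sigma * √(n * Real.log p)) := by
    have := l2_nonneg h
    push_cast at h3
    gcongr
  rw [rss_expand z θ.beta b]
  rw [← hh]
  linarith

set_option maxHeartbeats 1000000 in
/-- On a good design the pilot estimators are accurate. -/
theorem accurate_of_goodDesign {M₁ : ℝ} (hM : 1 < M₁) {k : ℕ} {θ : Param p} {z : Data n p}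
    (hσ : 0 < θ.sigma) (hβ : l0 θ.beta ≤ k) (hk : 0 < k) (hp : 1 < p)
    (hn : 10 ^ 6 * M₁ ^ 3 * (k * Real.log p) ≤ n) (hz : GoodDesign M₁ k θ z) :
    z ∈ accurate (4000 * M₁ ^ 2) (2000 * M₁ ^ 2) k (betaHat n p k) (sigmaHat n p k) θ := by
  have hL : 0 < Real.log p := Real.log_pos (by exact_mod_cast hp)
  have hk' : (0 : ℝ) < k := by exact_mod_cast hk
  have hn0 : (0 : ℝ) < n := lt_of_lt_of_le (by positivity) hn
  set q := θ.sigma * √(k * Real.log p / n) with hq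
  have hq0 : 0 < q := by positivity
  have hq2 : n * q ^ 2 = θ.sigma ^ 2 * (k * Real.log p) := by
    rw [hq, mul_pow, Real.sq_sqrt (by positivity)]; field_simp
  have hD : 32 * M₁ * θ.sigma * √(2 * k) * √(n * Real.log p) ≤ 64 * M₁ * n * q := by
    have h1 : √(2 * k) * √(n * Real.log p) = √2 * n * √(k * Real.log p / n) := by
      have h2 : (n : ℝ) = √(n ^ 2) := (Real.sqrt_sq hn0.le).symm
      rw [← Real.sqrt_mul (by positivity)]
      conv_rhs => rw [h2]
      rw [← Real.sqrt_mul (by positivity), ← Real.sqrt_mul (by positivity)]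
      congr 1
      rw [Real.sqrt_sq hn0.le]
      field_simp
    have h3 : √2 ≤ 2 := (Real.sqrt_le_left (by norm_num)).2 (by norm_num)
    calc _ = 32 * M₁ * θ.sigma * (√(2 * k) * √(n * Real.log p)) := by ring
      _ = 32 * M₁ * θ.sigma * (√2 * n * √(k * Real.log p / n)) := by rw [h1]
      _ ≤ 32 * M₁ * θ.sigma * (2 * n * √(k * Real.log p / n)) := by gcongr
      _ = _ := by rw [hq]; ring
  have hsmall : 10 ^ 6 * M₁ ^ 3 * (n * q ^ 2) ≤ n * θ.sigma ^ 2 := by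
    rw [hq2]
    calc _ = θ.sigma ^ 2 * (10 ^ 6 * M₁ ^ 3 * (k * Real.log p)) := by ring
      _ ≤ θ.sigma ^ 2 * n := by gcongr
      _ = _ := by ring
  have hlow : ∀ b : Fin p → ℝ, l0 b ≤ k → rss z θ.beta - 64 * M₁ * n * q * l2 (b - θ.beta) +
      n * l2 (b - θ.beta) ^ 2 / (16 * M₁) ≤ rss z b := fun b hb => by
    refine le_trans ?_ (rss_lower hM hσ hβ hz hb)
    have := mul_le_mul_of_nonneg_right hD (l2_nonneg (b - θ.beta))
    linarith
  have hM3 : 1 ≤ M₁ ^ 3 := one_le_pow₀ hM.le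
  obtain ⟨hn1, hn2⟩ := abs_le.1 hz.noise
  have hlow2 : ∀ b : Fin p → ℝ, l0 b ≤ k → 0.9 * (n * θ.sigma ^ 2) ≤ rss z b := fun b hb => by
    refine le_trans ?_ (hlow b hb)
    set N := l2 (b - θ.beta)
    -- Completing the square at N = 512 M₁² q. As n ≥ 10⁶ M₁³ k log p, the loss 16384 M₁³ n q² is
    -- below 0.02 nσ², which together with the 5% fluctuation of the noise leaves 0.9 nσ².
    have h1 : 64 * M₁ * n * q * N - n * N ^ 2 / (16 * M₁) ≤ 16384 * M₁ ^ 3 * (n * q ^ 2) := by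
      have h2 : 0 ≤ n / (16 * M₁) * (N - 512 * M₁ ^ 2 * q) ^ 2 := by positivity
      have h3 : n / (16 * M₁) * (N - 512 * M₁ ^ 2 * q) ^ 2 = n * N ^ 2 / (16 * M₁) -
          64 * M₁ * n * q * N + 16384 * M₁ ^ 3 * (n * q ^ 2) := by
        field_simp; ring
      linarith
    linarith
  have hmin : 0.9 * (n * θ.sigma ^ 2) ≤ minRss k z := le_ciInf fun i => hlow2 _ (sparseSeq p k i).2
  have hσ2 : 0 < n * θ.sigma ^ 2 := by positivity
  have hmin0 : 0 < minRss k z := by linarith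
  have hup := (rss_betaHat k z (by positivity)).trans
    (mul_le_mul_of_nonneg_left (minRss_le k z hβ) (by positivity))
  have hκ : (k : ℝ) * Real.log p / n ≤ 1 / 10 ^ 6 := by
    rw [div_le_div_iff₀ hn0 (by norm_num)]
    have : (1 : ℝ) * (k * Real.log p) ≤ M₁ ^ 3 * (k * Real.log p) := by gcongr
    linarith
  set b := betaHat n p k z with hb
  have hbk : l0 b ≤ k := l0_betaHat k z
  have hκrss : k * Real.log p / n * rss z θ.beta ≤ 2 * (n * q ^ 2) := by
    calc _ ≤ k * Real.log p / n * (2 * (n * θ.sigma ^ 2)) := by gcongr; linarith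
      _ = _ := by rw [hq2]; field_simp
  -- If N exceeded 2000 M₁² q, the basic inequality would still force N ≤ 1056 M₁² q: 1024 comes
  -- from the cross term and 32 from the slack of the near-minimizer.
  have hN : l2 (b - θ.beta) ≤ 2000 * M₁ ^ 2 * q := by
    by_contra hcon
    rw [not_le] at hcon
    have h1 := hlow b hbk
    set N := l2 (b - θ.beta)
    have h2 : n * N ^ 2 / (16 * M₁) ≤ 64 * M₁ * n * q * N + 2 * (n * q ^ 2) := by linarith
    rw [div_le_iff₀ (by positivity)] at h2
    have h3 : N ^ 2 ≤ 1024 * M₁ ^ 2 * q * N + 32 * M₁ * q ^ 2 := by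
      refine le_of_mul_le_mul_left ?_ hn0
      linarith
    have h4 : q ≤ N := by
      refine le_trans ?_ hcon.le
      have : 1 ≤ M₁ ^ 2 := one_le_pow₀ hM.le
      exact le_mul_of_one_le_left hq0.le (by linarith)
    have hN0 : 0 < N := by linarith
    have h5 : 32 * M₁ * q ^ 2 ≤ 32 * M₁ ^ 2 * q * N := by
      have : M₁ * q ^ 2 ≤ M₁ ^ 2 * (q * N) := by
        have : q ^ 2 ≤ q * N := by rw [sq]; gcongr
        have : M₁ ≤ M₁ ^ 2 := le_self_pow₀ hM.le two_ne_zero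
        gcongr
      linarith
    have h6 := mul_lt_mul_of_pos_right hcon hN0
    have : 0 < M₁ ^ 2 * q * N := by positivity
    linarith [sq N]
  -- For σ̂: (1 + 10⁻⁶) · 1.05 ≤ 1.05² and 0.9 · 1.05 < 1 on one side, 0.94² ≤ 0.9 and 1.1 · 0.94 >
  -- 1 on the other.
  refine ⟨?_, ?_, ?_, ?_⟩
  · have h1 : sigmaHat n p k z ≤ 1.05 * θ.sigma := by
      refine (Real.sqrt_le_left (by positivity)).2 ?_
      rw [div_le_iff₀ hn0]
      have : (1 + k * Real.log p / n) * rss z θ.beta ≤ (1 + 1 / 10 ^ 6) * (1.05 * (n * θ.sigma ^ 2)) := by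
        refine mul_le_mul (by linarith) (by linarith) (rss_nonneg _ _) (by norm_num)
      rw [mul_pow]
      linarith
    linarith
  · have h1 : 0.94 * θ.sigma ≤ sigmaHat n p k z := by
      refine Real.le_sqrt_of_sq_le ?_
      rw [le_div_iff₀ hn0]
      have := hlow2 b hbk
      rw [mul_pow]
      linarith
    linarith
  · have hs : l0 (b - θ.beta) ≤ 2 * k := (l0_sub_le _ _).trans (by omega)
    have h1 := l1_le_sqrt_mul_l2 hs
    have h2 : √((2 * k : ℕ) : ℝ) * √(k * Real.log p / n) ≤ 2 * k * √(Real.log p / n) := by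
      rw [mul_div_assoc, Real.sqrt_mul hk'.le]
      have h3 : √((2 * k : ℕ) : ℝ) ≤ 2 * √k := by
        refine (Real.sqrt_le_left (by positivity)).2 ?_
        rw [mul_pow, Real.sq_sqrt hk'.le]; push_cast; linarith
      calc _ ≤ 2 * √k * (√k * √(Real.log p / n)) := by gcongr
        _ = 2 * (√k * √k) * √(Real.log p / n) := by ring
        _ = _ := by rw [Real.mul_self_sqrt hk'.le]
    calc l1 (b - θ.beta) ≤ √((2 * k : ℕ) : ℝ) * (2000 * M₁ ^ 2 * q) :=
          h1.trans (mul_le_mul_of_nonneg_left hN (Real.sqrt_nonneg _))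
      _ = 2000 * M₁ ^ 2 * θ.sigma * (√((2 * k : ℕ) : ℝ) * √(k * Real.log p / n)) := by rw [hq]; ring
      _ ≤ 2000 * M₁ ^ 2 * θ.sigma * (2 * k * √(Real.log p / n)) := by gcongr
      _ = _ := by ring
  · rw [hq] at hN
    linarith

end AdaptiveSep

namespace AdaptiveSep
variable {n p : ℕ}

/-! ### Probability of a good design -/

theorem linCov_zero_left (θ : Param p) : linCov θ 0 1 0 1 = θ.sigma ^ 2 := by
  unfold linCov; simp

theorem linFun_zero_left (θ : Param p) (q : ℝ × (Fin p → ℝ)) :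
    linFun θ 0 1 q = q.1 - q.2 ⬝ᵥ θ.beta := by
  unfold linFun; simp

theorem sig_diag_bounds {M₁ M₂ : ℝ} {k : ℕ} (hM : 1 < M₁) {θ : Param p}
    (hθ : θ ∈ paramSpace p M₁ M₂ k) (j : Fin p) :
    0 < linCov θ (Pi.single j 1) 0 (Pi.single j 1) 0 ∧
      linCov θ (Pi.single j 1) 0 (Pi.single j 1) 0 ≤ M₁ := by
  have hb := (paramSpace_quadForm hM hθ).2 (Pi.single j 1)
  rw [single_dot_self] at hb
  rw [linCov_zero_right]
  have : 0 < 1 / M₁ * 1 := by have : 0 < M₁ := by linarith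
                              positivity
  exact ⟨by linarith, by linarith⟩

theorem measure_cross_gt {M₁ M₂ : ℝ} {k : ℕ} (hM : 1 < M₁) {θ : Param p}
    (hθ : θ ∈ paramSpace p M₁ M₂ k) (hn : 0 < n) (hp : 1 < p) (hL : 16 * Real.log p ≤ n)
    (j : Fin p) :
    dataLaw n θ {z | ¬ |∑ i, (z i).2 j * ((z i).1 - (z i).2 ⬝ᵥ θ.beta)| ≤
      8 * √M₁ * θ.sigma * √(n * Real.log p)} ≤ 4 * ENNReal.ofReal (Real.exp (-(2 * Real.log p))) := by
  have hσ : 0 < θ.sigma := hθ.2.2.1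
  have hlog : 0 < Real.log p := Real.log_pos (by exact_mod_cast hp)
  have hn' : (0 : ℝ) < n := by exact_mod_cast hn
  obtain ⟨hd0, hd1⟩ := sig_diag_bounds hM hθ j
  -- With this t the bound exp(-nt²/8) is p⁻², so a union over the p coordinates costs 4/p.
  set t := 4 * √(Real.log p / n) with ht
  have ht2 : t ^ 2 = 16 * Real.log p / n := by
    rw [ht, mul_pow, Real.sq_sqrt (by positivity)]; ring
  have ht1 : t ≤ 1 := by
    have h0 : 0 ≤ t := by positivity
    refine (sq_le_one_iff₀ h0).1 ?_
    rw [ht2, div_le_one hn']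
    exact hL
  have h := measure_abs_sum_mul_sub_ge hn (paramSpace_quadForm hM hθ).1 (Pi.single j 1) 0 0 1 hd0
    (by rw [linCov_zero_left]; positivity) (t := t) (by positivity) ht1
  refine (measure_mono fun z hz => ?_).trans (h.trans (le_of_eq ?_))
  · simp only [Set.mem_ofPred_eq, not_le, linCov_zero_left, linFun_zero_left, linFun_zero_right] at hz ⊢
    have h1 : linCov θ (Pi.single j 1) 0 0 1 = 0 := by unfold linCov; simp
    simp only [h1, mul_zero, sub_zero, single_one_dotProduct]
    refine lt_of_le_of_lt ?_ hz
    rw [Real.sqrt_sq hσ.le]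
    have h2 : √(n * Real.log p) = n * √(Real.log p / n) := by
      conv_rhs => rw [← Real.sqrt_sq hn'.le]
      rw [← Real.sqrt_mul (by positivity), Real.sqrt_sq hn'.le]
      congr 1; field_simp
    have h3 := Real.sqrt_le_sqrt hd1
    rw [h2, ht]
    calc _ = 8 * √(linCov θ (Pi.single j 1) 0 (Pi.single j 1) 0) * θ.sigma * (n * √(Real.log p / n)) := by
          ring
      _ ≤ _ := by gcongr
  · congr 4
    rw [ht2]; field_simp; norm_num

/-- For p ≥ 2, p(2p² + 1) ≤ p⁵, so the logarithm of the size of the net is at most 10 k log p. Under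
n ≥ 640 k log p this is at most n/64, half of the exponent n/32 available for each net point. -/
theorem net_count_le (hp : 2 ≤ p) (k : ℕ) :
    (((p * (2 * p ^ 2 + 1)) ^ (2 * k) + p : ℕ) : ℝ) ≤ Real.exp (10 * (k * Real.log p)) + p := by
  have hp' : (2 : ℝ) ≤ p := by exact_mod_cast hp
  push_cast
  have h1 : (p : ℝ) * (2 * p ^ 2 + 1) ≤ p ^ 5 := by
    have : (2 : ℝ) * p ^ 2 + 1 ≤ p ^ 4 := by
      have h4 : (4 : ℝ) ≤ p ^ 2 := by nlinarith
      have h5 : (p : ℝ) ^ 4 = p ^ 2 * p ^ 2 := by ring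
      nlinarith
    calc (p : ℝ) * (2 * p ^ 2 + 1) ≤ p * p ^ 4 := by gcongr
      _ = _ := by ring
  have h2 : Real.exp (10 * (k * Real.log p)) = ((p : ℝ) ^ 5) ^ (2 * k) := by
    rw [← pow_mul, ← Real.exp_log (show (0 : ℝ) < p by linarith), ← Real.exp_nat_mul, Real.exp_log (by linarith)]
    congr 1
    push_cast; ring
  rw [h2]
  gcongr

/-- A bound for the probability that the design is not good. -/
noncomputable def badProb (n p : ℕ) : ℝ :=
  2 * Real.exp (-(n / 3200)) + 4 / p + 2 * Real.exp (-(n / 64))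

theorem measure_not_goodDesign {M₁ M₂ : ℝ} {k : ℕ} (hM : 1 < M₁) {θ : Param p}
    (hθ : θ ∈ paramSpace p M₁ M₂ k) (hk : 0 < k) (hn : 0 < n) (hp : 8 * M₁ ≤ p)
    (hL : 640 * (k * Real.log p) ≤ n) :
    dataLaw n θ {z | ¬ GoodDesign M₁ k θ z} ≤ ENNReal.ofReal (badProb n p) := by
  have hp8 : (8 : ℝ) < p := by linarith
  have hp2 : 2 ≤ p := by
    have : 8 < p := by exact_mod_cast hp8
    omega
  have hlog : 0 < Real.log p := Real.log_pos (by linarith)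
  have hn' : (0 : ℝ) < n := by exact_mod_cast hn
  have hk' : (1 : ℝ) ≤ k := by exact_mod_cast hk
  have hkl : Real.log p ≤ k * Real.log p := le_mul_of_one_le_left hlog.le hk'
  have hσ : 0 < θ.sigma := hθ.2.2.1
  obtain ⟨hS, -⟩ := paramSpace_quadForm hM hθ
  have hv : 0 < linCov θ 0 1 0 1 := by rw [linCov_zero_left]; positivity
  have hA := measure_abs_sum_sq_sub_ge (n := n) (continuous_linFun θ 0 1).measurable hv.le le_rfl hv hn
    (map_linFun hS 0 1) (t := 1 / 20) (by norm_num) (by norm_num)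
  have hB : dataLaw n θ (⋃ j : Fin p, {z | ¬ |∑ i, (z i).2 j * ((z i).1 - (z i).2 ⬝ᵥ θ.beta)| ≤
      8 * √M₁ * θ.sigma * √(n * Real.log p)}) ≤ ENNReal.ofReal (4 / p) := by
    refine (measure_iUnion_fintype_le _ _).trans ((Finset.sum_le_sum fun j _ =>
      measure_cross_gt hM hθ hn (by omega) (by linarith) j).trans (le_of_eq ?_))
    rw [Finset.sum_const, Finset.card_univ, Fintype.card_fin, nsmul_eq_mul,
      ← ENNReal.ofReal_natCast, ← ENNReal.ofReal_ofNat, ← ENNReal.ofReal_mul (by norm_num),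
      ← ENNReal.ofReal_mul (by positivity)]
    congr 1
    have : Real.exp (-(2 * Real.log p)) = ((p : ℝ) ^ 2)⁻¹ := by
      rw [Real.exp_neg, ← Nat.cast_two, Real.exp_nat_mul, Real.exp_log (by linarith)]
    rw [this]
    field_simp
  have hC := measure_not_restricted_eigenvalue (n := n) (s := 2 * k) hM hp hθ
  have hC' : (((p * (2 * p ^ 2 + 1)) ^ (2 * k) + p : ℕ) : ℝ≥0∞) * ENNReal.ofReal (Real.exp (-(n / 32)))
      ≤ ENNReal.ofReal (2 * Real.exp (-(n / 64))) := by
    rw [← ENNReal.ofReal_natCast, ← ENNReal.ofReal_mul (by positivity)]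
    refine ENNReal.ofReal_le_ofReal ?_
    have h1 := net_count_le hp2 k
    have h2 : (p : ℝ) ≤ Real.exp (10 * (k * Real.log p)) := by
      conv_lhs => rw [← Real.exp_log (show (0 : ℝ) < p by linarith)]
      exact Real.exp_le_exp.2 (by linarith)
    calc _ ≤ 2 * Real.exp (10 * (k * Real.log p)) * Real.exp (-(n / 32)) := by gcongr; linarith
      _ = 2 * Real.exp (10 * (k * Real.log p) - n / 32) := by rw [mul_assoc, ← Real.exp_add]; rfl
      _ ≤ _ := by gcongr; linarith
  have hsub : {z : Data n p | ¬ GoodDesign M₁ k θ z} ⊆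
      ({z | n * linCov θ 0 1 0 1 * (1 / 20) ≤ |∑ i, linFun θ 0 1 (z i) ^ 2 - n * linCov θ 0 1 0 1|} ∪
      ⋃ j : Fin p, {z | ¬ |∑ i, (z i).2 j * ((z i).1 - (z i).2 ⬝ᵥ θ.beta)| ≤
        8 * √M₁ * θ.sigma * √(n * Real.log p)}) ∪
      {z | ¬ ∀ h : Fin p → ℝ, l0 h ≤ 2 * k →
        n * (h ⬝ᵥ h) / (16 * M₁) ≤ ∑ i, (h ⬝ᵥ (z i).2) ^ 2} := by
    intro z hz
    by_contra hcon
    simp only [Set.mem_union, Set.mem_iUnion, Set.mem_ofPred_eq, not_or, not_exists, not_not,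
      not_le, linCov_zero_left, linFun_zero_left] at hcon
    refine hz ⟨?_, fun j => not_lt.1 (hcon.1.2 j), hcon.2⟩
    have := hcon.1.1.le
    unfold rss
    linarith
  refine (measure_mono hsub).trans ((measure_union_le _ _).trans ?_)
  unfold badProb
  rw [ENNReal.ofReal_add (by positivity) (by positivity), ENNReal.ofReal_add (by positivity) (by positivity)]
  refine add_le_add ((measure_union_le _ _).trans (add_le_add (hA.trans (le_of_eq ?_)) hB)) (hC.trans hC')
  rw [← ENNReal.ofReal_ofNat, ← ENNReal.ofReal_mul (by norm_num)]
  congr 4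
  ring

theorem exists_badProb_le {δ : ℝ} (hδ : 0 < δ) : ∃ N : ℕ, ∀ n p : ℕ, N ≤ n → N ≤ p → badProb n p ≤ δ := by
  have h1 : Filter.Tendsto (fun n : ℕ => Real.exp (-((n : ℝ) / 3200))) Filter.atTop (nhds 0) :=
    Real.tendsto_exp_neg_atTop_nhds_zero.comp
      (tendsto_natCast_atTop_atTop.atTop_div_const (by norm_num))
  have h2 : Filter.Tendsto (fun n : ℕ => Real.exp (-((n : ℝ) / 64))) Filter.atTop (nhds 0) :=
    Real.tendsto_exp_neg_atTop_nhds_zero.comp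
      (tendsto_natCast_atTop_atTop.atTop_div_const (by norm_num))
  have h3 : Filter.Tendsto (fun p : ℕ => (4 : ℝ) / p) Filter.atTop (nhds 0) :=
    tendsto_const_div_atTop_nhds_zero_nat 4
  obtain ⟨N₁, hN₁⟩ := Filter.eventually_atTop.1 (h1.eventually_le_const (show 0 < δ / 8 by linarith))
  obtain ⟨N₂, hN₂⟩ := Filter.eventually_atTop.1 (h2.eventually_le_const (show 0 < δ / 8 by linarith))
  obtain ⟨N₃, hN₃⟩ := Filter.eventually_atTop.1 (h3.eventually_le_const (show 0 < δ / 8 by linarith))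
  refine ⟨max N₁ (max N₂ N₃), fun n p hn hp => ?_⟩
  have a := hN₁ n ((le_max_left _ _).trans hn)
  have b := hN₂ n (((le_max_left _ _).trans (le_max_right _ _)).trans hn)
  have c := hN₃ p (((le_max_right _ _).trans (le_max_right _ _)).trans hp)
  unfold badProb
  linarith

end AdaptiveSep

namespace AdaptiveSep
variable {n p : ℕ}

/-! ### The projection direction -/

/-- The dual constraint set: vectors `w` with `‖n⁻¹ Xᵀ w - v‖_∞ ≤ r`. -/
def dualSet (r : ℝ) (z : Data n p) (v : Fin p → ℝ) : Set (Fin n → ℝ) :=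
  {w | ∀ j, |(n : ℝ)⁻¹ * ∑ i, (z i).2 j * w i - v j| ≤ r}

/-- `w` has minimal norm in the dual constraint set. -/
def IsMinNorm (r : ℝ) (z : Data n p) (v : Fin p → ℝ) (w : Fin n → ℝ) : Prop :=
  w ∈ dualSet r z v ∧ ∀ w' ∈ dualSet r z v, w ⬝ᵥ w ≤ w' ⬝ᵥ w'

theorem sampleCov_mulVec_apply (z : Data n p) (u : Fin p → ℝ) (j : Fin p) :
    (sampleCov z *ᵥ u) j = (n : ℝ)⁻¹ * ∑ i, (z i).2 j * (design z *ᵥ u) i := by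
  unfold sampleCov
  rw [Matrix.smul_mulVec, ← Matrix.mulVec_mulVec, Pi.smul_apply, smul_eq_mul]
  rfl

theorem dot_sampleCov_mulVec (z : Data n p) (a u : Fin p → ℝ) :
    a ⬝ᵥ sampleCov z *ᵥ u = (n : ℝ)⁻¹ * ((design z *ᵥ a) ⬝ᵥ (design z *ᵥ u)) := by
  unfold sampleCov
  rw [Matrix.smul_mulVec, dotProduct_smul, smul_eq_mul, ← Matrix.mulVec_mulVec,
    Matrix.dotProduct_mulVec, Matrix.vecMul_transpose]

theorem feasible_iff (Cξ : ℝ) (z : Data n p) (v u : Fin p → ℝ) :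
    Feasible Cξ z v u ↔ design z *ᵥ u ∈ dualSet (Cξ * l2 v * √(Real.log p / n)) z v := by
  unfold Feasible dualSet
  simp only [Set.mem_ofPred_eq, Pi.sub_apply, sampleCov_mulVec_apply]

/-- The constraint set is convex, and by the parallelogram law the midpoint of two distinct
minimizers would be strictly shorter. Thus Xû is determined even when û is not. -/
theorem isMinNorm_unique {r : ℝ} {z : Data n p} {v : Fin p → ℝ} {w w' : Fin n → ℝ}
    (h : IsMinNorm r z v w) (h' : IsMinNorm r z v w') : w = w' := by
  have hmid : (1 / 2 : ℝ) • (w + w') ∈ dualSet r z v := fun j => by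
    have h1 := abs_le.1 (h.1 j)
    have h2 := abs_le.1 (h'.1 j)
    have e : (n : ℝ)⁻¹ * ∑ i, (z i).2 j * ((1 / 2 : ℝ) • (w + w')) i - v j =
        (1 / 2) * ((n : ℝ)⁻¹ * ∑ i, (z i).2 j * w i - v j) +
        (1 / 2) * ((n : ℝ)⁻¹ * ∑ i, (z i).2 j * w' i - v j) := by
      have : ∑ i, (z i).2 j * ((1 / 2 : ℝ) • (w + w')) i =
          (1 / 2) * ∑ i, (z i).2 j * w i + (1 / 2) * ∑ i, (z i).2 j * w' i := by
        rw [Finset.mul_sum, Finset.mul_sum, ← Finset.sum_add_distrib]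
        exact Finset.sum_congr rfl fun i _ => by simp; ring
      rw [this]; ring
    rw [e]
    exact abs_le.2 ⟨by linarith, by linarith⟩
  have h1 := h.2 _ hmid
  have h2 := h.2 _ h'.1
  have h3 := h'.2 _ h.1
  have e : (w - w') ⬝ᵥ (w - w') = 2 * (w ⬝ᵥ w) + 2 * (w' ⬝ᵥ w') -
      4 * (((1 / 2 : ℝ) • (w + w')) ⬝ᵥ ((1 / 2 : ℝ) • (w + w'))) := by
    simp only [sub_dotProduct, dotProduct_sub, add_dotProduct, dotProduct_add, smul_dotProduct,
      dotProduct_smul, smul_eq_mul]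
    ring
  have h4 : (w - w') ⬝ᵥ (w - w') = 0 := le_antisymm (by linarith) (dot_self_nonneg _)
  exact sub_eq_zero.1 (dotProduct_self_eq_zero.1 h4)

/-- Every vector is a vector in the range of the design plus one orthogonal to the columns. -/
theorem exists_design_decomp (z : Data n p) (w : Fin n → ℝ) : ∃ u : Fin p → ℝ,
    (∀ j, ∑ i, (z i).2 j * (w i - (design z *ᵥ u) i) = 0) ∧
      w ⬝ᵥ w = (design z *ᵥ u) ⬝ᵥ (design z *ᵥ u) +
        (w - design z *ᵥ u) ⬝ᵥ (w - design z *ᵥ u) := by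
  let T : (Fin p → ℝ) →ₗ[ℝ] EuclideanSpace ℝ (Fin n) :=
    (WithLp.linearEquiv 2 ℝ (Fin n → ℝ)).symm.toLinearMap ∘ₗ (design z).mulVecLin
  obtain ⟨y, hy, y', hy', hsum⟩ := (LinearMap.range T).exists_add_mem_mem_orthogonal (WithLp.toLp 2 w)
  obtain ⟨u, rfl⟩ := hy
  have hT : ∀ u, (T u).ofLp = design z *ᵥ u := fun u => rfl
  have hy2 : y'.ofLp = w - design z *ᵥ u := by
    have := congrArg WithLp.ofLp hsum
    simp only [WithLp.ofLp_add, hT] at this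
    rw [this]; simp
  have horth : ∀ u', (design z *ᵥ u') ⬝ᵥ (w - design z *ᵥ u) = 0 := fun u' => by
    have h := (Submodule.mem_orthogonal _ _).1 hy' (T u') ⟨u', rfl⟩
    rw [EuclideanSpace.inner_eq_star_dotProduct, star_trivial, hT, hy2, dotProduct_comm] at h
    exact h
  refine ⟨u, fun j => ?_, ?_⟩
  · have h := horth (Pi.single j 1)
    rw [Matrix.mulVec_single_one] at h
    exact h
  · have h := horth u
    have e : w = design z *ᵥ u + (w - design z *ᵥ u) := by abel
    conv_lhs => rw [e]
    simp only [add_dotProduct, dotProduct_add]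
    rw [h, dotProduct_comm (w - design z *ᵥ u) (design z *ᵥ u), h]
    ring

theorem design_mem_dualSet {r : ℝ} {z : Data n p} {v : Fin p → ℝ} {w : Fin n → ℝ} {u : Fin p → ℝ}
    (hw : w ∈ dualSet r z v) (hu : ∀ j, ∑ i, (z i).2 j * (w i - (design z *ᵥ u) i) = 0) :
    design z *ᵥ u ∈ dualSet r z v := fun j => by
  have h := hu j
  simp only [mul_sub, Finset.sum_sub_distrib] at h
  rw [← sub_eq_zero.1 h]
  exact hw j

/-- A competitor in ℝⁿ may be projected onto the range of X: this preserves the constraints and does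
not increase the norm. The problems in u and in w therefore agree, and in w the objective is
strictly convex and coercive. -/
theorem isMinNorm_of_isDirection (hn : 0 < n) {Cξ : ℝ} {z : Data n p} {v u : Fin p → ℝ}
    (h : IsDirection Cξ z v u) :
    IsMinNorm (Cξ * l2 v * √(Real.log p / n)) z v (design z *ᵥ u) := by
  have hn' : (0 : ℝ) < (n : ℝ)⁻¹ := by positivity
  refine ⟨(feasible_iff _ _ _ _).1 h.1, fun w' hw' => ?_⟩
  obtain ⟨u', hu', hsq⟩ := exists_design_decomp z w'
  have h1 := h.2 u' ((feasible_iff _ _ _ _).2 (design_mem_dualSet hw' hu'))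
  rw [dot_sampleCov_mulVec, dot_sampleCov_mulVec] at h1
  have h2 := le_of_mul_le_mul_left h1 hn'
  have := dot_self_nonneg (w' - design z *ᵥ u')
  linarith

theorem isClosed_dualSet (r : ℝ) (v : Fin p → ℝ) :
    IsClosed {q : Data n p × (Fin n → ℝ) | q.2 ∈ dualSet r q.1 v} := by
  have h : {q : Data n p × (Fin n → ℝ) | q.2 ∈ dualSet r q.1 v} =
      ⋂ j, {q : Data n p × (Fin n → ℝ) | |(n : ℝ)⁻¹ * ∑ i, (q.1 i).2 j * q.2 i - v j| ≤ r} := by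
    ext q
    simp [dualSet]
  rw [h]
  refine isClosed_iInter fun j => isClosed_le ?_ continuous_const
  fun_prop

theorem continuous_dot_self : Continuous fun w : Fin n → ℝ => w ⬝ᵥ w := by
  unfold dotProduct
  fun_prop

theorem norm_le_sqrt_dot (w : Fin n → ℝ) : ‖w‖ ≤ √(w ⬝ᵥ w) := by
  refine (pi_norm_le_iff_of_nonneg (Real.sqrt_nonneg _)).2 fun i => Real.le_sqrt_of_sq_le ?_
  rw [Real.norm_eq_abs, sq_abs, sq]
  exact Finset.single_le_sum (f := fun i => w i * w i) (fun i _ => mul_self_nonneg _) (Finset.mem_univ i)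

theorem exists_isMinNorm {r : ℝ} {z : Data n p} {v : Fin p → ℝ} (h : (dualSet r z v).Nonempty) :
    ∃ w, IsMinNorm r z v w := by
  obtain ⟨w₀, hw₀⟩ := h
  have hcl : IsClosed (dualSet r z v) :=
    (isClosed_dualSet r v).preimage (by fun_prop : Continuous fun w : Fin n → ℝ => (z, w))
  have hK : IsCompact (dualSet r z v ∩ {w | w ⬝ᵥ w ≤ w₀ ⬝ᵥ w₀}) := by
    refine Metric.isCompact_of_isClosed_isBounded
      (hcl.inter (isClosed_le continuous_dot_self continuous_const)) ?_
    refine (Metric.isBounded_closedBall (x := (0 : Fin n → ℝ)) (r := √(w₀ ⬝ᵥ w₀))).subset fun w hw => ?_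
    rw [mem_closedBall_zero_iff]
    exact (norm_le_sqrt_dot w).trans (Real.sqrt_le_sqrt hw.2)
  obtain ⟨w, hw, hmin⟩ := hK.exists_isMinOn ⟨w₀, hw₀, by rw [Set.mem_ofPred_eq]⟩ continuous_dot_self.continuousOn
  refine ⟨w, hw.1, fun w' hw' => ?_⟩
  rcases le_total (w' ⬝ᵥ w') (w₀ ⬝ᵥ w₀) with h | h
  · exact hmin ⟨hw', h⟩
  · exact le_trans hw.2 h

theorem exists_isDirection {Cξ : ℝ} {z : Data n p} {v : Fin p → ℝ}
    (h : (dualSet (Cξ * l2 v * √(Real.log p / n)) z v).Nonempty) : ∃ u, IsDirection Cξ z v u := by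
  obtain ⟨w, hw⟩ := exists_isMinNorm h
  obtain ⟨u, hu, hsq⟩ := exists_design_decomp z w
  refine ⟨u, (feasible_iff _ _ _ _).2 (design_mem_dualSet hw.1 hu), fun u' hu' => ?_⟩
  rw [dot_sampleCov_mulVec, dot_sampleCov_mulVec]
  have h1 := hw.2 _ ((feasible_iff _ _ _ _).1 hu')
  have := dot_self_nonneg (w - design z *ᵥ u)
  exact mul_le_mul_of_nonneg_left (by linarith) (by positivity)

theorem direction_spec {Cξ : ℝ} {z : Data n p} {v : Fin p → ℝ}
    (h : (dualSet (Cξ * l2 v * √(Real.log p / n)) z v).Nonempty) :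
    IsDirection Cξ z v (direction Cξ z v) := by
  have h' := exists_isDirection h
  unfold direction
  rw [dif_pos h']
  exact h'.choose_spec

theorem direction_eq_zero {Cξ : ℝ} {z : Data n p} {v : Fin p → ℝ}
    (h : ¬ (dualSet (Cξ * l2 v * √(Real.log p / n)) z v).Nonempty) : direction Cξ z v = 0 := by
  unfold direction
  rw [dif_neg]
  rintro ⟨u, hu⟩
  exact h ⟨_, (feasible_iff _ _ _ _).1 hu.1⟩

/-- The fitted projection direction `X û`. -/
noncomputable def fitDir (Cξ : ℝ) (v : Fin p → ℝ) (z : Data n p) : Fin n → ℝ :=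
  design z *ᵥ direction Cξ z v

/-- A projection of a closed set need not be closed; here the bound on w·w keeps the witnesses along
a convergent sequence bounded, so a subsequence of them converges. -/
theorem isClosed_exists_dualSet (r : ℝ) (v : Fin p → ℝ) {F : Set (Fin n → ℝ)} (hF : IsClosed F) :
    IsClosed {q : Data n p × ℝ | ∃ w ∈ F, w ∈ dualSet r q.1 v ∧ w ⬝ᵥ w ≤ q.2} := by
  refine IsSeqClosed.isClosed fun x q hx hq => ?_
  choose w hwF hwK hwn using hx
  obtain ⟨R, hR⟩ := ((continuous_snd.tendsto q).comp hq).bddAbove_range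
  have hb : ∀ k, w k ∈ Metric.closedBall (0 : Fin n → ℝ) √R := fun k => by
    rw [mem_closedBall_zero_iff]
    exact (norm_le_sqrt_dot _).trans (Real.sqrt_le_sqrt ((hwn k).trans (hR ⟨k, rfl⟩)))
  obtain ⟨w', -, φ, hφ, hlim⟩ := tendsto_subseq_of_bounded Metric.isBounded_closedBall hb
  have hq' := hq.comp hφ.tendsto_atTop
  refine ⟨w', hF.mem_of_tendsto hlim (Filter.Eventually.of_forall fun k => hwF _), ?_, ?_⟩
  · exact (isClosed_dualSet r v).mem_of_tendsto
      (((continuous_fst.tendsto q).comp hq').prodMk_nhds hlim) (Filter.Eventually.of_forall fun k => hwK _)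
  · exact le_of_tendsto_of_tendsto ((continuous_dot_self.tendsto w').comp hlim)
      ((continuous_snd.tendsto q).comp hq') (Filter.Eventually.of_forall fun k => hwn _)

/-- The least squared norm is measurable, since its sublevel sets are given by closed conditions of
the preceding kind. By uniqueness the minimizer lies in a closed set F exactly when some feasible w
in F has squared norm at most this minimum. Infeasible data, where the default is 0, are treated
separately. -/
theorem measurable_fitDir (hn : 0 < n) (Cξ : ℝ) (v : Fin p → ℝ) :
    Measurable (fitDir Cξ v : Data n p → Fin n → ℝ) := by
  set r := Cξ * l2 v * √(Real.log p / n)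
  have hspec : ∀ z : Data n p, (dualSet r z v).Nonempty → IsMinNorm r z v (fitDir Cξ v z) :=
    fun z h => isMinNorm_of_isDirection hn (direction_spec h)
  have hzero : ∀ z : Data n p, ¬ (dualSet r z v).Nonempty → fitDir Cξ v z = 0 := fun z h => by
    unfold fitDir
    rw [direction_eq_zero h, Matrix.mulVec_zero]
  have hA : ∀ {F : Set (Fin n → ℝ)}, IsClosed F → ∀ {d : Data n p → ℝ}, Measurable d →
      MeasurableSet {z : Data n p | ∃ w ∈ F, w ∈ dualSet r z v ∧ w ⬝ᵥ w ≤ d z} := fun hF d hd =>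
    (measurable_id.prodMk hd) (isClosed_exists_dualSet r v hF).measurableSet
  have hne : MeasurableSet {z : Data n p | (dualSet r z v).Nonempty} := by
    have : {z : Data n p | (dualSet r z v).Nonempty} =
        ⋃ k : ℕ, {z : Data n p | ∃ w ∈ Set.univ, w ∈ dualSet r z v ∧ w ⬝ᵥ w ≤ (k : ℝ)} := by
      ext z
      simp only [Set.mem_iUnion, Set.mem_ofPred_eq, Set.mem_univ, true_and]
      constructor
      · rintro ⟨w, hw⟩
        obtain ⟨k, hk⟩ := exists_nat_ge (w ⬝ᵥ w)
        exact ⟨k, w, hw, hk⟩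
      · rintro ⟨k, w, hw, -⟩
        exact ⟨w, hw⟩
    rw [this]
    exact MeasurableSet.iUnion fun k => hA isClosed_univ measurable_const
  have hd : Measurable fun z : Data n p => fitDir Cξ v z ⬝ᵥ fitDir Cξ v z := by
    refine measurable_of_Iic fun x => ?_
    have : (fun z : Data n p => fitDir Cξ v z ⬝ᵥ fitDir Cξ v z) ⁻¹' Set.Iic x =
        {z | ∃ w ∈ Set.univ, w ∈ dualSet r z v ∧ w ⬝ᵥ w ≤ x} ∪
        ({z | (dualSet r z v).Nonempty}ᶜ ∩ {_z | 0 ≤ x}) := by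
      ext z
      simp only [Set.mem_preimage, Set.mem_Iic, Set.mem_union, Set.mem_ofPred_eq, Set.mem_univ,
        true_and, Set.mem_inter_iff, Set.mem_compl_iff]
      by_cases h : (dualSet r z v).Nonempty
      · have h1 := hspec z h
        constructor
        · intro h2
          exact Or.inl ⟨_, h1.1, h2⟩
        · rintro (⟨w, hw, hwx⟩ | ⟨h2, -⟩)
          · exact (h1.2 w hw).trans hwx
          · exact absurd h h2
      · rw [hzero z h, zero_dotProduct]
        constructor
        · intro h2
          exact Or.inr ⟨h, h2⟩
        · rintro (⟨w, hw, -⟩ | ⟨-, h2⟩)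
          · exact absurd ⟨w, hw⟩ h
          · exact h2
    rw [this]
    exact (hA isClosed_univ measurable_const).union (hne.compl.inter (MeasurableSet.const _))
  refine measurable_of_isClosed fun F hF => ?_
  have : (fitDir Cξ v : Data n p → Fin n → ℝ) ⁻¹' F =
      {z | ∃ w ∈ F, w ∈ dualSet r z v ∧ w ⬝ᵥ w ≤ fitDir Cξ v z ⬝ᵥ fitDir Cξ v z} ∪
      ({z | (dualSet r z v).Nonempty}ᶜ ∩ {_z | (0 : Fin n → ℝ) ∈ F}) := by
    ext z
    simp only [Set.mem_preimage, Set.mem_union, Set.mem_ofPred_eq, Set.mem_inter_iff,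
      Set.mem_compl_iff]
    by_cases h : (dualSet r z v).Nonempty
    · have h1 := hspec z h
      constructor
      · intro h2
        exact Or.inl ⟨_, h2, h1.1, le_rfl⟩
      · rintro (⟨w, hwF, hw, hwx⟩ | ⟨h2, -⟩)
        · have h3 : IsMinNorm r z v w := ⟨hw, fun w' hw' => hwx.trans (h1.2 w' hw')⟩
          rwa [isMinNorm_unique h1 h3]
        · exact absurd h h2
    · rw [hzero z h]
      constructor
      · intro h2
        exact Or.inr ⟨h, h2⟩
      · rintro (⟨w, -, hw, -⟩ | ⟨-, h2⟩)
        · exact absurd ⟨w, hw⟩ h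
        · exact h2
  rw [this]
  exact (hA hF hd).union (hne.compl.inter (MeasurableSet.const _))

end AdaptiveSep

namespace AdaptiveSep
variable {n p : ℕ}

/-! ### Gaussian noise in a direction depending on the design -/

theorem measure_dot_gaussian_gt {σ : ℝ} (hσ : 0 < σ) {w : Fin n → ℝ} (hw : 0 < w ⬝ᵥ w) {A : ℝ} (hA : 0 < A) :
    Measure.pi (fun _ : Fin n => gaussianReal 0 (σ ^ 2).toNNReal)
      {e | A * σ * √(w ⬝ᵥ w) ≤ w ⬝ᵥ e} ≤ ENNReal.ofReal (Real.exp (-(A ^ 2 / 2))) := by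
  set N := √(w ⬝ᵥ w) with hN
  have hN0 : 0 < N := Real.sqrt_pos.2 hw
  have hN2 : N ^ 2 = w ⬝ᵥ w := Real.sq_sqrt hw.le
  -- This l minimizes the Chernoff exponent σ²l²N²/2 - lAσN.
  set l := A / (σ * N) with hl
  have hl0 : 0 < l := by positivity
  have h1 : ∀ c : ℝ, ∫⁻ x, ENNReal.ofReal (Real.exp (c * x)) ∂(gaussianReal 0 (σ ^ 2).toNNReal) =
      ENNReal.ofReal (Real.exp (σ ^ 2 * c ^ 2 / 2)) := fun c => by
    rw [← ofReal_integral_eq_lintegral_ofReal (integrable_exp_mul_gaussianReal c)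
      (Filter.Eventually.of_forall fun x => (Real.exp_pos _).le)]
    congr 1
    have h := mgf_gaussianReal (p := gaussianReal 0 (σ ^ 2).toNNReal) (X := id) Measure.map_id c
    unfold mgf at h
    simp only [id] at h
    rw [h, Real.coe_toNNReal _ (sq_nonneg σ)]
    congr 1; ring
  have hm : ∀ i : Fin n, Measurable fun x : ℝ => ENNReal.ofReal (Real.exp (l * w i * x)) :=
    fun _ => by fun_prop
  have h := mul_meas_ge_le_lintegral (μ := Measure.pi (fun _ : Fin n => gaussianReal 0 (σ ^ 2).toNNReal))
    (f := fun e => ∏ i, ENNReal.ofReal (Real.exp (l * w i * e i)))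
    (Finset.measurable_prod _ fun i _ => (hm i).comp (measurable_pi_apply i))
    (ENNReal.ofReal (Real.exp (l * (A * σ * N))))
  rw [lintegral_pi_prod _ hm] at h
  simp only [h1] at h
  rw [← ENNReal.ofReal_prod_of_nonneg fun i _ => (Real.exp_pos _).le, ← Real.exp_sum] at h
  have hset : {e : Fin n → ℝ | A * σ * N ≤ w ⬝ᵥ e} ⊆
      {e | ENNReal.ofReal (Real.exp (l * (A * σ * N))) ≤
        ∏ i, ENNReal.ofReal (Real.exp (l * w i * e i))} := fun e he => by
    simp only [Set.mem_ofPred_eq] at he ⊢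
    rw [← ENNReal.ofReal_prod_of_nonneg fun i _ => (Real.exp_pos _).le, ← Real.exp_sum]
    simp only [mul_assoc, ← Finset.mul_sum]
    refine ENNReal.ofReal_le_ofReal (Real.exp_le_exp.2 ?_)
    rw [← mul_assoc A]
    exact mul_le_mul_of_nonneg_left he hl0.le
  refine (measure_mono hset).trans ?_
  have e1 : ∑ i, σ ^ 2 * (l * w i) ^ 2 / 2 = A ^ 2 / 2 := by
    have : ∑ i, σ ^ 2 * (l * w i) ^ 2 / 2 = σ ^ 2 * l ^ 2 / 2 * (w ⬝ᵥ w) := by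
      rw [dotProduct, Finset.mul_sum]
      exact Finset.sum_congr rfl fun i _ => by ring
    rw [this, ← hN2, hl]
    field_simp
  have e2 : l * (A * σ * N) = A ^ 2 := by rw [hl]; field_simp
  rw [e1, e2] at h
  rw [e2]
  have e3 : -(A ^ 2 / 2) = A ^ 2 / 2 - A ^ 2 := by ring
  rw [e3, Real.exp_sub, ENNReal.ofReal_div_of_pos (Real.exp_pos _),
    ENNReal.le_div_iff_mul_le (Or.inl (by simp [Real.exp_pos])) (Or.inl ENNReal.ofReal_ne_top),
    mul_comm]
  exact h

theorem measure_abs_dot_gaussian_gt {σ : ℝ} (hσ : 0 < σ) (w : Fin n → ℝ) {A : ℝ} (hA : 0 < A) :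
    Measure.pi (fun _ : Fin n => gaussianReal 0 (σ ^ 2).toNNReal)
      {e | A * σ * √(w ⬝ᵥ w) < |w ⬝ᵥ e|} ≤ 2 * ENNReal.ofReal (Real.exp (-(A ^ 2 / 2))) := by
  rcases (dot_self_nonneg w).eq_or_lt with h0 | h0
  · have : w = 0 := dotProduct_self_eq_zero.1 h0.symm
    simp [this]
  · have h1 := measure_dot_gaussian_gt hσ h0 hA
    have h2 := measure_dot_gaussian_gt hσ (w := -w) (by simpa using h0) hA
    refine (measure_mono (fun e he => ?_)).trans ((measure_union_le _ _).trans
      ((add_le_add h1 h2).trans (by rw [two_mul])))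
    simp only [Set.mem_ofPred_eq, Set.mem_union] at he ⊢
    rcases lt_abs.1 he with h | h
    · exact Or.inl h.le
    · right
      rw [neg_dotProduct_neg, neg_dotProduct]
      exact h.le

theorem measurable_dataMap (β : Fin p → ℝ) :
    Measurable fun (q : (Fin n → EuclideanSpace ℝ (Fin p)) × (Fin n → ℝ)) (i : Fin n) =>
      (((q.1 i).ofLp ⬝ᵥ β + q.2 i, (q.1 i).ofLp) : ℝ × (Fin p → ℝ)) := by
  refine measurable_pi_lambda _ fun i => ?_
  have h : Measurable fun q : (Fin n → EuclideanSpace ℝ (Fin p)) × (Fin n → ℝ) => (q.1 i, q.2 i) :=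
    ((measurable_pi_apply i).comp measurable_fst).prodMk
      ((measurable_pi_apply i).comp measurable_snd)
  exact (measurable_obs β).comp h

/-- The data as a function of design and noise. -/
theorem dataLaw_eq_map (n : ℕ) (θ : Param p) :
    dataLaw n θ = ((Measure.pi fun _ : Fin n => multivariateGaussian 0 θ.Sig).prod
      (Measure.pi fun _ : Fin n => gaussianReal 0 (θ.sigma ^ 2).toNNReal)).map
      (fun q i => ((q.1 i).ofLp ⬝ᵥ θ.beta + q.2 i, (q.1 i).ofLp)) := by
  have hmp := measurePreserving_arrowProdEquivProdArrow (EuclideanSpace ℝ (Fin p)) ℝ (Fin n)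
    (fun _ => multivariateGaussian 0 θ.Sig) (fun _ => gaussianReal 0 (θ.sigma ^ 2).toNNReal)
  have hm := measurable_dataMap (n := n) θ.beta
  rw [← hmp.map_eq, Measure.map_map hm (MeasurableEquiv.measurable _)]
  unfold dataLaw obsLaw
  rw [← Measure.pi_map_pi fun _ => (measurable_obs θ.beta).aemeasurable]
  rfl

/-- W depends on the design only, so by Fubini it is fixed while the noise is integrated. The
Gaussian tail of W·ε/(σ‖W‖) does not depend on the fixed vector, which handles the random direction
Xû. -/
theorem measure_noise_gt {θ : Param p} (hσ : 0 < θ.sigma) {W : Data n p → Fin n → ℝ}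
    (hW : Measurable W) (hdep : ∀ z z' : Data n p, design z = design z' → W z = W z') {A : ℝ}
    (hA : 0 < A) :
    dataLaw n θ {z | A * θ.sigma * √(W z ⬝ᵥ W z) < |W z ⬝ᵥ fun i => (z i).1 - (z i).2 ⬝ᵥ θ.beta|} ≤
      2 * ENNReal.ofReal (Real.exp (-(A ^ 2 / 2))) := by
  have hm := measurable_dataMap (n := n) θ.beta
  have hmε : Measurable fun (z : Data n p) (i : Fin n) => (z i).1 - (z i).2 ⬝ᵥ θ.beta := by
    refine Continuous.measurable ?_
    unfold dotProduct
    fun_prop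
  have hmd : Measurable fun q : (Fin n → ℝ) × (Fin n → ℝ) => q.1 ⬝ᵥ q.2 := by
    refine Continuous.measurable ?_
    unfold dotProduct
    fun_prop
  have hset : MeasurableSet {z : Data n p | A * θ.sigma * √(W z ⬝ᵥ W z) <
      |W z ⬝ᵥ fun i => (z i).1 - (z i).2 ⬝ᵥ θ.beta|} := by
    have h1 : Measurable fun z : Data n p => W z ⬝ᵥ W z := hmd.comp (hW.prodMk hW)
    have h2 : Measurable fun z : Data n p => W z ⬝ᵥ fun i => (z i).1 - (z i).2 ⬝ᵥ θ.beta :=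
      hmd.comp (hW.prodMk hmε)
    exact measurableSet_lt (h1.sqrt.const_mul _) (continuous_abs.measurable.comp h2)
  rw [dataLaw_eq_map, Measure.map_apply hm hset, Measure.prod_apply (hm hset)]
  refine (lintegral_mono (g := fun _ => 2 * ENNReal.ofReal (Real.exp (-(A ^ 2 / 2))))
    fun x => ?_).trans (le_of_eq (by simp))
  · refine (measure_mono fun e he => ?_).trans (measure_abs_dot_gaussian_gt hσ
      (W fun i => (0, (x i).ofLp)) hA)
    simp only [Set.mem_preimage, Set.mem_ofPred_eq] at he ⊢
    -- W does not see the responses, so they may be set to 0; this makes the direction independent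
    -- of the noise variable.
    rw [hdep (fun i => ((x i).ofLp ⬝ᵥ θ.beta + e i, (x i).ofLp)) (fun i => (0, (x i).ofLp)) rfl] at he
    simpa using he

/-! ### Feasibility of the population direction -/

/-- The vector is u = Σ⁻¹v. From ‖u‖² ≤ M₁ u·v and Cauchy–Schwarz, (u·v)² ≤ M₁ (u·v) ‖v‖². -/
theorem exists_mulVec_eq {M₁ M₂ : ℝ} {k : ℕ} (hM : 1 < M₁) {θ : Param p}
    (hθ : θ ∈ paramSpace p M₁ M₂ k) (v : Fin p → ℝ) :
    ∃ u, θ.Sig *ᵥ u = v ∧ u ⬝ᵥ θ.Sig *ᵥ u ≤ M₁ * (v ⬝ᵥ v) := by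
  obtain ⟨hS, hb⟩ := paramSpace_quadForm hM hθ
  have hinj : Function.Injective θ.Sig.mulVec := fun a b hab => by
    have h1 : θ.Sig *ᵥ (a - b) = 0 := by rw [Matrix.mulVec_sub]; exact sub_eq_zero.2 hab
    have h2 := (hb (a - b)).1
    rw [h1, dotProduct_zero] at h2
    by_contra hne
    have := dot_self_pos (sub_ne_zero.2 hne)
    have : 0 < 1 / M₁ * ((a - b) ⬝ᵥ (a - b)) := mul_pos (by positivity) this
    linarith
  obtain ⟨u, hu⟩ := Matrix.mulVec_surjective_iff_isUnit.2 (Matrix.mulVec_injective_iff_isUnit.1 hinj) v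
  refine ⟨u, hu, ?_⟩
  have h1 := (hb u).1
  rw [hu] at h1 ⊢
  have h2 := dot_sq_le u v
  have h3 := dot_self_nonneg u
  have h4 := dot_self_nonneg v
  have hM0 : 0 < M₁ := by linarith
  have h5 : u ⬝ᵥ u ≤ M₁ * (u ⬝ᵥ v) := by
    rw [one_div, inv_mul_le_iff₀ hM0] at h1
    exact h1
  by_contra hcon
  rw [not_le] at hcon
  have h6 : 0 < u ⬝ᵥ v := lt_of_le_of_lt (by positivity) hcon
  have h7 : (u ⬝ᵥ v) ^ 2 ≤ M₁ * (u ⬝ᵥ v) * (v ⬝ᵥ v) :=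
    h2.trans (mul_le_mul_of_nonneg_right h5 h4)
  nlinarith

/-- The witness is w = XΣ⁻¹v. Entry j of n⁻¹Xᵀw is an empirical covariance with mean v_j; at t =
4√(log p / n) its deviation is at most 2t √M₁ · √M₁ ‖v‖₂, whence the constant 8M₁. Its squared norm
exceeds twice its mean, itself at most nM₁‖v‖², with probability at most exp(-n/8). The vector v = 0
is set apart because the variance vanishes. -/
theorem measure_not_feasible {M₁ M₂ : ℝ} {k : ℕ} (hM : 1 < M₁) {θ : Param p}
    (hθ : θ ∈ paramSpace p M₁ M₂ k) (hn : 0 < n) (hp : 1 < p) (hL : 16 * Real.log p ≤ n)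
    (v : Fin p → ℝ) :
    dataLaw n θ {z | ¬ ∃ w ∈ dualSet (8 * M₁ * l2 v * √(Real.log p / n)) z v,
      w ⬝ᵥ w ≤ 2 * n * M₁ * l2 v ^ 2} ≤ ENNReal.ofReal (4 / p + Real.exp (-(n / 8))) := by
  rcases eq_or_ne v 0 with hv | hv
  · have h : {z : Data n p | ¬ ∃ w ∈ dualSet (8 * M₁ * l2 v * √(Real.log p / n)) z v,
      w ⬝ᵥ w ≤ 2 * n * M₁ * l2 v ^ 2} = ∅ := by
      ext z
      simp only [Set.mem_ofPred_eq, Set.mem_empty_iff_false, iff_false, not_not]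
      refine ⟨0, fun j => ?_, ?_⟩
      · subst hv
        simp [l2]
      · rw [zero_dotProduct]
        positivity
    rw [h, measure_empty]
    exact zero_le
  obtain ⟨u, hu, huv⟩ := exists_mulVec_eq hM hθ v
  obtain ⟨hS, hb⟩ := paramSpace_quadForm hM hθ
  have hM0 : 0 < M₁ := by linarith
  have hlog : 0 < Real.log p := Real.log_pos (by exact_mod_cast hp)
  have hn' : (0 : ℝ) < n := by exact_mod_cast hn
  have hp' : (0 : ℝ) < p := by positivity
  have hu0 : u ≠ 0 := fun h => hv (by rw [← hu, h, Matrix.mulVec_zero])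
  have hvar : 0 < linCov θ u 0 u 0 := by
    rw [linCov_zero_right]
    exact lt_of_lt_of_le (mul_pos (by positivity) (dot_self_pos hu0)) (hb u).1
  set t := 4 * √(Real.log p / n) with ht
  have ht2 : t ^ 2 = 16 * Real.log p / n := by
    rw [ht, mul_pow, Real.sq_sqrt (by positivity)]; ring
  have ht1 : t ≤ 1 := by
    have h0 : 0 ≤ t := by positivity
    refine (sq_le_one_iff₀ h0).1 ?_
    rw [ht2, div_le_one hn']
    exact hL
  have hA : ∀ j : Fin p, dataLaw n θ {z | 8 * M₁ * l2 v * √(Real.log p / n) <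
      |(n : ℝ)⁻¹ * ∑ i, (z i).2 j * (design z *ᵥ u) i - v j|} ≤
      4 * ENNReal.ofReal (Real.exp (-(2 * Real.log p))) := fun j => by
    obtain ⟨hd0, hd1⟩ := sig_diag_bounds hM hθ j
    have h := measure_abs_sum_mul_sub_ge hn hS (Pi.single j 1) u 0 0 hd0 hvar (t := t) (by positivity) ht1
    refine (measure_mono fun z hz => ?_).trans (h.trans (le_of_eq ?_))
    · have hcov : linCov θ (Pi.single j 1) 0 u 0 = v j := by unfold linCov; simp [hu]
      simp only [Set.mem_ofPred_eq, linFun_zero_right, hcov, single_one_dotProduct] at hz ⊢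
      have e1 : ∀ i, u ⬝ᵥ (z i).2 = (design z *ᵥ u) i := fun i => dotProduct_comm _ _
      simp only [e1]
      have e2 : ∑ i, (z i).2 j * (design z *ᵥ u) i - n * v j =
          n * ((n : ℝ)⁻¹ * ∑ i, (z i).2 j * (design z *ᵥ u) i - v j) := by field_simp
      rw [e2, abs_mul, abs_of_pos hn']
      refine lt_of_le_of_lt ?_ (mul_lt_mul_of_pos_left hz hn')
      have h3 : √(linCov θ (Pi.single j 1) 0 (Pi.single j 1) 0) ≤ √M₁ := Real.sqrt_le_sqrt hd1
      have h4 : √(linCov θ u 0 u 0) ≤ √M₁ * l2 v := by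
        rw [linCov_zero_right]
        refine (Real.sqrt_le_left (mul_nonneg (Real.sqrt_nonneg _) (l2_nonneg v))).2 ?_
        rw [mul_pow, Real.sq_sqrt hM0.le, l2_sq]
        exact huv
      calc _ ≤ 2 * n * t * (√M₁ * (√M₁ * l2 v)) := by gcongr
        _ = 2 * n * t * ((√M₁ * √M₁) * l2 v) := by ring
        _ = _ := by rw [Real.mul_self_sqrt hM0.le, ht]; ring
    · congr 4
      rw [ht2]; field_simp; norm_num
  have hB := measure_sum_sq_ge (n := n) (continuous_linFun θ u 0).measurable hvar (map_linFun hS u 0)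
    (t := 1) (by norm_num) le_rfl
  refine (measure_mono (t := (⋃ j : Fin p, {z | 8 * M₁ * l2 v * √(Real.log p / n) <
      |(n : ℝ)⁻¹ * ∑ i, (z i).2 j * (design z *ᵥ u) i - v j|}) ∪
      {z | n * linCov θ u 0 u 0 * (1 + 1) ≤ ∑ i, linFun θ u 0 (z i) ^ 2}) fun z hz => ?_).trans
      ((measure_union_le _ _).trans ?_)
  · by_contra hcon
    simp only [Set.mem_union, Set.mem_iUnion, Set.mem_ofPred_eq, not_or, not_exists, not_lt,
      not_le, linCov_zero_right, linFun_zero_right] at hcon hz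
    refine hz (design z *ᵥ u) ⟨fun j => hcon.1 j, ?_⟩
    have e1 : ∀ i, u ⬝ᵥ (z i).2 = (design z *ᵥ u) i := fun i => dotProduct_comm _ _
    simp only [e1] at hcon
    have e2 : (design z *ᵥ u) ⬝ᵥ (design z *ᵥ u) = ∑ i, (design z *ᵥ u) i ^ 2 := by
      simp [dotProduct, sq]
    rw [e2, l2_sq]
    refine hcon.2.le.trans ?_
    have := mul_le_mul_of_nonneg_left huv hn'.le
    linarith
  · rw [ENNReal.ofReal_add (by positivity) (by positivity)]
    refine add_le_add ((measure_iUnion_fintype_le _ _).trans ((Finset.sum_le_sum fun j _ =>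
      hA j).trans (le_of_eq ?_))) (hB.trans (le_of_eq (by norm_num)))
    rw [Finset.sum_const, Finset.card_univ, Fintype.card_fin, nsmul_eq_mul,
      ← ENNReal.ofReal_natCast, ← ENNReal.ofReal_ofNat, ← ENNReal.ofReal_mul (by norm_num),
      ← ENNReal.ofReal_mul (by positivity)]
    congr 1
    have : Real.exp (-(2 * Real.log p)) = ((p : ℝ) ^ 2)⁻¹ := by
      rw [Real.exp_neg, ← Nat.cast_two, Real.exp_nat_mul, Real.exp_log hp']
    rw [this]
    field_simp

end AdaptiveSep

namespace AdaptiveSep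
variable {n p : ℕ}

/-! ### The mixed test -/

/-- A Minkowski sum with an empty summand is empty, hence the two nonemptiness conditions; the form
on the right makes the rejection region visibly measurable. -/
theorem mem_Icc_add_Icc {x a b c d : ℝ} :
    x ∈ Set.Icc a b + Set.Icc c d ↔ a ≤ b ∧ c ≤ d ∧ a + c ≤ x ∧ x ≤ b + d := by
  constructor
  · rintro ⟨y, ⟨h1, h2⟩, y', ⟨h3, h4⟩, rfl⟩
    exact ⟨h1.trans h2, h3.trans h4, add_le_add h1 h3, add_le_add h2 h4⟩
  · rintro ⟨h1, h2, h3, h4⟩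
    rw [Set.Icc_add_Icc h1 h2]
    exact ⟨h3, h4⟩

/-- Centre of the debiased interval. -/
noncomputable def debiasedCentre (Cξ : ℝ) (b v : Fin p → ℝ) (z : Data n p) : ℝ :=
  v ⬝ᵥ b + (n : ℝ)⁻¹ * (fitDir Cξ v z ⬝ᵥ fun i => (z i).1 - (z i).2 ⬝ᵥ b)

/-- Radius of the debiased interval. -/
noncomputable def debiasedRadius (Cξ A₁ A₂ : ℝ) (ku : ℕ) (s : ℝ) (v : Fin p → ℝ) (z : Data n p) : ℝ :=
  s * (A₁ * √((n : ℝ)⁻¹ * (fitDir Cξ v z ⬝ᵥ fitDir Cξ v z)) / √n + A₂ * l2 v * (ku * Real.log p / n))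

/-- Radius of the plug-in interval. -/
noncomputable def plugInRadius (n : ℕ) (A₃ : ℝ) (ku : ℕ) (s : ℝ) (v : Fin p → ℝ) : ℝ :=
  A₃ * s * linf v * ku * √(Real.log p / n)

/-- The interval depends on û only through Xû, so the arbitrary choice among minimizers û affects
neither the test nor its measurability. -/
theorem debiasedCI_eq (Cξ A₁ A₂ : ℝ) (ku : ℕ) (b : Fin p → ℝ) (s : ℝ) (z : Data n p)
    (v : Fin p → ℝ) : debiasedCI Cξ A₁ A₂ ku b s z v =
      Set.Icc (debiasedCentre Cξ b v z - debiasedRadius Cξ A₁ A₂ ku s v z)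
        (debiasedCentre Cξ b v z + debiasedRadius Cξ A₁ A₂ ku s v z) := by
  unfold debiasedCI debiasedCentre debiasedRadius fitDir
  simp only [dot_sampleCov_mulVec]
  rw [dotProduct_smul, Matrix.dotProduct_mulVec, Matrix.vecMul_transpose, smul_eq_mul]
  rfl

theorem plugInCI_eq (A₃ : ℝ) (ku : ℕ) (b : Fin p → ℝ) (s : ℝ) (v : Fin p → ℝ) :
    plugInCI n A₃ ku b s v =
      Set.Icc (v ⬝ᵥ b - plugInRadius n A₃ ku s v) (v ⬝ᵥ b + plugInRadius n A₃ ku s v) := rfl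

theorem continuous_dot : Continuous fun q : (Fin p → ℝ) × (Fin p → ℝ) => q.1 ⬝ᵥ q.2 := by
  unfold dotProduct
  fun_prop

theorem measurable_mixedTest (hn : 0 < n) (Cξ A₁ A₂ A₃ : ℝ) (ku : ℕ) {bhat : Data n p → Fin p → ℝ}
    {shat : Data n p → ℝ} (hb : Measurable bhat) (hs : Measurable shat) (ξ : Fin p → ℝ) (t₀ : ℝ)
    (m : ℕ) : Measurable (mixedTest Cξ A₁ A₂ A₃ ku bhat shat ξ t₀ m) := by
  classical
  have hdot : ∀ {q : ℕ} {f g : Data n p → Fin q → ℝ}, Measurable f → Measurable g →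
      Measurable fun z => f z ⬝ᵥ g z := fun hf hg =>
    continuous_dot.measurable.comp (hf.prodMk hg)
  have hfit := measurable_fitDir hn Cξ (head ξ m)
  have hres : Measurable fun (z : Data n p) (i : Fin n) => (z i).1 - (z i).2 ⬝ᵥ bhat z :=
    measurable_pi_lambda _ fun i => (measurable_pi_apply i).fst.sub
      (hdot (measurable_pi_apply i).snd hb)
  have hc : Measurable fun z : Data n p => debiasedCentre Cξ (bhat z) (head ξ m) z :=
    (hdot measurable_const hb).add ((hdot hfit hres).const_mul _)
  have hr : Measurable fun z : Data n p => debiasedRadius Cξ A₁ A₂ ku (shat z) (head ξ m) z :=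
    hs.mul (((((hdot hfit hfit).const_mul _).sqrt.const_mul _).div_const _).add_const _)
  have hc' : Measurable fun z : Data n p => (ξ - head ξ m) ⬝ᵥ bhat z := hdot measurable_const hb
  have hr' : Measurable fun z : Data n p => plugInRadius n A₃ ku (shat z) (ξ - head ξ m) :=
    (((hs.const_mul _).mul_const _).mul_const _).mul_const _
  unfold mixedTest
  refine Measurable.ite ?_ measurable_const measurable_const
  simp only [debiasedCI_eq, plugInCI_eq, mem_Icc_add_Icc]
  exact (measurableSet_le (hc.sub hr) (hc.add hr)).inter
    ((measurableSet_le (hc'.sub hr') (hc'.add hr')).inter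
    ((measurableSet_le ((hc.sub hr).add (hc'.sub hr')) measurable_const).inter
    (measurableSet_le measurable_const ((hc.add hr).add (hc'.add hr')))))

theorem abs_dot_le_linf_mul_l1 (v h : Fin p → ℝ) : |v ⬝ᵥ h| ≤ linf v * l1 h := by
  unfold dotProduct l1
  rw [Finset.mul_sum]
  refine (Finset.abs_sum_le_sum_abs _ _).trans (Finset.sum_le_sum fun j _ => ?_)
  rw [abs_mul]
  exact mul_le_mul_of_nonneg_right (le_ciSup (f := fun j => |v j|) (Set.finite_range _).bddAbove j)
    (abs_nonneg _)

theorem linf_nonneg (v : Fin p → ℝ) : 0 ≤ linf v := Real.iSup_nonneg fun _ => abs_nonneg _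

/-- The event on which the intervals are analysed. -/
structure GoodInterval (M₁ A : ℝ) (k : ℕ) (θ : Param p) (v : Fin p → ℝ) (z : Data n p) : Prop where
  accurate : z ∈ accurate (4000 * M₁ ^ 2) (2000 * M₁ ^ 2) k (betaHat n p k) (sigmaHat n p k) θ
  feasible : ∃ w ∈ dualSet (8 * M₁ * l2 v * √(Real.log p / n)) z v, w ⬝ᵥ w ≤ 2 * n * M₁ * l2 v ^ 2
  noise : |fitDir (8 * M₁) v z ⬝ᵥ fun i => (z i).1 - (z i).2 ⬝ᵥ θ.beta| ≤
    A * θ.sigma * √(fitDir (8 * M₁) v z ⬝ᵥ fitDir (8 * M₁) v z)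

/-- The error is (v - Σ̂û)·(β̂ - β) + n⁻¹ (Xû)·ε. The first term is bounded by the feasibility
radius times ‖β̂ - β‖₁, the second by the noise event. Replacing σ by 2σ̂ yields A₁ = 2A and A₂ =
8M₁ · 4000M₁² · 2. -/
theorem abs_debiasedCentre_sub_le (hn : 0 < n) {M₁ A : ℝ} (hM : 1 < M₁) (hA : 0 < A) {k : ℕ} {θ : Param p}
    (hσ : 0 < θ.sigma) {v : Fin p → ℝ} {z : Data n p} (h : GoodInterval M₁ A k θ v z) :
    |debiasedCentre (8 * M₁) (betaHat n p k z) v z - v ⬝ᵥ θ.beta| ≤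
      debiasedRadius (8 * M₁) (2 * A) (64000 * M₁ ^ 3) k (sigmaHat n p k z) v z := by
  have hn' : (0 : ℝ) < n := by exact_mod_cast hn
  obtain ⟨w₀, hw₀, -⟩ := h.feasible
  have hmin := isMinNorm_of_isDirection hn (direction_spec (z := z) (Cξ := 8 * M₁) ⟨w₀, hw₀⟩)
  change IsMinNorm _ z v (fitDir (8 * M₁) v z) at hmin
  obtain ⟨-, hs, hl1, -⟩ := h.accurate
  have hnoise := h.noise
  set w := fitDir (8 * M₁) v z
  set b := betaHat n p k z
  set s := sigmaHat n p k z
  set r := 8 * M₁ * l2 v * √(Real.log p / n) with hr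
  have hlogn : 0 ≤ Real.log p / n := div_nonneg (Real.log_natCast_nonneg p) hn'.le
  have hr0 : 0 ≤ r := by
    have := l2_nonneg v
    positivity
  have e : debiasedCentre (8 * M₁) b v z - v ⬝ᵥ θ.beta =
      -(∑ j, ((n : ℝ)⁻¹ * ∑ i, (z i).2 j * w i - v j) * (b - θ.beta) j) +
        (n : ℝ)⁻¹ * (w ⬝ᵥ fun i => (z i).1 - (z i).2 ⬝ᵥ θ.beta) := by
    have e1 : (w ⬝ᵥ fun i => (z i).1 - (z i).2 ⬝ᵥ b) = (w ⬝ᵥ fun i => (z i).1 - (z i).2 ⬝ᵥ θ.beta) -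
        ∑ j, (∑ i, (z i).2 j * w i) * (b - θ.beta) j := by
      have e2 : ∑ j, (∑ i, (z i).2 j * w i) * (b - θ.beta) j =
          ∑ i, w i * ((z i).2 ⬝ᵥ (b - θ.beta)) := by
        simp only [Finset.sum_mul, dotProduct, Finset.mul_sum]
        rw [Finset.sum_comm]
        exact Finset.sum_congr rfl fun i _ => Finset.sum_congr rfl fun j _ => by ring
      rw [e2]
      unfold dotProduct
      rw [← Finset.sum_sub_distrib]
      refine Finset.sum_congr rfl fun i _ => ?_
      have := dotProduct_sub (z i).2 b θ.beta
      unfold dotProduct at this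
      rw [this]; ring
    unfold debiasedCentre
    change v ⬝ᵥ b + (n : ℝ)⁻¹ * (w ⬝ᵥ fun i => (z i).1 - (z i).2 ⬝ᵥ b) - _ = _
    rw [e1]
    simp only [sub_mul, Finset.sum_sub_distrib, mul_assoc, ← Finset.mul_sum]
    have e3 : ∑ j, v j * (b - θ.beta) j = v ⬝ᵥ b - v ⬝ᵥ θ.beta := by
      rw [← dotProduct_sub]; rfl
    rw [e3]; ring
  have hbias : |∑ j, ((n : ℝ)⁻¹ * ∑ i, (z i).2 j * w i - v j) * (b - θ.beta) j| ≤
      r * l1 (b - θ.beta) := by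
    unfold l1
    rw [Finset.mul_sum]
    refine (Finset.abs_sum_le_sum_abs _ _).trans (Finset.sum_le_sum fun j _ => ?_)
    rw [abs_mul]
    exact mul_le_mul_of_nonneg_right (hmin.1 j) (abs_nonneg _)
  have hσs : θ.sigma ≤ 2 * s := by linarith
  have hs0 : 0 ≤ s := Real.sqrt_nonneg _
  have h1 : r * l1 (b - θ.beta) ≤ s * (64000 * M₁ ^ 3 * l2 v * (k * Real.log p / n)) := by
    have hsq : √(Real.log p / n) * √(Real.log p / n) = Real.log p / n := Real.mul_self_sqrt hlogn
    have hl2 := l2_nonneg v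
    calc r * l1 (b - θ.beta) ≤ r * (4000 * M₁ ^ 2 * (2 * s) * k * √(Real.log p / n)) :=
          mul_le_mul_of_nonneg_left (hl1.trans (by gcongr)) hr0
      _ = s * (64000 * M₁ ^ 3 * l2 v * (k * (√(Real.log p / n) * √(Real.log p / n)))) := by rw [hr]; ring
      _ = _ := by rw [hsq]; ring
  have h2 : (n : ℝ)⁻¹ * (A * θ.sigma * √(w ⬝ᵥ w)) ≤
      s * (2 * A * √((n : ℝ)⁻¹ * (w ⬝ᵥ w)) / √n) := by
    have : √((n : ℝ)⁻¹ * (w ⬝ᵥ w)) / √n = (n : ℝ)⁻¹ * √(w ⬝ᵥ w) := by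
      rw [Real.sqrt_mul (by positivity), Real.sqrt_inv, inv_mul_eq_div, div_div,
        Real.mul_self_sqrt hn'.le, inv_mul_eq_div]
    rw [mul_div_assoc, this]
    calc _ ≤ (n : ℝ)⁻¹ * (A * (2 * s) * √(w ⬝ᵥ w)) := by gcongr
      _ = _ := by ring
  rw [e]
  refine (abs_add_le _ _).trans ?_
  rw [abs_neg, abs_mul, abs_of_pos (by positivity : 0 < (n : ℝ)⁻¹)]
  unfold debiasedRadius
  have h3 := mul_le_mul_of_nonneg_left hnoise (by positivity : 0 ≤ (n : ℝ)⁻¹)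
  rw [mul_add]
  linarith

theorem abs_plugIn_sub_le {M₁ A : ℝ} {k : ℕ} {θ : Param p} {u : Fin p → ℝ}
    {z : Data n p} (h : GoodInterval M₁ A k θ u z) (v : Fin p → ℝ) :
    |v ⬝ᵥ betaHat n p k z - v ⬝ᵥ θ.beta| ≤
      plugInRadius n (8000 * M₁ ^ 2) k (sigmaHat n p k z) v := by
  obtain ⟨-, hs, hl1, -⟩ := h.accurate
  have hs0 : 0 ≤ sigmaHat n p k z := Real.sqrt_nonneg _
  rw [← dotProduct_sub]
  refine (abs_dot_le_linf_mul_l1 _ _).trans ?_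
  have hσs : θ.sigma ≤ 2 * sigmaHat n p k z := by linarith
  calc _ ≤ linf v * (4000 * M₁ ^ 2 * (2 * sigmaHat n p k z) * k * √(Real.log p / n)) :=
        mul_le_mul_of_nonneg_left (hl1.trans (by gcongr)) (linf_nonneg v)
    _ = _ := by unfold plugInRadius; ring

theorem l2_head (ξ : Fin p → ℝ) (m : ℕ) : l2 (head ξ m) = topNorm m ξ := by
  unfold l2 topNorm head
  rw [Finset.sum_filter]
  simp only [Nat.ceil_natCast]
  congr 1
  refine Finset.sum_congr rfl fun j _ => ?_
  split_ifs <;> simp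

theorem nextAbs_nonneg (ξ : Fin p → ℝ) (m : ℕ) : 0 ≤ nextAbs ξ m := by
  unfold nextAbs
  split_ifs
  · exact abs_nonneg _
  · exact le_rfl

theorem linf_sub_head_le {ξ : Fin p → ℝ} (hξ : IsLoading ξ) (m : ℕ) :
    linf (ξ - head ξ m) ≤ nextAbs ξ m := by
  refine Real.iSup_le (fun j => ?_) (nextAbs_nonneg ξ m)
  simp only [Pi.sub_apply, head]
  split_ifs with h
  · simpa using nextAbs_nonneg ξ m
  · have hm : m < p := lt_of_le_of_lt (not_lt.1 h) j.2
    unfold nextAbs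
    rw [dif_pos hm, sub_zero]
    exact hξ.2 (show (⟨m, hm⟩ : Fin p) ≤ j from not_lt.1 h)

/-- By minimality Xû is no longer than the feasible witness, so n⁻¹‖Xû‖² ≤ 2M₁‖v‖² ≤ (2M₁‖v‖)². -/
theorem debiasedRadius_le (hn : 0 < n) {M₁ M₂ A : ℝ} (hM : 1 < M₁) (hA : 0 < A) {k : ℕ} {θ : Param p}
    (hσM : θ.sigma ≤ M₂) {v : Fin p → ℝ} {z : Data n p} (h : GoodInterval M₁ A k θ v z) :
    debiasedRadius (8 * M₁) (2 * A) (64000 * M₁ ^ 3) k (sigmaHat n p k z) v z ≤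
      2 * M₂ * (4 * A * M₁ + 64000 * M₁ ^ 3) * (l2 v * (1 / √n + k * Real.log p / n)) := by
  have hn' : (0 : ℝ) < n := by exact_mod_cast hn
  obtain ⟨w₀, hw₀, hw₀n⟩ := h.feasible
  have hmin := isMinNorm_of_isDirection hn (direction_spec (z := z) (Cξ := 8 * M₁) ⟨w₀, hw₀⟩)
  change IsMinNorm _ z v (fitDir (8 * M₁) v z) at hmin
  have hs := h.accurate.1
  have hw := (hmin.2 w₀ hw₀).trans hw₀n
  have hs0 : 0 ≤ sigmaHat n p k z := Real.sqrt_nonneg _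
  have hs2 : sigmaHat n p k z ≤ 2 * M₂ := by linarith
  have hl2 := l2_nonneg v
  have hlogn : 0 ≤ k * Real.log p / n := div_nonneg (mul_nonneg (by positivity) (Real.log_natCast_nonneg p)) hn'.le
  have h1 : √((n : ℝ)⁻¹ * (fitDir (8 * M₁) v z ⬝ᵥ fitDir (8 * M₁) v z)) ≤ 2 * M₁ * l2 v := by
    refine (Real.sqrt_le_left (by positivity)).2 ?_
    rw [inv_mul_le_iff₀ hn']
    refine hw.trans ?_
    have : 2 * M₁ ≤ (2 * M₁) ^ 2 := by nlinarith
    calc 2 * n * M₁ * l2 v ^ 2 = n * (2 * M₁ * l2 v ^ 2) := by ring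
      _ ≤ n * ((2 * M₁) ^ 2 * l2 v ^ 2) := by gcongr
      _ = _ := by ring
  unfold debiasedRadius
  calc _ ≤ 2 * M₂ * (2 * A * (2 * M₁ * l2 v) / √n + 64000 * M₁ ^ 3 * l2 v * (k * Real.log p / n)) := by
        gcongr
        exact hs0.trans hs2
    _ = 2 * M₂ * (4 * A * M₁ * (l2 v * (1 / √n)) + 64000 * M₁ ^ 3 * (l2 v * (k * Real.log p / n))) := by
        ring
    _ ≤ 2 * M₂ * ((4 * A * M₁ + 64000 * M₁ ^ 3) * (l2 v * (1 / √n)) +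
        (4 * A * M₁ + 64000 * M₁ ^ 3) * (l2 v * (k * Real.log p / n))) := by
        have hM0 : 0 < M₁ := by linarith
        have : 0 ≤ 4 * A * M₁ := by positivity
        have : 0 ≤ 64000 * M₁ ^ 3 := by positivity
        have : 0 ≤ 2 * M₂ := hs0.trans hs2
        gcongr
        · linarith
        · linarith
    _ = _ := by ring

theorem plugInRadius_le {M₁ M₂ A : ℝ} (hM : 1 < M₁) {k : ℕ} {θ : Param p}
    (hσM : θ.sigma ≤ M₂) {u : Fin p → ℝ} {z : Data n p} (h : GoodInterval M₁ A k θ u z)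
    {ξ : Fin p → ℝ} (hξ : IsLoading ξ) (m : ℕ) :
    plugInRadius n (8000 * M₁ ^ 2) k (sigmaHat n p k z) (ξ - head ξ m) ≤
      2 * M₂ * (8000 * M₁ ^ 2) * (nextAbs ξ m * k * √(Real.log p / n)) := by
  have hs := h.accurate.1
  have hs0 : 0 ≤ sigmaHat n p k z := Real.sqrt_nonneg _
  have hs2 : sigmaHat n p k z ≤ 2 * M₂ := by linarith
  unfold plugInRadius
  calc _ ≤ 8000 * M₁ ^ 2 * (2 * M₂) * nextAbs ξ m * k * √(Real.log p / n) := by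
        have := linf_nonneg (ξ - head ξ m)
        have := linf_sub_head_le hξ m
        have : 0 ≤ 2 * M₂ := hs0.trans hs2
        gcongr
    _ = _ := by ring

end AdaptiveSep

namespace AdaptiveSep
variable {n p : ℕ}

/-! ### Attainment and the upper bound -/

/-- Only subadditivity of the outer measure is used, so the good event need not be measurable. -/
theorem ofReal_one_sub_le {Ω : Type*} [MeasurableSpace Ω] {μ : Measure Ω} [IsProbabilityMeasure μ]
    {G : Ω → Prop} {δ : ℝ} (hδ : 0 ≤ δ) (h : μ {z | ¬ G z} ≤ ENNReal.ofReal δ) :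
    ENNReal.ofReal (1 - δ) ≤ μ {z | G z} := by
  rw [ENNReal.ofReal_sub _ hδ, ENNReal.ofReal_one, tsub_le_iff_right]
  have h1 : (1 : ℝ≥0∞) ≤ μ {z | G z} + μ {z | ¬ G z} := by
    rw [← measure_univ (μ := μ)]
    refine (measure_mono fun z _ => ?_).trans (measure_union_le _ _)
    exact em (G z)
  exact h1.trans (add_le_add le_rfl h)

/-- The minimization problem involves the data only through Σ̂, so equal designs give the same
predicate and hence the same chosen minimizer. -/
theorem direction_congr (Cξ : ℝ) {z z' : Data n p} (h : design z = design z') (v : Fin p → ℝ) :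
    direction Cξ z v = direction Cξ z' v := by
  classical
  have hS : sampleCov z = sampleCov z' := by unfold sampleCov; rw [h]
  have hI : IsDirection Cξ z v = IsDirection Cξ z' v := by
    unfold IsDirection Feasible
    rw [hS]
  have key : ∀ P Q : (Fin p → ℝ) → Prop, P = Q →
      (if h : ∃ u, P u then h.choose else 0) = if h : ∃ u, Q u then h.choose else 0 := by
    rintro P _ rfl; rfl
  unfold direction
  convert key _ _ hI

theorem badProb_nonneg (n p : ℕ) : 0 ≤ badProb n p := by unfold badProb; positivity

theorem measure_not_goodInterval {M₁ M₂ A : ℝ} {k : ℕ} (hM : 1 < M₁) {θ : Param p}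
    (hθ : θ ∈ paramSpace p M₁ M₂ k) (hk : 0 < k) (hn : 0 < n) (hp : 8 * M₁ ≤ p)
    (hL : 10 ^ 6 * M₁ ^ 3 * (k * Real.log p) ≤ n) (hA : 0 < A) (v : Fin p → ℝ) :
    dataLaw n θ {z | ¬ GoodInterval M₁ A k θ v z} ≤
      ENNReal.ofReal (2 * Real.exp (-(A ^ 2 / 2)) + (badProb n p + (4 / p + Real.exp (-(n / 8))))) := by
  have hp8 : (8 : ℝ) < p := by linarith
  have hp1 : 1 < p := by
    have : 8 < p := by exact_mod_cast hp8
    omega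
  have hlog : 0 < Real.log p := Real.log_pos (by linarith)
  have hk' : (1 : ℝ) ≤ k := by exact_mod_cast hk
  have hkl : Real.log p ≤ k * Real.log p := le_mul_of_one_le_left hlog.le hk'
  have hM3 : 1 * (k * Real.log p) ≤ M₁ ^ 3 * (k * Real.log p) :=
    mul_le_mul_of_nonneg_right (one_le_pow₀ hM.le) (by positivity)
  have hσ := hθ.2.2.1
  have h1 := measure_not_goodDesign hM hθ hk hn hp (by linarith)
  have h2 := measure_not_feasible hM hθ hn hp1 (by linarith) v
  have h3 := measure_noise_gt hσ (measurable_fitDir hn (8 * M₁) v) (fun z z' hz => by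
    unfold fitDir
    rw [direction_congr _ hz, hz]) hA
  have hb0 := badProb_nonneg n p
  refine (measure_mono (t := {z | A * θ.sigma * √(fitDir (8 * M₁) v z ⬝ᵥ fitDir (8 * M₁) v z) <
      |fitDir (8 * M₁) v z ⬝ᵥ fun i => (z i).1 - (z i).2 ⬝ᵥ θ.beta|} ∪
      ({z | ¬ GoodDesign M₁ k θ z} ∪ {z | ¬ ∃ w ∈ dualSet (8 * M₁ * l2 v * √(Real.log p / n)) z v,
      w ⬝ᵥ w ≤ 2 * n * M₁ * l2 v ^ 2})) fun z hz => ?_).trans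
    ((measure_union_le _ _).trans ?_)
  · by_contra hcon
    simp only [Set.mem_union, Set.mem_ofPred_eq, not_or, not_not, not_lt] at hcon hz
    exact hz ⟨accurate_of_goodDesign hM hσ hθ.1 hk hp1 hL hcon.2.1, hcon.2.2, hcon.1⟩
  · rw [ENNReal.ofReal_add (by positivity) (by positivity), ENNReal.ofReal_add hb0 (by positivity)]
    refine add_le_add (h3.trans (le_of_eq ?_)) ((measure_union_le _ _).trans (add_le_add h1 h2))
    rw [ENNReal.ofReal_mul (by norm_num), ENNReal.ofReal_ofNat]

/-- The constant in the radius bound of the mixed test. -/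
noncomputable def radiusConst (M₁ M₂ A : ℝ) : ℝ :=
  2 * M₂ * (4 * A * M₁ + 64000 * M₁ ^ 3) + 2 * M₂ * (8000 * M₁ ^ 2)

/-- Positivity supplies the τ > 0 required in `tauAdap`, and turns separation by 3 times the radius
bound into the strict inequality with factor 2 needed for rejection. For m = 0 the plug-in term is
positive, for m ≥ 1 the debiased one. -/
theorem mixedRate_pos (hn : 0 < n) (hp : 1 < p) {ku : ℕ} (hku : 0 < ku) {ξ : Fin p → ℝ}
    (hξ : IsLoading ξ) (m : ℕ) : 0 < mixedRate n ku ξ m := by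
  have hlog : 0 < Real.log p := Real.log_pos (by exact_mod_cast hp)
  have h0 : ξ ⟨0, by omega⟩ ≠ 0 := fun h => hξ.1 <| by
    ext j
    have h1 : |ξ j| ≤ |ξ ⟨0, by omega⟩| := hξ.2 (Fin.mk_le_of_le_val (Nat.zero_le _))
    rw [h, abs_zero] at h1
    exact abs_nonpos_iff.1 h1
  have hnn := nextAbs_nonneg ξ m
  have htt : 0 ≤ topNorm (m : ℝ) ξ := Real.sqrt_nonneg _
  unfold mixedRate
  rcases Nat.eq_zero_or_pos m with hm | hm
  · subst hm
    have : 0 < nextAbs ξ 0 := by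
      unfold nextAbs
      rw [dif_pos (by omega)]
      exact abs_pos.2 h0
    have : 0 < nextAbs ξ 0 * ku * √(Real.log p / n) := by positivity
    have : 0 ≤ topNorm ((0 : ℕ) : ℝ) ξ * (1 / √n + ku * Real.log p / n) := by positivity
    linarith
  · have : 0 < topNorm (m : ℝ) ξ := by
      unfold topNorm
      refine Real.sqrt_pos.2 (lt_of_lt_of_le (pow_pos (abs_pos.2 h0) 2) ?_)
      rw [sq_abs]
      refine Finset.single_le_sum (f := fun j => ξ j ^ 2) (fun j _ => sq_nonneg _)
        (Finset.mem_filter.2 ⟨Finset.mem_univ _, ?_⟩)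
      simpa using hm
    have : 0 < topNorm (m : ℝ) ξ * (1 / √n + ku * Real.log p / n) := by positivity
    have : 0 ≤ nextAbs ξ m * ku * √(Real.log p / n) := by positivity
    linarith

/-- On the good event ξ·β lies in the Minkowski sum, so a true null is accepted; and an accepted t₀
is within twice the total radius of ξ·β. -/
theorem mixedTest_analysis (hn : 0 < n) {M₁ M₂ A : ℝ} (hM : 1 < M₁) (hM₂ : 0 < M₂) (hA : 0 < A) {k : ℕ}
    {θ : Param p} (hσ : 0 < θ.sigma) (hσM : θ.sigma ≤ M₂) {ξ : Fin p → ℝ} (hξ : IsLoading ξ) {t₀ : ℝ}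
    {m : ℕ} {z : Data n p} (h : GoodInterval M₁ A k θ (head ξ m) z) :
    (ξ ⬝ᵥ θ.beta = t₀ → mixedTest (8 * M₁) (2 * A) (64000 * M₁ ^ 3) (8000 * M₁ ^ 2) k
      (betaHat n p k) (sigmaHat n p k) ξ t₀ m z = 0) ∧
    (2 * radiusConst M₁ M₂ A * mixedRate n k ξ m < |ξ ⬝ᵥ θ.beta - t₀| →
      mixedTest (8 * M₁) (2 * A) (64000 * M₁ ^ 3) (8000 * M₁ ^ 2) k
      (betaHat n p k) (sigmaHat n p k) ξ t₀ m z = 1) := by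
  have hd := abs_le.1 (abs_debiasedCentre_sub_le hn hM hA hσ h)
  have hp := abs_le.1 (abs_plugIn_sub_le h (ξ - head ξ m))
  have hr1 := debiasedRadius_le hn hM hA hσM h
  have hr2 := plugInRadius_le hM hσM h hξ m
  have hsplit : ξ ⬝ᵥ θ.beta = head ξ m ⬝ᵥ θ.beta + (ξ - head ξ m) ⬝ᵥ θ.beta := by
    rw [sub_dotProduct]; ring
  unfold mixedTest
  simp only [debiasedCI_eq, plugInCI_eq, mem_Icc_add_Icc]
  set c := debiasedCentre (8 * M₁) (betaHat n p k z) (head ξ m) z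
  set r := debiasedRadius (8 * M₁) (2 * A) (64000 * M₁ ^ 3) k (sigmaHat n p k z) (head ξ m) z
  set c' := (ξ - head ξ m) ⬝ᵥ betaHat n p k z
  set r' := plugInRadius n (8000 * M₁ ^ 2) k (sigmaHat n p k z) (ξ - head ξ m)
  constructor
  · intro ht
    rw [if_pos]
    refine ⟨by linarith, by linarith, by linarith, by linarith⟩
  · intro ht
    rw [if_neg]
    rintro ⟨-, -, h3, h4⟩
    have hle : |ξ ⬝ᵥ θ.beta - t₀| ≤ 2 * (r + r') := abs_le.2 ⟨by linarith, by linarith⟩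
    have hsum : r + r' ≤ radiusConst M₁ M₂ A * mixedRate n k ξ m := by
      rw [l2_head] at hr1
      have hn' : (0 : ℝ) < n := by exact_mod_cast hn
      have hlogn : 0 ≤ k * Real.log p / n :=
        div_nonneg (mul_nonneg (by positivity) (Real.log_natCast_nonneg p)) hn'.le
      have h5 : 0 ≤ topNorm (m : ℝ) ξ * (1 / √n + k * Real.log p / n) :=
        mul_nonneg (Real.sqrt_nonneg _) (by positivity)
      have h6 : 0 ≤ nextAbs ξ m * k * √(Real.log p / n) := by
        have := nextAbs_nonneg ξ m
        positivity
      have hM0 : 0 < M₁ := by linarith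
      have h7 : 0 ≤ 2 * M₂ * (4 * A * M₁ + 64000 * M₁ ^ 3) := by positivity
      have h8 : 0 ≤ 2 * M₂ * (8000 * M₁ ^ 2) := by positivity
      unfold radiusConst mixedRate
      have := mul_nonneg h7 h6
      have := mul_nonneg h8 h5
      linarith
    linarith

theorem mixedTest_zero_or_one (Cξ A₁ A₂ A₃ : ℝ) (ku : ℕ) (bhat : Data n p → Fin p → ℝ)
    (shat : Data n p → ℝ) (ξ : Fin p → ℝ) (t₀ : ℝ) (m : ℕ) (z : Data n p) :
    mixedTest Cξ A₁ A₂ A₃ ku bhat shat ξ t₀ m z = 0 ∨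
      mixedTest Cξ A₁ A₂ A₃ ku bhat shat ξ t₀ m z = 1 := by
  unfold mixedTest
  split_ifs
  · exact Or.inl rfl
  · exact Or.inr rfl

/-- Size and power of the mixed test. -/
theorem mixedTest_size_power {M₁ M₂ A δ α η : ℝ} {k : ℕ} (hM : 1 < M₁) (hM₂ : 0 < M₂)
    (hk : 0 < k) (hn : 0 < n) (hp : 8 * M₁ ≤ p)
    (hL : 10 ^ 6 * M₁ ^ 3 * (k * Real.log p) ≤ n) (hA : 0 < A)
    (hδ : 2 * Real.exp (-(A ^ 2 / 2)) + (badProb n p + (4 / p + Real.exp (-(n / 8)))) ≤ δ)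
    (hα : δ ≤ α) (hη : δ ≤ η) {ξ : Fin p → ℝ} (hξ : IsLoading ξ) (t₀ : ℝ) (m : ℕ) :
    mixedTest (8 * M₁) (2 * A) (64000 * M₁ ^ 3) (8000 * M₁ ^ 2) k
      (betaHat n p k) (sigmaHat n p k) ξ t₀ m ∈ tests n α (nullSpace M₁ M₂ k ξ t₀) ∧
    ∀ k' ≤ k, ∀ θ ∈ altSpace M₁ M₂ k' ξ t₀ (3 * radiusConst M₁ M₂ A * mixedRate n k ξ m),
      ENNReal.ofReal (1 - η) ≤ power (mixedTest (8 * M₁) (2 * A) (64000 * M₁ ^ 3) (8000 * M₁ ^ 2) k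
      (betaHat n p k) (sigmaHat n p k) ξ t₀ m) θ := by
  set ψ := mixedTest (8 * M₁) (2 * A) (64000 * M₁ ^ 3) (8000 * M₁ ^ 2) k
      (betaHat n p k) (sigmaHat n p k) ξ t₀ m with hψ
  have hψm : Measurable ψ := measurable_mixedTest hn _ _ _ _ k (measurable_betaHat n p k)
    (measurable_sigmaHat n p k) ξ t₀ m
  have hψ01 : ∀ z, ψ z = 0 ∨ ψ z = 1 := mixedTest_zero_or_one _ _ _ _ k _ _ ξ t₀ m
  have hbad : ∀ θ ∈ paramSpace p M₁ M₂ k,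
      dataLaw n θ {z | ¬ GoodInterval M₁ A k θ (head ξ m) z} ≤ ENNReal.ofReal δ := fun θ hθ =>
    (measure_not_goodInterval hM hθ hk hn hp hL hA _).trans (ENNReal.ofReal_le_ofReal hδ)
  have hδ0 : 0 ≤ δ := le_trans (by have := badProb_nonneg n p; positivity) hδ
  refine ⟨⟨hψm, fun z => ?_, iSup₂_le fun θ hθ => ?_⟩, fun k' hk' θ hθ => ?_⟩
  · rcases hψ01 z with h | h <;> rw [h]
    exact zero_le
  · have hset : MeasurableSet {z | ψ z = 1} := hψm (measurableSet_singleton 1)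
    calc power ψ θ ≤ ∫⁻ z, {z | ψ z = 1}.indicator 1 z ∂(dataLaw n θ) := by
          refine lintegral_mono fun z => ?_
          rcases hψ01 z with h | h
          · rw [h]; exact zero_le
          · rw [Set.indicator_of_mem (show z ∈ {z | ψ z = 1} from h), h]; rfl
      _ = dataLaw n θ {z | ψ z = 1} := lintegral_indicator_one hset
      _ ≤ dataLaw n θ {z | ¬ GoodInterval M₁ A k θ (head ξ m) z} := by
          refine measure_mono fun z hz hG => ?_
          have h0 := (mixedTest_analysis hn hM hM₂ hA hθ.1.2.2.1 hθ.1.2.2.2 hξ (t₀ := t₀) hG).1 hθ.2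
          exact zero_ne_one (h0.symm.trans hz)
      _ ≤ ENNReal.ofReal δ := hbad θ hθ.1
      _ ≤ _ := ENNReal.ofReal_le_ofReal hα
  · have hθ' : θ ∈ paramSpace p M₁ M₂ k := ⟨hθ.1.1.trans hk', hθ.1.2⟩
    have hp1 : 1 < p := by
      have : (1 : ℝ) < p := by linarith
      exact_mod_cast this
    have hR := mixedRate_pos hn hp1 hk hξ m
    have hC : 0 < radiusConst M₁ M₂ A := by
      have : 0 < M₁ := by linarith
      unfold radiusConst; positivity
    have hlt : 2 * radiusConst M₁ M₂ A * mixedRate n k ξ m < |ξ ⬝ᵥ θ.beta - t₀| := by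
      have := hθ.2
      have := mul_pos hC hR
      linarith
    calc ENNReal.ofReal (1 - η) ≤ ENNReal.ofReal (1 - δ) := ENNReal.ofReal_le_ofReal (by linarith)
      _ ≤ dataLaw n θ {z | GoodInterval M₁ A k θ (head ξ m) z} := ofReal_one_sub_le hδ0 (hbad θ hθ')
      _ ≤ dataLaw n θ {z | 1 ≤ ψ z} := measure_mono fun z hG =>
          ((mixedTest_analysis hn hM hM₂ hA hθ.1.2.2.1 hθ.1.2.2.2 hξ (t₀ := t₀) hG).2 hlt).symm.le
      _ ≤ power ψ θ := by
          have := mul_meas_ge_le_lintegral (μ := dataLaw n θ) hψm 1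
          rwa [one_mul] at this

theorem tauAdap_le_of_test {M₁ M₂ α η τ : ℝ} {ku k : ℕ} {ξ : Fin p → ℝ} {t₀ : ℝ} (hτ : 0 < τ)
    {ψ : Data n p → ℝ≥0∞} (hψ : ψ ∈ tests n α (nullSpace M₁ M₂ ku ξ t₀))
    (hpow : ∀ θ ∈ altSpace M₁ M₂ k ξ t₀ τ, ENNReal.ofReal (1 - η) ≤ power ψ θ) :
    tauAdap n M₁ M₂ α η ku k ξ t₀ ≤ ENNReal.ofReal τ :=
  iInf₂_le_of_le τ hτ (iInf_le_of_le (le_trans (le_iInf₂ hpow) (le_iSup₂_of_le ψ hψ le_rfl)) le_rfl)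

theorem exists_mixedRate_eq_upperRate (ku : ℕ) (ξ : Fin p → ℝ) :
    ∃ m ≤ p, mixedRate n ku ξ m = upperRate n ku ξ := by
  obtain ⟨m, hm⟩ := exists_eq_ciInf_of_finite (f := fun m : Fin (p + 1) => mixedRate n ku ξ m)
  exact ⟨m, by omega, hm⟩

theorem exists_error_le {δ : ℝ} (hδ : 0 < δ) : ∃ A : ℝ, 0 < A ∧ ∃ N : ℕ, ∀ n p : ℕ, N ≤ n → N ≤ p →
    2 * Real.exp (-(A ^ 2 / 2)) + (badProb n p + (4 / p + Real.exp (-(n / 8)))) ≤ δ := by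
  have h0 : Filter.Tendsto (fun A : ℝ => Real.exp (-(A ^ 2 / 2))) Filter.atTop (nhds 0) :=
    Real.tendsto_exp_neg_atTop_nhds_zero.comp
      ((Filter.tendsto_pow_atTop two_ne_zero).atTop_div_const (by norm_num))
  -- A is fixed by the Gaussian tail before n and p are taken large, since it enters the constant A₁
  -- of the test.
  obtain ⟨A, hA, hA'⟩ := ((h0.eventually_le_const (show 0 < δ / 8 by linarith)).and
    (Filter.eventually_gt_atTop 0)).exists
  have h1 : Filter.Tendsto (fun n : ℕ => Real.exp (-((n : ℝ) / 8))) Filter.atTop (nhds 0) :=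
    Real.tendsto_exp_neg_atTop_nhds_zero.comp
      (tendsto_natCast_atTop_atTop.atTop_div_const (by norm_num))
  have h3 : Filter.Tendsto (fun p : ℕ => (4 : ℝ) / p) Filter.atTop (nhds 0) :=
    tendsto_const_div_atTop_nhds_zero_nat 4
  obtain ⟨N₁, hN₁⟩ := Filter.eventually_atTop.1 (h1.eventually_le_const (show 0 < δ / 8 by linarith))
  obtain ⟨N₂, hN₂⟩ := Filter.eventually_atTop.1 (h3.eventually_le_const (show 0 < δ / 8 by linarith))
  obtain ⟨N₃, hN₃⟩ := exists_badProb_le (show 0 < δ / 8 by linarith)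
  refine ⟨A, hA', max N₁ (max N₂ N₃), fun n p hn hp => ?_⟩
  have a := hN₁ n ((le_max_left _ _).trans hn)
  have b := hN₂ p (((le_max_left _ _).trans (le_max_right _ _)).trans hp)
  have c := hN₃ n p (((le_max_right _ _).trans (le_max_right _ _)).trans hn)
    (((le_max_right _ _).trans (le_max_right _ _)).trans hp)
  linarith

end AdaptiveSep

namespace AdaptiveSep

/-! ### Gaussian shears -/

theorem pi_withDensity {ι : Type*} [Fintype ι] {E : ι → Type*} [∀ i, MeasurableSpace (E i)]
    (μ : ∀ i, Measure (E i)) [∀ i, SigmaFinite (μ i)] {f : ∀ i, E i → ℝ}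
    (hf0 : ∀ i x, 0 ≤ f i x) (hi : ∀ i, Integrable (f i) (μ i)) :
    Measure.pi (fun i => (μ i).withDensity fun x => ENNReal.ofReal (f i x)) =
      (Measure.pi μ).withDensity fun x => ENNReal.ofReal (∏ i, f i (x i)) := by
  have : ∀ i, IsFiniteMeasure ((μ i).withDensity fun x => ENNReal.ofReal (f i x)) := fun i =>
    isFiniteMeasure_withDensity_ofReal (hi i).2
  refine Measure.pi_eq fun s hs => ?_
  have key : ∀ x : ∀ i, E i, (Set.univ.pi s).indicator (fun x => ENNReal.ofReal (∏ i, f i (x i))) x =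
      ENNReal.ofReal (∏ i, (s i).indicator (f i) (x i)) := fun x => by
    by_cases hx : x ∈ Set.univ.pi s
    · rw [Set.indicator_of_mem hx]
      congr 1
      exact Finset.prod_congr rfl fun i _ => (Set.indicator_of_mem (hx i (Set.mem_univ i)) _).symm
    · rw [Set.indicator_of_notMem hx]
      obtain ⟨i, hi⟩ : ∃ i, x i ∉ s i := by simpa [Set.mem_pi] using hx
      rw [Finset.prod_eq_zero (Finset.mem_univ i) (Set.indicator_of_notMem hi _)]
      simp
  have hi' : ∀ i, Integrable ((s i).indicator (f i)) (μ i) := fun i => (hi i).indicator (hs i)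
  have h0 : ∀ i x, 0 ≤ (s i).indicator (f i) x := fun i x => Set.indicator_nonneg (fun x _ => hf0 i x) x
  rw [withDensity_apply _ (MeasurableSet.univ_pi hs), ← lintegral_indicator (MeasurableSet.univ_pi hs)]
  simp only [key]
  rw [← ofReal_integral_eq_lintegral_ofReal (Integrable.fintype_prod_dep hi')
    (Filter.Eventually.of_forall fun x => Finset.prod_nonneg fun i _ => h0 i _),
    integral_fintype_prod_eq_prod, ENNReal.ofReal_prod_of_nonneg fun i _ => integral_nonneg (h0 i)]
  refine Finset.prod_congr rfl fun i _ => ?_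
  rw [ofReal_integral_eq_lintegral_ofReal (hi' i) (Filter.Eventually.of_forall (h0 i)),
    withDensity_apply _ (hs i), ← lintegral_indicator (hs i)]
  refine lintegral_congr fun x => ?_
  by_cases hx : x ∈ s i <;> simp [hx]

variable {ι : Type*} [Fintype ι]

/-- The standard Gaussian measure on `ι → ℝ`. -/
noncomputable def stdPi (ι : Type*) [Fintype ι] : Measure (ι → ℝ) := Measure.pi fun _ => gaussianReal 0 1

instance : IsProbabilityMeasure (stdPi ι) := by unfold stdPi; infer_instance

theorem stdPi_eq_withDensity : stdPi ι = (volume : Measure (ι → ℝ)).withDensity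
    fun x => ENNReal.ofReal ((√(2 * Real.pi))⁻¹ ^ Fintype.card ι * Real.exp (-(x ⬝ᵥ x) / 2)) := by
  have h := pi_withDensity (fun _ : ι => (volume : Measure ℝ)) (f := fun _ => gaussianPDFReal 0 1)
    (fun _ => gaussianPDFReal_nonneg 0 1)
    (fun _ => integrable_gaussianPDFReal 0 1)
  have h2 : ∀ x : ι → ℝ, ∏ i, gaussianPDFReal 0 1 (x i) =
      (√(2 * Real.pi))⁻¹ ^ Fintype.card ι * Real.exp (-(x ⬝ᵥ x) / 2) := fun x => by
    simp only [gaussianPDFReal, NNReal.coe_one, mul_one, sub_zero]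
    rw [Finset.prod_mul_distrib, Finset.prod_const, Finset.card_univ, ← Real.exp_sum]
    congr 2
    rw [← Finset.sum_div, Finset.sum_neg_distrib]
    simp only [dotProduct, sq]
  simp only [h2] at h
  unfold stdPi
  rw [gaussianReal_of_var_ne_zero 0 one_ne_zero]
  exact h

/-- The likelihood ratio of the sheared standard Gaussian measure. -/
noncomputable def shearLR (g d x : ι → ℝ) : ℝ :=
  Real.exp ((g ⬝ᵥ x) * (d ⬝ᵥ x) - (g ⬝ᵥ x) ^ 2 * (d ⬝ᵥ d) / 2)

/-- The shear `x ↦ x + (g · x) d`. -/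
def shear (g d x : ι → ℝ) : ι → ℝ := x + (g ⬝ᵥ x) • d

theorem continuous_shear (g d : ι → ℝ) : Continuous (shear g d) := by
  unfold shear dotProduct; fun_prop

theorem continuous_shearLR (g d : ι → ℝ) : Continuous (shearLR g d) := by
  unfold shearLR dotProduct; fun_prop

theorem dot_shear {g d : ι → ℝ} (v x : ι → ℝ) : v ⬝ᵥ shear g d x = v ⬝ᵥ x + (g ⬝ᵥ x) * (v ⬝ᵥ d) := by
  simp [shear, dotProduct_add]

/-- The shear is a transvection, of determinant 1 + g·d = 1. -/
theorem measurePreserving_shear {g d : ι → ℝ} (h : g ⬝ᵥ d = 0) :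
    MeasurePreserving (shear g d) (volume : Measure (ι → ℝ)) volume := by
  classical
  let f : Module.Dual ℝ (ι → ℝ) := dotProductBilin ℝ ℝ g
  have hf : (shear g d) = LinearMap.transvection f d := by
    ext x; simp [shear, LinearMap.transvection.apply, f]
  have hdet : LinearMap.det (LinearMap.transvection f d) = 1 := by
    rw [LinearMap.transvection.det]; simp [f, h]
  refine ⟨(continuous_shear g d).measurable, ?_⟩
  rw [hf, Real.map_linearMap_volume_pi_eq_smul_volume_pi (by rw [hdet]; exact one_ne_zero), hdet]
  simp

/-- There is no Jacobian, and g·x is invariant under the shear, so the likelihood ratio is the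
quotient of the standard densities at x - (g·x)d and at x. -/
theorem map_shear {g d : ι → ℝ} (h : g ⬝ᵥ d = 0) :
    (stdPi ι).map (shear g d) = (stdPi ι).withDensity fun x => ENNReal.ofReal (shearLR g d x) := by
  have hm := (continuous_shear g d).measurable
  have hc : Measurable fun x : ι → ℝ => x ⬝ᵥ x := by
    refine Continuous.measurable ?_
    unfold dotProduct; fun_prop
  have hL := (continuous_shearLR g d).measurable
  refine Measure.ext_of_lintegral _ fun F hF => ?_
  rw [lintegral_map hF hm, lintegral_withDensity_eq_lintegral_mul _ (by fun_prop) hF,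
    stdPi_eq_withDensity, lintegral_withDensity_eq_lintegral_mul _ (g := fun x => F (shear g d x)) (by fun_prop) (hF.comp hm),
    lintegral_withDensity_eq_lintegral_mul _ (by fun_prop) (by fun_prop)]
  symm
  rw [← (measurePreserving_shear h).lintegral_comp (by fun_prop)]
  refine lintegral_congr fun x => ?_
  simp only [Pi.mul_apply]
  rw [← mul_assoc, ← ENNReal.ofReal_mul (by positivity), mul_assoc (_ ^ _)]
  congr 3
  rw [shearLR, ← Real.exp_add]
  congr 1
  have e2 : shear g d x ⬝ᵥ shear g d x = x ⬝ᵥ x + 2 * ((g ⬝ᵥ x) * (d ⬝ᵥ x)) + (g ⬝ᵥ x) ^ 2 * (d ⬝ᵥ d) := by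
    rw [dot_shear, dotProduct_comm _ x, dot_shear, dotProduct_comm (shear g d x) d, dot_shear, dotProduct_comm x d]
    ring
  rw [e2]
  simp only [dot_shear, h, mul_zero, add_zero]
  ring

theorem lintegral_shear {g d : ι → ℝ} (h : g ⬝ᵥ d = 0) {F : (ι → ℝ) → ℝ≥0∞} (hF : Measurable F) :
    ∫⁻ x, F (shear g d x) ∂stdPi ι = ∫⁻ x, ENNReal.ofReal (shearLR g d x) * F x ∂stdPi ι := by
  have hL := (continuous_shearLR g d).measurable
  rw [← lintegral_map hF (continuous_shear g d).measurable, map_shear h,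
    lintegral_withDensity_eq_lintegral_mul _ (by fun_prop) hF]
  rfl

theorem map_dot_stdPi (g : ι → ℝ) : (stdPi ι).map (fun x => g ⬝ᵥ x) = gaussianReal 0 (g ⬝ᵥ g).toNNReal := by
  have hm : Measurable fun x : ι → ℝ => g ⬝ᵥ x := by
    refine Continuous.measurable ?_
    unfold dotProduct; fun_prop
  have : IsProbabilityMeasure ((stdPi ι).map fun x => g ⬝ᵥ x) :=
    Measure.isProbabilityMeasure_map hm.aemeasurable
  refine Measure.ext_of_charFun ?_
  ext t
  rw [charFun_apply_real, integral_map hm.aemeasurable (by fun_prop), charFun_gaussianReal, stdPi]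
  have h : ∀ x : ι → ℝ, Complex.exp (t * ((g ⬝ᵥ x : ℝ) : ℂ) * Complex.I) =
      ∏ i, Complex.exp (((t * g i : ℝ) : ℂ) * (x i : ℂ) * Complex.I) := fun x => by
    rw [← Complex.exp_sum]
    congr 1
    simp only [dotProduct]
    push_cast
    rw [Finset.mul_sum, Finset.sum_mul]
    exact Finset.sum_congr rfl fun i _ => by ring
  simp only [h]
  rw [integral_fintype_prod_eq_prod (𝕜 := ℂ)
    (f := fun i (y : ℝ) => Complex.exp (((t * g i : ℝ) : ℂ) * (y : ℂ) * Complex.I))]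
  simp only [← charFun_apply_real, charFun_gaussianReal]
  rw [← Complex.exp_sum, Real.coe_toNNReal _ (dot_self_nonneg g)]
  congr 1
  simp only [dotProduct]
  push_cast
  simp only [mul_zero, zero_mul, zero_sub]
  rw [Finset.sum_mul, Finset.sum_div, ← Finset.sum_neg_distrib]
  exact Finset.sum_congr rfl fun i _ => by simp; ring

/-- Absorb each likelihood ratio into a change of variables. The first leaves the second ratio times
exp((d·d')(g·x)²), the second leaves this factor alone because both shears fix g·x. What remains is
the Laplace transform of a squared standard Gaussian. -/
theorem lintegral_shearLR_mul {g d d' : ι → ℝ} (hg : g ⬝ᵥ g = 1) (h : g ⬝ᵥ d = 0) (h' : g ⬝ᵥ d' = 0)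
    (h0 : 0 ≤ d ⬝ᵥ d') (h1 : d ⬝ᵥ d' ≤ 1 / 4) :
    ∫⁻ x, ENNReal.ofReal (shearLR g d x) * ENNReal.ofReal (shearLR g d' x) ∂stdPi ι ≤
      ENNReal.ofReal (Real.exp (2 * (d ⬝ᵥ d'))) := by
  have hL := (continuous_shearLR g d').measurable
  have hgm : Measurable fun x : ι → ℝ => g ⬝ᵥ x := by
    refine Continuous.measurable ?_
    unfold dotProduct; fun_prop
  rw [← lintegral_shear h (by fun_prop)]
  have e : ∀ x, ENNReal.ofReal (shearLR g d' (shear g d x)) = ENNReal.ofReal (shearLR g d' x) *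
      ENNReal.ofReal (Real.exp ((d ⬝ᵥ d') * (g ⬝ᵥ shear g d' x) ^ 2)) := fun x => by
    rw [shearLR, shearLR, ← ENNReal.ofReal_mul (Real.exp_pos _).le, ← Real.exp_add]
    simp only [dot_shear, h, h', mul_zero, add_zero, dotProduct_comm d' d]
    congr 2; ring
  have e' : ∀ x, g ⬝ᵥ shear g d' x = g ⬝ᵥ x := fun x => by rw [dot_shear, h']; simp
  simp only [e, e']
  rw [← lintegral_shear h' (F := fun x => ENNReal.ofReal (Real.exp ((d ⬝ᵥ d') * (g ⬝ᵥ x) ^ 2))) (by fun_prop)]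
  simp only [e']
  have hlaw := map_dot_stdPi g
  rw [hg] at hlaw
  have := lintegral_exp_sq_le hgm one_pos hlaw (l := d ⬝ᵥ d') (by linarith) h1
  simp only [div_one] at this
  refine this.trans (ENNReal.ofReal_le_ofReal (Real.exp_le_exp.2 (by nlinarith)))

end AdaptiveSep

namespace AdaptiveSep

/-! ### The chi-square method -/

/-- With B the mixture likelihood ratio, φ(1 - B) ≤ |1 - B| ≤ t/2 + (1 - B)²/(2t). Since ∫B = 1 and
∫B² ≤ 1 + t², the right side integrates to at most t. -/
theorem lintegral_le_of_chiSq {Ω J : Type*} [MeasurableSpace Ω] [Fintype J] {P : Measure Ω}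
    [IsProbabilityMeasure P] {φ : Ω → ℝ≥0∞} (hφ : Measurable φ) (hφ1 : ∀ z, φ z ≤ 1) {L : J → Ω → ℝ}
    (hL : ∀ i, Measurable (L i)) (hL0 : ∀ i z, 0 ≤ L i z) (hL1 : ∀ i, ∫⁻ z, ENNReal.ofReal (L i z) ∂P = 1)
    {q : J → ℝ} (hq : ∀ i, 0 ≤ q i) (hq1 : ∑ i, q i = 1) {E : J → J → ℝ} (hE0 : ∀ i j, 0 ≤ E i j)
    (hE : ∀ i j, ∫⁻ z, ENNReal.ofReal (L i z) * ENNReal.ofReal (L j z) ∂P ≤ ENNReal.ofReal (E i j))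
    {t : ℝ} (ht : 0 < t) (hchi : ∑ i, ∑ j, q i * q j * E i j ≤ 1 + t ^ 2) :
    ∫⁻ z, φ z ∂P ≤ ∑ i, ENNReal.ofReal (q i) * (∫⁻ z, φ z * ENNReal.ofReal (L i z) ∂P) + ENNReal.ofReal t := by
  let B : Ω → ℝ := fun z => ∑ i, q i * L i z
  have hBm : Measurable B := by fun_prop
  have hB0 : ∀ z, 0 ≤ B z := fun z => Finset.sum_nonneg fun i _ => mul_nonneg (hq i) (hL0 i z)
  have hBe : ∀ z, ENNReal.ofReal (B z) = ∑ i, ENNReal.ofReal (q i) * ENNReal.ofReal (L i z) := fun z => by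
    rw [ENNReal.ofReal_sum_of_nonneg fun i _ => mul_nonneg (hq i) (hL0 i z)]
    exact Finset.sum_congr rfl fun i _ => ENNReal.ofReal_mul (hq i)
  have hB1 : ∫⁻ z, ENNReal.ofReal (B z) ∂P = 1 := by
    simp only [hBe]
    rw [lintegral_finsetSum _ fun i _ => by fun_prop]
    have : ∀ i, ∫⁻ z, ENNReal.ofReal (q i) * ENNReal.ofReal (L i z) ∂P = ENNReal.ofReal (q i) := fun i => by
      rw [lintegral_const_mul _ (by fun_prop), hL1, mul_one]
    simp only [this]
    rw [← ENNReal.ofReal_sum_of_nonneg fun i _ => hq i, hq1, ENNReal.ofReal_one]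
  have hB2 : ∫⁻ z, ENNReal.ofReal (B z ^ 2) ∂P ≤ ENNReal.ofReal (1 + t ^ 2) := by
    have h1 : ∀ z, ENNReal.ofReal (B z ^ 2) = ∑ i, ∑ j, ENNReal.ofReal (q i * q j) *
        (ENNReal.ofReal (L i z) * ENNReal.ofReal (L j z)) := fun z => by
      rw [sq, ENNReal.ofReal_mul (hB0 z), hBe, Finset.sum_mul_sum]
      refine Finset.sum_congr rfl fun i _ => Finset.sum_congr rfl fun j _ => ?_
      rw [ENNReal.ofReal_mul (hq i)]; ring
    simp only [h1]
    rw [lintegral_finsetSum _ fun i _ => by fun_prop]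
    refine le_trans ?_ (ENNReal.ofReal_le_ofReal hchi)
    rw [ENNReal.ofReal_sum_of_nonneg fun i _ => Finset.sum_nonneg fun j _ =>
      mul_nonneg (mul_nonneg (hq i) (hq j)) (hE0 i j)]
    refine Finset.sum_le_sum fun i _ => ?_
    rw [lintegral_finsetSum _ fun j _ => by fun_prop, ENNReal.ofReal_sum_of_nonneg fun j _ =>
      mul_nonneg (mul_nonneg (hq i) (hq j)) (hE0 i j)]
    refine Finset.sum_le_sum fun j _ => ?_
    rw [lintegral_const_mul _ (by fun_prop), ENNReal.ofReal_mul (mul_nonneg (hq i) (hq j))]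
    exact mul_le_mul_right (hE i j) _
  -- The same inequality with the negative terms moved across, as integrals take extended
  -- nonnegative values.
  have hpt : ∀ z, φ z + ENNReal.ofReal (t⁻¹) * ENNReal.ofReal (B z) ≤ φ z * ENNReal.ofReal (B z) +
      (ENNReal.ofReal (t / 2 + (2 * t)⁻¹) + ENNReal.ofReal ((2 * t)⁻¹) * ENNReal.ofReal (B z ^ 2)) := fun z => by
    have hfin : φ z ≠ ∞ := ne_top_of_le_ne_top ENNReal.one_ne_top (hφ1 z)
    have hx1 : (φ z).toReal ≤ 1 := by
      have := ENNReal.toReal_mono ENNReal.one_ne_top (hφ1 z)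
      simpa using this
    have hx0 : 0 ≤ (φ z).toReal := ENNReal.toReal_nonneg
    rw [← ENNReal.ofReal_toReal hfin]
    set x := (φ z).toReal
    rw [← ENNReal.ofReal_mul (by positivity), ← ENNReal.ofReal_mul hx0,
      ← ENNReal.ofReal_mul (by positivity), ← ENNReal.ofReal_add hx0 (mul_nonneg (by positivity) (hB0 z)),
      ← ENNReal.ofReal_add (by positivity) (by positivity),
      ← ENNReal.ofReal_add (mul_nonneg hx0 (hB0 z)) (by positivity)]
    refine ENNReal.ofReal_le_ofReal ?_
    have h2 : x * (1 - B z) ≤ t / 2 + (2 * t)⁻¹ * (1 - B z) ^ 2 := by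
      have h3 : x * (1 - B z) ≤ |1 - B z| := by
        refine (le_abs_self _).trans ?_
        rw [abs_mul, abs_of_nonneg hx0]
        exact mul_le_of_le_one_left (abs_nonneg _) hx1
      refine h3.trans ?_
      rw [← sq_abs (1 - B z), ← sub_nonneg]
      have : t / 2 + (2 * t)⁻¹ * |1 - B z| ^ 2 - |1 - B z| = (2 * t)⁻¹ * (t - |1 - B z|) ^ 2 := by
        field_simp; ring
      rw [this]; positivity
    have h4 : (2 * t)⁻¹ * (1 - B z) ^ 2 = (2 * t)⁻¹ - t⁻¹ * B z + (2 * t)⁻¹ * B z ^ 2 := by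
      field_simp
      ring
    linarith
  have hint := lintegral_mono (μ := P) hpt
  rw [lintegral_add_left hφ, lintegral_const_mul _ (by fun_prop), hB1,
    lintegral_add_left (by fun_prop), lintegral_add_left (by fun_prop), lintegral_const_mul _ (by fun_prop),
    lintegral_const, measure_univ, mul_one, mul_one] at hint
  have h5 : ∫⁻ z, φ z * ENNReal.ofReal (B z) ∂P =
      ∑ i, ENNReal.ofReal (q i) * (∫⁻ z, φ z * ENNReal.ofReal (L i z) ∂P) := by
    simp only [hBe, Finset.mul_sum]
    rw [lintegral_finsetSum _ fun i _ => by fun_prop]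
    refine Finset.sum_congr rfl fun i _ => ?_
    rw [← lintegral_const_mul _ (by fun_prop)]
    refine lintegral_congr fun z => ?_
    ring
  rw [h5] at hint
  refine (ENNReal.add_le_add_iff_right (a := ENNReal.ofReal t⁻¹) ENNReal.ofReal_ne_top).1 (hint.trans ?_)
  rw [add_assoc]
  refine add_le_add le_rfl ?_
  refine (add_le_add le_rfl (mul_le_mul_right hB2 _)).trans (le_of_eq ?_)
  rw [← ENNReal.ofReal_mul (by positivity), ← ENNReal.ofReal_add (by positivity) (by positivity),
    ← ENNReal.ofReal_add (by positivity) (by positivity)]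
  congr 1
  field_simp; ring

/-- If some τ < T were admissible, θ₁ would be an alternative at distance τ and every test of level
α would have power at most α + t < 1 - η there. The supremum over tests is bounded before comparing,
so it need not be attained. -/
theorem le_tauAdap_of_prior {n p : ℕ} {M₁ M₂ α η t T : ℝ} {ku k : ℕ} {ξ : Fin p → ℝ} {t₀ : ℝ} {J : Type*} [Fintype J]
    {q : J → ℝ} (hq : ∀ i, 0 ≤ q i) (hq1 : ∑ i, q i = 1) {θ : J → Param p}
    (hθ : ∀ i, θ i ∈ nullSpace M₁ M₂ ku ξ t₀) {θ₁ : Param p} (hθ₁ : θ₁ ∈ altSpace M₁ M₂ k ξ t₀ T)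
    (hα : 0 ≤ α) (ht : 0 ≤ t) (htα : t < 1 - α - η)
    (hψ : ∀ ψ : Data n p → ℝ≥0∞, Measurable ψ → (∀ z, ψ z ≤ 1) →
      power ψ θ₁ ≤ ∑ i, ENNReal.ofReal (q i) * power ψ (θ i) + ENNReal.ofReal t) :
    ENNReal.ofReal T ≤ tauAdap n M₁ M₂ α η ku k ξ t₀ := by
  refine le_iInf fun τ => le_iInf fun hτ => le_iInf fun hsup => ENNReal.ofReal_le_ofReal ?_
  by_contra! hlt
  have hmem : θ₁ ∈ altSpace M₁ M₂ k ξ t₀ τ := ⟨hθ₁.1, hlt.le.trans hθ₁.2⟩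
  have : ENNReal.ofReal (1 - η) ≤ ENNReal.ofReal (α + t) := by
    refine hsup.trans (iSup₂_le fun ψ hψt => (iInf₂_le θ₁ hmem).trans ?_)
    obtain ⟨hm, h1, hs⟩ := hψt
    refine (hψ ψ hm h1).trans ?_
    rw [ENNReal.ofReal_add hα ht]
    refine add_le_add ?_ le_rfl
    calc ∑ i, ENNReal.ofReal (q i) * power ψ (θ i) ≤ ∑ i, ENNReal.ofReal (q i) * ENNReal.ofReal α :=
          Finset.sum_le_sum fun i _ => mul_le_mul_right ((le_iSup₂ (f := fun θ _ => power ψ θ) _ (hθ i)).trans hs) _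
      _ = ENNReal.ofReal α := by
        rw [← Finset.sum_mul, ← ENNReal.ofReal_sum_of_nonneg fun i _ => hq i, hq1, ENNReal.ofReal_one, one_mul]
  rw [ENNReal.ofReal_le_ofReal_iff (by linarith)] at this
  linarith

end AdaptiveSep

namespace AdaptiveSep

variable {p : ℕ}

/-! ### Laws of observations as images of sheared standard Gaussian measures -/

/-- Cramér–Wold. Every linear functional of (Y, X) can be rewritten in terms of X and the residual Y
- X·β, with bβ absorbed in the coefficient of X. -/
theorem obsLaw_eq_of_linear {θ : Param p} (hS : θ.Sig.PosSemidef) {μ : Measure (ℝ × (Fin p → ℝ))}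
    [IsProbabilityMeasure μ] (h : ∀ (a : Fin p → ℝ) (b : ℝ),
      μ.map (fun q => a ⬝ᵥ q.2 + b * (q.1 - q.2 ⬝ᵥ θ.beta)) =
        gaussianReal 0 (a ⬝ᵥ θ.Sig *ᵥ a + b ^ 2 * θ.sigma ^ 2).toNNReal) : μ = obsLaw θ := by
  refine Measure.ext_of_charFunDual ?_
  ext L
  rw [charFunDual_eq_charFun_map_one, charFunDual_eq_charFun_map_one]
  let b : ℝ := L (1, 0)
  let a : Fin p → ℝ := fun j => L (0, Pi.single j 1) + b * θ.beta j
  have hL : (L : ℝ × (Fin p → ℝ) → ℝ) = fun q => a ⬝ᵥ q.2 + b * (q.1 - q.2 ⬝ᵥ θ.beta) := by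
    ext q
    have h1 : q = q.1 • ((1 : ℝ), (0 : Fin p → ℝ)) + ∑ j, q.2 j • ((0 : ℝ), (Pi.single j 1 : Fin p → ℝ)) := by
      refine Prod.ext ?_ ?_
      · simp [Prod.fst_sum]
      · ext i
        simp [Prod.snd_sum, Finset.sum_apply, Pi.single_apply]
    conv_lhs => rw [h1]
    simp only [map_add, map_sum, map_smul, smul_eq_mul, dotProduct, a, add_mul, Finset.sum_add_distrib]
    rw [mul_sub, Finset.mul_sum]
    have : ∀ x, b * θ.beta x * q.2 x = b * (q.2 x * θ.beta x) := fun x => by ring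
    simp only [this]
    have : ∀ x, q.2 x * L (0, Pi.single x 1) = L (0, Pi.single x 1) * q.2 x := fun x => by ring
    simp only [this]
    simp only [b]
    ring
  rw [hL, h a b, map_linear_obsLaw hS a b]

/-- The observation built from standard Gaussian coordinates, with identity covariance. -/
def obsMap (β : Fin p → ℝ) (σ : ℝ) (x : Option (Fin p) → ℝ) : ℝ × (Fin p → ℝ) :=
  ((fun j => x (some j)) ⬝ᵥ β + σ * x none, fun j => x (some j))

theorem measurable_obsMap (β : Fin p → ℝ) (σ : ℝ) : Measurable (obsMap β σ) := by
  refine Continuous.measurable ?_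
  unfold obsMap dotProduct; fun_prop

/-- The vector with coordinate `c` on `none` and coordinates `a` on `some`. -/
def optVec (c : ℝ) (a : Fin p → ℝ) : Option (Fin p) → ℝ := fun o => o.elim c a

theorem optVec_dot (c : ℝ) (a : Fin p → ℝ) (x : Option (Fin p) → ℝ) :
    optVec c a ⬝ᵥ x = c * x none + a ⬝ᵥ fun j => x (some j) := by
  simp [dotProduct, optVec, Fintype.sum_option]

/-- The parameter of the observations after the shear by `g = (c, a)` and `d`. -/
noncomputable def shearParam (β : Fin p → ℝ) (σ c : ℝ) (a d : Fin p → ℝ) : Param p where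
  beta := β + σ • ((-(c * (d ⬝ᵥ d)) / (1 + c ^ 2 * (d ⬝ᵥ d))) • a + (c / (1 + c ^ 2 * (d ⬝ᵥ d))) • d)
  Sig := 1 + Matrix.vecMulVec d d + Matrix.vecMulVec a d + Matrix.vecMulVec d a
  sigma := σ / √(1 + c ^ 2 * (d ⬝ᵥ d))

theorem shearParam_isHermitian (β : Fin p → ℝ) (σ c : ℝ) (a d : Fin p → ℝ) :
    (shearParam β σ c a d).Sig.IsHermitian := by
  ext i j
  simp [shearParam, Matrix.vecMulVec_apply, Matrix.one_apply, eq_comm (a := j)]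
  ring

theorem dot_shearParam (β : Fin p → ℝ) (σ c : ℝ) (a d v : Fin p → ℝ) :
    v ⬝ᵥ (shearParam β σ c a d).Sig *ᵥ v = v ⬝ᵥ v + (v ⬝ᵥ d) ^ 2 + 2 * (v ⬝ᵥ a) * (v ⬝ᵥ d) := by
  simp only [shearParam, Matrix.add_mulVec, dotProduct_add, Matrix.one_mulVec, Matrix.vecMulVec_mulVec,
    dotProduct_smul, MulOpposite.smul_eq_mul_unop, MulOpposite.unop_op]
  rw [dotProduct_comm d v, dotProduct_comm a v]
  ring

/-- The form equals ‖v + (v·d)a‖² + c²(v·d)², the variance of v·X after the shear. -/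
theorem posSemidef_shearParam (β : Fin p → ℝ) (σ : ℝ) {c : ℝ} {a : Fin p → ℝ} (hca : c ^ 2 + a ⬝ᵥ a = 1) (d : Fin p → ℝ) :
    (shearParam β σ c a d).Sig.PosSemidef := by
  refine posSemidef_of_bounds (shearParam_isHermitian β σ c a d) fun v => ?_
  rw [dot_shearParam]
  have h := dot_self_nonneg (v + (v ⬝ᵥ d) • a)
  have e : (v + (v ⬝ᵥ d) • a) ⬝ᵥ (v + (v ⬝ᵥ d) • a) = v ⬝ᵥ v + 2 * (v ⬝ᵥ a) * (v ⬝ᵥ d) + (v ⬝ᵥ d) ^ 2 * (a ⬝ᵥ a) := by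
    simp only [add_dotProduct, dotProduct_add, smul_dotProduct, dotProduct_smul, smul_eq_mul]
    rw [dotProduct_comm a v]; ring
  rw [e] at h
  nlinarith [sq_nonneg (v ⬝ᵥ d * c)]

/-- After the shear, X = X₀ + (cε + a·X₀)d with (X₀, ε) standard, while Y = X·β + σε with the same
ε, now correlated with X. Put D = |d|². The regression of ε on X has coefficient (-cD a + c d)/(1 +
c²D) and residual variance 1/(1 + c²D), which explains `shearParam`. The proof compares the
variances of all linear functionals. -/
theorem map_obsMap_shear (β : Fin p → ℝ) (σ : ℝ) {c : ℝ} {a d : Fin p → ℝ} (hca : c ^ 2 + a ⬝ᵥ a = 1)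
    (had : a ⬝ᵥ d = 0) :
    (stdPi (Option (Fin p))).map (fun x => obsMap β σ (shear (optVec c a) (optVec 0 d) x)) =
      obsLaw (shearParam β σ c a d) := by
  have hm : Measurable fun x => obsMap β σ (shear (optVec c a) (optVec 0 d) x) :=
    (measurable_obsMap β σ).comp (continuous_shear _ _).measurable
  have : IsProbabilityMeasure ((stdPi (Option (Fin p))).map
    fun x => obsMap β σ (shear (optVec c a) (optVec 0 d) x)) := Measure.isProbabilityMeasure_map hm.aemeasurable
  refine obsLaw_eq_of_linear (posSemidef_shearParam β σ hca d) fun u w => ?_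
  have hl : Measurable fun q : ℝ × (Fin p → ℝ) => u ⬝ᵥ q.2 + w * (q.1 - q.2 ⬝ᵥ (shearParam β σ c a d).beta) := by
    refine Continuous.measurable ?_
    unfold dotProduct; fun_prop
  have hD : 0 ≤ d ⬝ᵥ d := dot_self_nonneg d
  have hK : 0 < 1 + c ^ 2 * (d ⬝ᵥ d) := by positivity
  set b₁ := -(c * (d ⬝ᵥ d)) / (1 + c ^ 2 * (d ⬝ᵥ d)) with hb₁
  set b₂ := c / (1 + c ^ 2 * (d ⬝ᵥ d)) with hb₂
  set e := u - (w * σ) • (b₁ • a + b₂ • d) with he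
  rw [Measure.map_map hl hm]
  have h1 : (fun q : ℝ × (Fin p → ℝ) => u ⬝ᵥ q.2 + w * (q.1 - q.2 ⬝ᵥ (shearParam β σ c a d).beta)) ∘
      (fun x => obsMap β σ (shear (optVec c a) (optVec 0 d) x)) =
      fun x => optVec ((e ⬝ᵥ d) * c + w * σ) (e + (e ⬝ᵥ d) • a) ⬝ᵥ x := by
    ext x
    set y : Fin p → ℝ := fun j => x (some j) with hy
    have hs : (fun j => shear (optVec c a) (optVec 0 d) x (some j)) = y + (c * x none + a ⬝ᵥ y) • d := by
      ext j; simp [shear, optVec_dot, optVec, y]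
    have hn : shear (optVec c a) (optVec 0 d) x none = x none := by simp [shear, optVec]
    have e1 : ∀ z : Fin p → ℝ, u ⬝ᵥ z + w * (z ⬝ᵥ β + σ * x none - z ⬝ᵥ (shearParam β σ c a d).beta) =
        e ⬝ᵥ z + w * σ * x none := fun z => by
      simp only [shearParam, ← hb₁, ← hb₂, he, dotProduct_add, sub_dotProduct, dotProduct_smul, smul_dotProduct,
        add_dotProduct, smul_eq_mul]
      rw [dotProduct_comm z a, dotProduct_comm z d]; ring
    simp only [Function.comp, obsMap, hs, hn]
    rw [e1, optVec_dot, ← hy]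
    simp only [dotProduct_add, dotProduct_smul, add_dotProduct, smul_dotProduct, smul_eq_mul]
    ring
  rw [h1, map_dot_stdPi, dot_shearParam]
  congr 2
  rw [optVec_dot]
  have h2 : (fun j => optVec ((e ⬝ᵥ d) * c + w * σ) (e + (e ⬝ᵥ d) • a) (some j)) = e + (e ⬝ᵥ d) • a := rfl
  have h3 : optVec ((e ⬝ᵥ d) * c + w * σ) (e + (e ⬝ᵥ d) • a) none = (e ⬝ᵥ d) * c + w * σ := rfl
  have hda : d ⬝ᵥ a = 0 := by rw [dotProduct_comm, had]
  have haa : a ⬝ᵥ a = 1 - c ^ 2 := by linarith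
  have hed : e ⬝ᵥ d = u ⬝ᵥ d - w * σ * b₂ * (d ⬝ᵥ d) := by
    simp only [he, sub_dotProduct, add_dotProduct, smul_dotProduct, smul_eq_mul, had]; ring
  have hea : e ⬝ᵥ a = u ⬝ᵥ a - w * σ * b₁ * (1 - c ^ 2) := by
    simp only [he, sub_dotProduct, add_dotProduct, smul_dotProduct, smul_eq_mul, hda, haa]; ring
  have hee : e ⬝ᵥ e = u ⬝ᵥ u - 2 * w * σ * (b₁ * (u ⬝ᵥ a) + b₂ * (u ⬝ᵥ d)) +
      w ^ 2 * σ ^ 2 * (b₁ ^ 2 * (1 - c ^ 2) + b₂ ^ 2 * (d ⬝ᵥ d)) := by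
    simp only [he, sub_dotProduct, add_dotProduct, smul_dotProduct, smul_eq_mul, had, dotProduct_sub,
      dotProduct_add, dotProduct_smul, hda, haa, dotProduct_comm a u, dotProduct_comm d u]
    ring
  have hsig : (shearParam β σ c a d).sigma ^ 2 = σ ^ 2 / (1 + c ^ 2 * (d ⬝ᵥ d)) := by
    simp only [shearParam]
    rw [div_pow, Real.sq_sqrt hK.le]
  rw [h2, h3, hsig]
  simp only [dotProduct_add, dotProduct_smul, add_dotProduct, smul_dotProduct, smul_eq_mul,
    dotProduct_comm a e, hee, hea, haa]
  rw [hed, hb₁, hb₂]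
  generalize d ⬝ᵥ d = D at *
  generalize u ⬝ᵥ d = x
  generalize u ⬝ᵥ a = y
  generalize u ⬝ᵥ u = z
  field_simp
  ring

end AdaptiveSep

/-! ### Likelihood ratios of samples and lower bounds from mixtures of shears -/

namespace AdaptiveSep

variable {n p : ℕ}

theorem lintegral_shearLR {ι : Type*} [Fintype ι] {g d : ι → ℝ} (h : g ⬝ᵥ d = 0) :
    ∫⁻ x, ENNReal.ofReal (shearLR g d x) ∂stdPi ι = 1 := by
  have := lintegral_shear h (F := fun _ => 1) measurable_const
  simpa using this.symm

theorem shearLR_pos {ι : Type*} [Fintype ι] (g d x : ι → ℝ) : 0 < shearLR g d x := Real.exp_pos _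

theorem integrable_shearLR {ι : Type*} [Fintype ι] {g d : ι → ℝ} (h : g ⬝ᵥ d = 0) :
    Integrable (shearLR g d) (stdPi ι) := by
  refine ⟨(continuous_shearLR g d).aestronglyMeasurable, ?_⟩
  rw [hasFiniteIntegral_iff_ofReal (Filter.Eventually.of_forall fun x => (shearLR_pos g d x).le),
    lintegral_shearLR h]
  exact ENNReal.one_lt_top

theorem optVec_dot_optVec (c e : ℝ) (a d : Fin p → ℝ) : optVec c a ⬝ᵥ optVec e d = c * e + a ⬝ᵥ d := by
  rw [optVec_dot]; rfl

/-- The likelihood ratio of `n` sheared observations. -/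
noncomputable def sampleLR (n : ℕ) (c : ℝ) (a d : Fin p → ℝ) (z : Fin n → Option (Fin p) → ℝ) : ℝ :=
  ∏ i, shearLR (optVec c a) (optVec 0 d) (z i)

theorem measurable_sampleLR (c : ℝ) (a d : Fin p → ℝ) : Measurable (sampleLR n c a d) := by
  refine Finset.measurable_prod _ fun i _ => ?_
  exact (continuous_shearLR _ _).measurable.comp (measurable_pi_apply i)

theorem sampleLR_nonneg (c : ℝ) (a d : Fin p → ℝ) (z : Fin n → Option (Fin p) → ℝ) : 0 ≤ sampleLR n c a d z :=
  Finset.prod_nonneg fun _ _ => (Real.exp_pos _).le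

theorem ofReal_sampleLR (c : ℝ) (a d : Fin p → ℝ) (z : Fin n → Option (Fin p) → ℝ) :
    ENNReal.ofReal (sampleLR n c a d z) = ∏ i, ENNReal.ofReal (shearLR (optVec c a) (optVec 0 d) (z i)) :=
  ENNReal.ofReal_prod_of_nonneg fun _ _ => (Real.exp_pos _).le

theorem power_shearParam {ψ : Data n p → ℝ≥0∞} (hψ : Measurable ψ) (β : Fin p → ℝ) (σ : ℝ) {c : ℝ} {a d : Fin p → ℝ}
    (hca : c ^ 2 + a ⬝ᵥ a = 1) (had : a ⬝ᵥ d = 0) :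
    power ψ (shearParam β σ c a d) = ∫⁻ z, ψ (fun i => obsMap β σ (z i)) * ENNReal.ofReal (sampleLR n c a d z)
      ∂(Measure.pi fun _ : Fin n => stdPi (Option (Fin p))) := by
  have hgd : optVec c a ⬝ᵥ optVec 0 d = 0 := by rw [optVec_dot_optVec, had]; ring
  have hm : Measurable fun z : Fin n → Option (Fin p) → ℝ => fun i => obsMap β σ (z i) :=
    measurable_pi_lambda _ fun i => (measurable_obsMap β σ).comp (measurable_pi_apply i)
  have hlaw : dataLaw n (shearParam β σ c a d) =
      ((Measure.pi fun _ : Fin n => stdPi (Option (Fin p))).withDensity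
        fun z => ENNReal.ofReal (sampleLR n c a d z)).map fun z i => obsMap β σ (z i) := by
    unfold dataLaw sampleLR
    rw [← pi_withDensity (fun _ : Fin n => stdPi (Option (Fin p)))
      (f := fun _ => shearLR (optVec c a) (optVec 0 d)) (fun _ x => (shearLR_pos _ _ x).le)
      (fun _ => integrable_shearLR hgd), ← map_obsMap_shear β σ hca had, ← map_shear hgd]
    have : IsProbabilityMeasure ((stdPi (Option (Fin p))).map (shear (optVec c a) (optVec 0 d))) :=
      Measure.isProbabilityMeasure_map (continuous_shear _ _).measurable.aemeasurable
    have h2 := Measure.map_map (μ := stdPi (Option (Fin p))) (measurable_obsMap β σ)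
      (continuous_shear (optVec c a) (optVec 0 d)).measurable
    have : IsProbabilityMeasure
        (((stdPi (Option (Fin p))).map (shear (optVec c a) (optVec 0 d))).map (obsMap β σ)) :=
      Measure.isProbabilityMeasure_map (measurable_obsMap β σ).aemeasurable
    rw [Measure.pi_map_pi (fun _ => (measurable_obsMap β σ).aemeasurable), h2]
    rfl
  have hL := measurable_sampleLR (n := n) c a d
  unfold power
  rw [hlaw, lintegral_map hψ hm]
  refine (lintegral_withDensity_eq_lintegral_mul _ (by fun_prop) (hψ.comp hm)).trans ?_
  exact lintegral_congr fun z => mul_comm _ _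

/-- The shear by d = 0 is the identity, so the reference measure is the alternative itself.
Independence of the n observations raises the bound exp(2 d·d') to the power n. -/
theorem power_shearParam_le {J : Type*} [Fintype J] {q : J → ℝ} (hq : ∀ i, 0 ≤ q i) (hq1 : ∑ i, q i = 1)
    {ψ : Data n p → ℝ≥0∞} (hψ : Measurable ψ) (hψ1 : ∀ z, ψ z ≤ 1) (β : Fin p → ℝ) (σ : ℝ) {c : ℝ} {a : Fin p → ℝ}
    (hca : c ^ 2 + a ⬝ᵥ a = 1) {d : J → Fin p → ℝ} (had : ∀ i, a ⬝ᵥ d i = 0)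
    (hd0 : ∀ i j, 0 ≤ d i ⬝ᵥ d j) (hd1 : ∀ i j, d i ⬝ᵥ d j ≤ 1 / 4) {t : ℝ} (ht : 0 < t)
    (hchi : ∑ i, ∑ j, q i * q j * Real.exp (2 * n * (d i ⬝ᵥ d j)) ≤ 1 + t ^ 2) :
    power ψ (shearParam β σ c a 0) ≤
      ∑ i, ENNReal.ofReal (q i) * power ψ (shearParam β σ c a (d i)) + ENNReal.ofReal t := by
  have hm : Measurable fun z : Fin n → Option (Fin p) → ℝ => fun i => obsMap β σ (z i) :=
    measurable_pi_lambda _ fun i => (measurable_obsMap β σ).comp (measurable_pi_apply i)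
  have hgg : optVec c a ⬝ᵥ optVec c a = 1 := by rw [optVec_dot_optVec]; linarith
  have hgd : ∀ i, optVec c a ⬝ᵥ optVec 0 (d i) = 0 := fun i => by rw [optVec_dot_optVec, had]; ring
  have hdd : ∀ i j, optVec 0 (d i) ⬝ᵥ optVec 0 (d j) = d i ⬝ᵥ d j := fun i j => by rw [optVec_dot_optVec]; ring
  have hLm : ∀ i, Measurable fun x => ENNReal.ofReal (shearLR (optVec c a) (optVec 0 (d i)) x) := fun i =>
    (continuous_shearLR _ _).measurable.ennreal_ofReal
  simp only [power_shearParam hψ β σ hca (had _), power_shearParam hψ β σ hca (dotProduct_zero a)]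
  have h0 : ∀ z, sampleLR n c a 0 z = 1 := fun z => by
    have : ∀ x, optVec 0 (0 : Fin p → ℝ) ⬝ᵥ x = 0 := fun x => by rw [optVec_dot]; simp
    simp [sampleLR, shearLR, this]
  simp only [h0, ENNReal.ofReal_one, mul_one]
  refine lintegral_le_of_chiSq (hψ.comp hm) (fun z => hψ1 _) (fun i => measurable_sampleLR c a (d i))
    (fun i => sampleLR_nonneg c a (d i)) (fun i => ?_) hq hq1 (fun _ _ => (Real.exp_pos _).le) (fun i j => ?_) ht hchi
  · simp only [ofReal_sampleLR]
    rw [lintegral_pi_prod (fun _ : Fin n => stdPi (Option (Fin p))) fun _ => hLm i]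
    simp [lintegral_shearLR (hgd i)]
  · simp only [ofReal_sampleLR, ← Finset.prod_mul_distrib]
    rw [lintegral_pi_prod (fun _ : Fin n => stdPi (Option (Fin p))) (f := fun _ x =>
      ENNReal.ofReal (shearLR (optVec c a) (optVec 0 (d i)) x) * ENNReal.ofReal (shearLR (optVec c a) (optVec 0 (d j)) x))
      fun _ => (hLm i).mul (hLm j),
      Finset.prod_const, Finset.card_univ, Fintype.card_fin]
    have h := lintegral_shearLR_mul hgg (hgd i) (hgd j) (by rw [hdd]; exact hd0 i j) (by rw [hdd]; exact hd1 i j)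
    rw [hdd] at h
    refine (pow_le_pow_left₀ zero_le h n).trans (le_of_eq ?_)
    rw [← ENNReal.ofReal_pow (Real.exp_pos _).le, ← Real.exp_nat_mul]
    congr 2; ring

/-- For ε = (1 - 1/M₁)/3 and |d| ≤ ε, |a| ≤ 1, the covariance form lies between (1 - 2ε)‖v‖² and (1
+ 2ε + ε²)‖v‖². Here 1 - 3ε = 1/M₁, and 1 + 3ε ≤ M₁ because M₁ + 1/M₁ ≥ 2. The noise level only
decreases. -/
theorem shearParam_mem_paramSpace {M₁ M₂ : ℝ} (hM₁ : 1 < M₁) {k : ℕ} {β : Fin p → ℝ} {σ : ℝ} (hσ : 0 < σ)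
    (hσ₂ : σ ≤ M₂) {c : ℝ} {a d : Fin p → ℝ} (hca : c ^ 2 + a ⬝ᵥ a = 1)
    (hd : d ⬝ᵥ d ≤ ((1 - 1 / M₁) / 3) ^ 2) (hk : l0 (shearParam β σ c a d).beta ≤ k) :
    shearParam β σ c a d ∈ paramSpace p M₁ M₂ k := by
  have hD : 0 ≤ d ⬝ᵥ d := dot_self_nonneg d
  have hi1 : 1 / M₁ < 1 := by rw [div_lt_one (by linarith)]; exact hM₁
  have hi0 : 0 < 1 / M₁ := by positivity
  refine ⟨hk, ⟨shearParam_isHermitian β σ c a d, eigenvalues_bounds _ fun v => ?_⟩, ?_, ?_⟩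
  · rw [dot_shearParam]
    set ε := (1 - 1 / M₁) / 3 with hε
    have hε0 : 0 < ε := by rw [hε]; linarith
    have hε1 : ε < 1 := by rw [hε]; linarith
    have hV : 0 ≤ v ⬝ᵥ v := dot_self_nonneg v
    have h1 : (v ⬝ᵥ d) ^ 2 ≤ ε ^ 2 * (v ⬝ᵥ v) := by
      refine (dot_sq_le v d).trans ?_
      rw [mul_comm]
      exact mul_le_mul_of_nonneg_right hd hV
    have ha : a ⬝ᵥ a ≤ 1 := by nlinarith [sq_nonneg c]
    have h2 : (v ⬝ᵥ a) ^ 2 ≤ v ⬝ᵥ v := by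
      refine (dot_sq_le v a).trans ?_
      exact mul_le_of_le_one_right hV ha
    have h3 : |2 * (v ⬝ᵥ a) * (v ⬝ᵥ d)| ≤ 2 * ε * (v ⬝ᵥ v) := by
      refine abs_le_of_sq_le_sq ?_ (by positivity)
      calc (2 * (v ⬝ᵥ a) * (v ⬝ᵥ d)) ^ 2 = 4 * ((v ⬝ᵥ a) ^ 2 * (v ⬝ᵥ d) ^ 2) := by ring
        _ ≤ 4 * ((v ⬝ᵥ v) * (ε ^ 2 * (v ⬝ᵥ v))) := by gcongr
        _ = _ := by ring
    obtain ⟨h4, h5⟩ := abs_le.1 h3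
    have h6 : 1 + ε ^ 2 + 2 * ε ≤ M₁ := by
      have : 1 - 1 / M₁ ≤ M₁ - 1 := by
        have : 2 ≤ M₁ + 1 / M₁ := by
          rw [← sub_nonneg]
          have : M₁ + 1 / M₁ - 2 = (M₁ - 1) ^ 2 / M₁ := by field_simp; ring
          rw [this]; positivity
        linarith
      nlinarith
    constructor
    · have h7 : (1 / M₁) * (v ⬝ᵥ v) = (1 - 3 * ε) * (v ⬝ᵥ v) := by rw [hε]; ring
      rw [h7]
      nlinarith [sq_nonneg (v ⬝ᵥ d), mul_nonneg hε0.le hV]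
    · have := mul_le_mul_of_nonneg_right h6 hV
      linarith
  · simp only [shearParam]
    have : 0 < 1 + c ^ 2 * (d ⬝ᵥ d) := by positivity
    positivity
  · simp only [shearParam]
    refine le_trans (div_le_self hσ.le ?_) hσ₂
    rw [Real.one_le_sqrt]
    have : 0 ≤ c ^ 2 * (d ⬝ᵥ d) := by positivity
    linarith

/-- Lower bound for the adaptive separation distance from a finite mixture of sheared parameters. -/
theorem le_tauAdap_of_shear {M₁ M₂ α η T : ℝ} (hM₁ : 1 < M₁) (hM₂ : 0 < M₂) (hα : 0 ≤ α) {ku k : ℕ}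
    {ξ : Fin p → ℝ} {t₀ : ℝ} {J : Type*} [Fintype J] {q : J → ℝ} (hq : ∀ i, 0 ≤ q i) (hq1 : ∑ i, q i = 1)
    {β : Fin p → ℝ} (hβ : l0 β ≤ k) (hT : T ≤ |ξ ⬝ᵥ β - t₀|) {c : ℝ} {a : Fin p → ℝ} (hca : c ^ 2 + a ⬝ᵥ a = 1)
    {d : J → Fin p → ℝ} (had : ∀ i, a ⬝ᵥ d i = 0) (hd0 : ∀ i j, 0 ≤ d i ⬝ᵥ d j)
    (hd : ∀ i, d i ⬝ᵥ d i ≤ ((1 - 1 / M₁) / 3) ^ 2)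
    (hk : ∀ i, l0 (shearParam β M₂ c a (d i)).beta ≤ ku) (hξ : ∀ i, ξ ⬝ᵥ (shearParam β M₂ c a (d i)).beta = t₀)
    {t : ℝ} (ht : 0 < t) (htα : t < 1 - α - η)
    (hchi : ∑ i, ∑ j, q i * q j * Real.exp (2 * n * (d i ⬝ᵥ d j)) ≤ 1 + t ^ 2) :
    ENNReal.ofReal T ≤ tauAdap n M₁ M₂ α η ku k ξ t₀ := by
  have hi1 : 1 / M₁ < 1 := by rw [div_lt_one (by linarith)]; exact hM₁
  have hi0 : 0 < 1 / M₁ := by positivity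
  have hb0 : (shearParam β M₂ c a 0).beta = β := by simp [shearParam]
  refine le_tauAdap_of_prior hq hq1
    (fun i => ⟨shearParam_mem_paramSpace hM₁ hM₂ le_rfl hca (hd i) (hk i), hξ i⟩)
    (θ₁ := shearParam β M₂ c a 0) ⟨shearParam_mem_paramSpace hM₁ hM₂ le_rfl hca ?_ (by rwa [hb0]), by rwa [hb0]⟩
    hα ht.le htα fun ψ hψ hψ1 => power_shearParam_le hq hq1 hψ hψ1 β M₂ hca had hd0 (fun i j => ?_) ht hchi
  · rw [dotProduct_zero]; positivity
  · refine (abs_le.1 (abs_le_of_sq_le_sq (b := 1 / 4) ?_ (by norm_num))).2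
    have h1 : ((1 - 1 / M₁) / 3) ^ 2 ≤ 1 / 9 := by nlinarith
    have hi := dot_self_nonneg (d i)
    have hj := dot_self_nonneg (d j)
    have := mul_le_mul ((hd i).trans h1) ((hd j).trans h1) hj (by norm_num)
    refine (dot_sq_le (d i) (d j)).trans (this.trans (by norm_num))

end AdaptiveSep

namespace AdaptiveSep

/-! ### Product priors -/

section
variable {ι : Type*} [Fintype ι] [DecidableEq ι] {C : ι → Type*} [∀ g, Fintype (C g)]

theorem sum_prod_weights {w : ∀ g, C g → ℝ} (hw1 : ∀ g, ∑ c, w g c = 1) : ∑ J : ∀ g, C g, ∏ g, w g (J g) = 1 := by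
  have h := Finset.prod_univ_sum (fun g => (Finset.univ : Finset (C g))) w
  rw [Fintype.piFinset_univ] at h
  rw [← h]
  exact Finset.prod_eq_one fun g _ => hw1 g

/-- Two independent draws from a product prior interact group by group, so the sum factors. A group
contributes 1 + Σ w²(exp y - 1) ≤ exp r, because w² is the probability that both draws pick the same
element. -/
theorem sum_prior_exp_le [∀ g, DecidableEq (C g)] {w : ∀ g, C g → ℝ} (hw : ∀ g c, 0 ≤ w g c)
    (hw1 : ∀ g, ∑ c, w g c = 1) {y : ∀ g, C g → ℝ} {r : ι → ℝ}
    (hr : ∀ g, ∑ c, w g c ^ 2 * (Real.exp (y g c) - 1) ≤ r g) :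
    ∑ J : ∀ g, C g, ∑ J' : ∀ g, C g, (∏ g, w g (J g)) * (∏ g, w g (J' g)) *
      Real.exp (∑ g, if J g = J' g then y g (J g) else 0) ≤ Real.exp (∑ g, r g) := by
  have h1 : ∀ J : ∀ g, C g, ∑ J' : ∀ g, C g, (∏ g, w g (J g)) * (∏ g, w g (J' g)) *
      Real.exp (∑ g, if J g = J' g then y g (J g) else 0) =
      ∏ g, ∑ c, w g (J g) * w g c * Real.exp (if J g = c then y g (J g) else 0) := fun J => by
    rw [Finset.prod_univ_sum, Fintype.piFinset_univ]
    refine Finset.sum_congr rfl fun J' _ => ?_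
    rw [Finset.prod_mul_distrib, Finset.prod_mul_distrib, Real.exp_sum]
  simp only [h1]
  have h2 := Finset.prod_univ_sum (fun g => (Finset.univ : Finset (C g)))
    fun g c' => ∑ c, w g c' * w g c * Real.exp (if c' = c then y g c' else 0)
  rw [Fintype.piFinset_univ] at h2
  rw [← h2, Real.exp_sum]
  refine Finset.prod_le_prod (fun g _ => Finset.sum_nonneg fun c _ => Finset.sum_nonneg fun c' _ =>
    mul_nonneg (mul_nonneg (hw g c) (hw g c')) (Real.exp_pos _).le) fun g _ => ?_
  have h3 : ∀ c c', w g c * w g c' * Real.exp (if c = c' then y g c else 0) =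
      w g c * w g c' + if c = c' then w g c ^ 2 * (Real.exp (y g c) - 1) else 0 := fun c c' => by
    split_ifs with h
    · subst h; ring
    · simp
  simp only [h3, Finset.sum_add_distrib, ← Finset.mul_sum, hw1, Finset.sum_ite_eq, Finset.mem_univ, if_true, mul_one]
  linarith [hr g, Real.add_one_le_exp (r g)]

end

theorem dot_sum_orthogonal {ι : Type*} [Fintype ι] {C : ι → Type*} {p : ℕ} [∀ g, DecidableEq (C g)] {u : ∀ g, C g → Fin p → ℝ}
    (hu : ∀ g c g' c', g ≠ g' → u g c ⬝ᵥ u g' c' = 0) (hu' : ∀ g c c', c ≠ c' → u g c ⬝ᵥ u g c' = 0) (J J' : ∀ g, C g) :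
    (∑ g, u g (J g)) ⬝ᵥ (∑ g, u g (J' g)) =
      ∑ g, if J g = J' g then u g (J g) ⬝ᵥ u g (J g) else 0 := by
  rw [sum_dotProduct]
  refine Finset.sum_congr rfl fun g _ => ?_
  rw [dotProduct_sum, Finset.sum_eq_single g (fun g' _ h => hu g _ g' _ h.symm) (by simp)]
  split_ifs with h
  · rw [← h]
  · exact hu' g _ _ h

variable {n p : ℕ}

/-- Choice of the shear for a prescribed difference of signals. -/
theorem exists_shearParam_beta {σ ε : ℝ} (hσ : 0 < σ) (hε0 : 0 ≤ ε) (hε : ε ≤ 1) {δ : Fin p → ℝ}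
    (hδ : 4 * (δ ⬝ᵥ δ) ≤ ε ^ 2 * σ ^ 2) : ∃ τ : ℝ, 0 ≤ τ ∧ τ ≤ 2 / σ ∧ (τ • δ) ⬝ᵥ (τ • δ) ≤ ε ^ 2 ∧
      ∀ β : Fin p → ℝ, (shearParam β σ 1 0 (τ • δ)).beta = β + δ := by
  set A := δ ⬝ᵥ δ / σ ^ 2 with hA
  have hA0 : 0 ≤ A := div_nonneg (dot_self_nonneg δ) (by positivity)
  have hA4 : 4 * A ≤ ε ^ 2 := by
    rw [hA, mul_div_assoc', div_le_iff₀ (by positivity)]; exact hδ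
  have hA1 : 4 * A ≤ 1 := hA4.trans (pow_le_one₀ hε0 hε)
  set r := √(1 - 4 * A) with hr
  have hr0 : 0 ≤ r := Real.sqrt_nonneg _
  have hr2 : r ^ 2 = 1 - 4 * A := Real.sq_sqrt (by linarith)
  have hAr : A = (1 - r ^ 2) / 4 := by linarith
  have hdd : δ ⬝ᵥ δ = A * σ ^ 2 := by rw [hA]; field_simp
  have hD : (2 / (1 + r) / σ) • δ ⬝ᵥ (2 / (1 + r) / σ) • δ = (2 / (1 + r)) ^ 2 * A := by
    simp only [smul_dotProduct, dotProduct_smul, smul_eq_mul, hdd]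
    field_simp
  have ht2 : 2 / (1 + r) ≤ 2 := div_le_self (by norm_num) (by linarith)
  have ht0 : 0 ≤ 2 / (1 + r) := by positivity
  -- The shear adds exactly δ to β when x = στ solves x = 1 + A x²; this is the smaller root, which
  -- stays at most 2.
  refine ⟨2 / (1 + r) / σ, by positivity, by gcongr, ?_, fun β => ?_⟩
  · rw [hD]
    have := pow_le_pow_left₀ ht0 ht2 2
    nlinarith
  · have h1 : 1 + 1 ^ 2 * ((2 / (1 + r)) ^ 2 * A) = 2 / (1 + r) := by
      rw [hAr]; field_simp; ring
    simp only [shearParam, hD, h1, smul_zero, zero_add]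
    rw [smul_smul, smul_smul]
    have h2 : σ * (1 / (2 / (1 + r))) * (2 / (1 + r) / σ) = 1 := by field_simp
    rw [h2, one_smul]

theorem l0_add_le (a b : Fin p → ℝ) : l0 (a + b) ≤ l0 a + l0 b := by
  unfold l0
  refine le_trans (Finset.card_le_card fun j hj => ?_) (Finset.card_union_le _ _)
  simp only [Finset.mem_union, Finset.mem_filter, Finset.mem_univ, true_and, Pi.add_apply] at hj ⊢
  by_contra! h
  exact hj (by rw [h.1, h.2, add_zero])

theorem l0_sum_le {ι : Type*} (s : Finset ι) (f : ι → Fin p → ℝ) {m : ℕ} (hf : ∀ i ∈ s, l0 (f i) ≤ m) :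
    l0 (∑ i ∈ s, f i) ≤ s.card * m := by
  classical
  induction s using Finset.induction_on with
  | empty => simp [l0]
  | insert i s hi ih =>
    rw [Finset.sum_insert hi, Finset.card_insert_of_notMem hi, add_mul, one_mul, add_comm (_ * _)]
    exact (l0_add_le _ _).trans (add_le_add (hf i (Finset.mem_insert_self _ _))
      (ih fun j hj => hf j (Finset.mem_insert_of_mem hj)))

theorem l0_single_le (j : Fin p) (x : ℝ) : l0 (Pi.single j x : Fin p → ℝ) ≤ 1 := by
  unfold l0
  refine (Finset.card_le_card (t := {j}) fun i hi => ?_).trans (by simp)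
  by_contra h
  exact (Finset.mem_filter.1 hi).2 (Pi.single_eq_of_ne (M := fun _ => ℝ) (by simpa using h) x)

/-- Lower bound from a prior that picks one coordinate from each of several disjoint groups. -/
theorem le_tauAdap_of_groups {M₁ M₂ α η : ℝ} (hM₁ : 1 < M₁) (hM₂ : 0 < M₂) (hα : 0 ≤ α) {ku k : ℕ} (hk : 1 ≤ k)
    {ξ : Fin p → ℝ} {t₀ : ℝ} {j₀ : Fin p} (hj₀ : ξ j₀ ≠ 0) (hn : 0 < n) {ι : Type*} [Fintype ι] [DecidableEq ι]
    {G : ι → Finset (Fin p)} (hG : ∀ g g', g ≠ g' → Disjoint (G g) (G g')) (hGξ : ∀ g, ∀ j ∈ G g, ξ j ≠ 0)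
    {w : ι → Fin p → ℝ} (hw : ∀ g j, 0 ≤ w g j) (hw1 : ∀ g, ∑ j ∈ G g, w g j = 1) {κ : ι → ℝ}
    {r : ι → ℝ} (hr : ∀ g, ∑ j ∈ G g, w g j ^ 2 * (Real.exp (8 / M₂ ^ 2 * (κ g ^ 2 / ξ j ^ 2)) - 1) ≤ r g)
    {K : ℝ} (hK : ∀ g, ∀ j ∈ G g, κ g ^ 2 / ξ j ^ 2 ≤ K)
    (hKn : 4 * (Fintype.card ι * (K / n)) ≤ ((1 - 1 / M₁) / 3) ^ 2 * M₂ ^ 2) (hcard : Fintype.card ι + 1 ≤ ku)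
    {t : ℝ} (ht : 0 < t) (htα : t < 1 - α - η) (hrt : Real.exp (∑ g, r g) ≤ 1 + t ^ 2) :
    ENNReal.ofReal ((∑ g, κ g) / √n) ≤ tauAdap n M₁ M₂ α η ku k ξ t₀ := by
  classical
  have hn' : (0 : ℝ) < n := by exact_mod_cast hn
  have hi1 : 1 / M₁ < 1 := by rw [div_lt_one (by linarith)]; exact hM₁
  have hi0 : 0 < 1 / M₁ := by positivity
  set ε := (1 - 1 / M₁) / 3 with hε
  let C : ι → Type := fun g => {j // j ∈ G g}
  -- The entry κ_g/(√n ξ_j) makes the change of ξ·β equal to Σ_g κ_g/√n for every draw, so all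
  -- mixture components meet the same null constraint.
  let u : ∀ g, C g → Fin p → ℝ := fun g c => Pi.single c.1 (κ g / (√n * ξ c.1))
  let δ : (∀ g, C g) → Fin p → ℝ := fun J => ∑ g, u g (J g)
  have huu : ∀ g c, u g c ⬝ᵥ u g c = κ g ^ 2 / ξ c.1 ^ 2 / n := fun g c => by
    have := hGξ g c.1 c.2
    simp only [u, single_dotProduct, Pi.single_eq_same]
    rw [← sq, div_pow, mul_pow, Real.sq_sqrt hn'.le]
    field_simp
  have hδδ : ∀ J J', δ J ⬝ᵥ δ J' = ∑ g, if J g = J' g then κ g ^ 2 / ξ (J g).1 ^ 2 / n else 0 := fun J J' => by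
    simp only [δ]
    rw [dot_sum_orthogonal]
    · simp only [huu]
    · intro g c g' c' h
      have : c.1 ≠ c'.1 := fun e => Finset.disjoint_left.1 (hG g g' h) c.2 (e ▸ c'.2)
      simp [u, this]
    · intro g c c' h
      have : c.1 ≠ c'.1 := fun e => h (Subtype.ext e)
      simp [u, this]
  have hterm0 : ∀ g (c : C g), 0 ≤ κ g ^ 2 / ξ c.1 ^ 2 / n := fun g c => by positivity
  have hδ0 : ∀ J J', 0 ≤ δ J ⬝ᵥ δ J' := fun J J' => by
    rw [hδδ]
    exact Finset.sum_nonneg fun g _ => by split_ifs <;> [exact hterm0 g _; exact le_rfl]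
  have hξδ : ∀ J, ξ ⬝ᵥ δ J = (∑ g, κ g) / √n := fun J => by
    simp only [δ, dotProduct_sum, Finset.sum_div]
    refine Finset.sum_congr rfl fun g _ => ?_
    have := hGξ g (J g).1 (J g).2
    simp only [u, dotProduct_single]
    field_simp
  have hδ4 : ∀ J, 4 * (δ J ⬝ᵥ δ J) ≤ ε ^ 2 * M₂ ^ 2 := fun J => by
    refine le_trans ?_ hKn
    rw [hδδ]
    simp only [if_true]
    have : ∑ g, κ g ^ 2 / ξ (J g).1 ^ 2 / n ≤ ∑ _g : ι, K / n :=
      Finset.sum_le_sum fun g _ => div_le_div_of_nonneg_right (hK g _ (J g).2) hn'.le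
    rw [Finset.sum_const, Finset.card_univ, nsmul_eq_mul] at this
    linarith
  have hlδ : ∀ J, l0 (δ J) ≤ Fintype.card ι := fun J => by
    have := l0_sum_le Finset.univ (fun g => u g (J g)) (m := 1) fun g _ => l0_single_le _ _
    rwa [mul_one] at this
  -- The scale varies with the draw since ‖δ J‖ does. Only τ ≤ 2/M₂ enters the χ² sum, giving the
  -- constant 8/M₂² = 2(2/M₂)².
  choose τ hτ0 hτ hτε hτβ using fun J => exists_shearParam_beta hM₂ (by rw [hε]; linarith)
    (by rw [hε]; linarith) (hδ4 J)
  set T := (∑ g, κ g) / √n with hT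
  -- The one-sparse alternative, with functional t₀ - T; adding δ restores t₀ and uses at most one
  -- further coordinate per group.
  set β : Fin p → ℝ := Pi.single j₀ ((t₀ - T) / ξ j₀) with hβ
  have hξβ : ξ ⬝ᵥ β = t₀ - T := by
    rw [hβ, dotProduct_single]; field_simp
  refine le_tauAdap_of_shear hM₁ hM₂ hα (q := fun J : ∀ g, C g => ∏ g, w g (J g).1) (β := β) (c := 1) (a := 0)
    (d := fun J => τ J • δ J) (fun J => Finset.prod_nonneg fun g _ => hw g _)
    (sum_prod_weights (w := fun g (c : C g) => w g c.1) fun g => ?_)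
    ((l0_single_le _ _).trans hk) ?_ (by simp) (fun J => by simp) (fun J J' => ?_) hτε
    (fun J => ?_) (fun J => ?_) ht htα ?_
  · rw [← hw1 g]; exact Finset.sum_coe_sort (G g) (w g)
  · rw [hξβ]
    have : t₀ - T - t₀ = -T := by ring
    rw [this, abs_neg]; exact le_abs_self T
  · simp only [smul_dotProduct, dotProduct_smul, smul_eq_mul]
    exact mul_nonneg (hτ0 J') (mul_nonneg (hτ0 J) (hδ0 J J'))
  · rw [hτβ]
    refine (l0_add_le _ _).trans (le_trans (add_le_add (l0_single_le _ _) (hlδ J)) ?_)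
    omega
  · rw [hτβ, dotProduct_add, hξβ, hξδ]; ring
  · refine le_trans (Finset.sum_le_sum fun J _ => Finset.sum_le_sum fun J' _ => ?_)
      ((sum_prior_exp_le (w := fun g (c : C g) => w g c.1) (y := fun g c => 8 / M₂ ^ 2 * (κ g ^ 2 / ξ c.1 ^ 2))
        (r := r) (fun g c => hw g c.1) (fun g => ?_) fun g => ?_).trans hrt)
    · refine mul_le_mul_of_nonneg_left (Real.exp_le_exp.2 ?_) (mul_nonneg
        (Finset.prod_nonneg fun g _ => hw g _) (Finset.prod_nonneg fun g _ => hw g _))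
      have e : ∀ g, (if J g = J' g then 8 / M₂ ^ 2 * (κ g ^ 2 / ξ (J g).1 ^ 2) else 0) =
          8 / M₂ ^ 2 * n * (if J g = J' g then κ g ^ 2 / ξ (J g).1 ^ 2 / n else 0) := fun g => by
        split_ifs
        · field_simp
        · simp
      simp only [e]
      rw [← Finset.mul_sum, ← hδδ]
      simp only [smul_dotProduct, dotProduct_smul, smul_eq_mul]
      have h1 : τ J * τ J' ≤ 2 / M₂ * (2 / M₂) := mul_le_mul (hτ J) (hτ J') (hτ0 J') (by positivity)
      have h2 := mul_le_mul_of_nonneg_right h1 (mul_nonneg (by positivity : 0 ≤ 2 * (n : ℝ)) (hδ0 J J'))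
      calc _ = τ J * τ J' * (2 * n * (δ J ⬝ᵥ δ J')) := by ring
        _ ≤ _ := h2
        _ = _ := by field_simp; ring
    · rw [← hw1 g]; exact Finset.sum_coe_sort (G g) (w g)
    · refine le_trans (le_of_eq ?_) (hr g)
      exact Finset.sum_coe_sort (G g) fun j => w g j ^ 2 * (Real.exp (8 / M₂ ^ 2 * (κ g ^ 2 / ξ j ^ 2)) - 1)

end AdaptiveSep

namespace AdaptiveSep

/-! ### Grouping of coordinates -/

/-- The least value of `v` on a nonempty finite set. -/
noncomputable def minOn {E : Type*} (v : E → ℝ) (B : Finset E) : ℝ := if h : B.Nonempty then B.inf' h v else 0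

theorem minOn_le {E : Type*} {v : E → ℝ} {B : Finset E} {j : E} (hj : j ∈ B) : minOn v B ≤ v j := by
  rw [minOn, dif_pos ⟨j, hj⟩]; exact Finset.inf'_le _ hj

theorem minOn_nonneg {E : Type*} {v : E → ℝ} (hv : ∀ j, 0 ≤ v j) (B : Finset E) : 0 ≤ minOn v B := by
  unfold minOn
  split_ifs with h
  · exact Finset.le_inf' _ _ fun j _ => hv j
  · exact le_rfl

theorem le_minOn {E : Type*} {v : E → ℝ} {B : Finset E} (hB : B.Nonempty) {x : ℝ} (h : ∀ j ∈ B, x ≤ v j) : x ≤ minOn v B := by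
  rw [minOn, dif_pos hB]; exact Finset.le_inf' _ _ h

section
variable {E : Type*} [DecidableEq E]

/-- Discard the element with the smallest value as long as the mass exceeds 2; a single weight is at
most 1, so the mass never drops below 1. -/
theorem exists_top_subset (v w : E → ℝ) (hw1 : ∀ j, w j ≤ 1) (A : Finset E) (hA : 1 ≤ ∑ j ∈ A, w j) :
    ∃ B ⊆ A, 1 ≤ ∑ j ∈ B, w j ∧ ∑ j ∈ B, w j ≤ 2 ∧ ∀ i ∈ B, ∀ j ∈ A, j ∉ B → v j ≤ v i := by
  induction hc : A.card using Nat.strong_induction_on generalizing A with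
  | _ m ih =>
    by_cases h2 : ∑ j ∈ A, w j ≤ 2
    · exact ⟨A, subset_rfl, hA, h2, fun i _ j hj hj' => absurd hj hj'⟩
    · push Not at h2
      have hne : A.Nonempty := by
        by_contra h
        rw [Finset.not_nonempty_iff_eq_empty] at h
        simp [h] at hA
        linarith
      obtain ⟨x, hx, hmin⟩ := Finset.exists_min_image A v hne
      have hs := Finset.add_sum_erase A w hx
      obtain ⟨B, hB, h3, h4, h5⟩ := ih (A.erase x).card (by rw [← hc]; exact Finset.card_erase_lt_of_mem hx)
        (A.erase x) (by linarith [hw1 x]) rfl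
      refine ⟨B, hB.trans (Finset.erase_subset _ _), h3, h4, fun i hi j hj hj' => ?_⟩
      by_cases hjx : j = x
      · rw [hjx]; exact hmin i (Finset.mem_of_mem_erase (hB hi))
      · exact h5 i hi j (Finset.mem_erase.2 ⟨hjx, hj⟩) hj'

/-- Peel off top blocks of mass in [1, 2]. The values in a block are at most the minimum of the
preceding block (M for the first), so shifting the index by one bounds the weighted sum by twice M
plus the block minima. The remainder of mass below 1 is covered by the last minimum. -/
theorem exists_groups {v w : E → ℝ} (hv : ∀ j, 0 ≤ v j) (hw : ∀ j, 0 ≤ w j) (hw1 : ∀ j, w j ≤ 1) (A : Finset E)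
    {M : ℝ} (hM0 : 0 ≤ M) (hM : ∀ j ∈ A, v j ≤ M) :
    ∃ 𝒢 : Finset (Finset E), (∀ B ∈ 𝒢, ∀ B' ∈ 𝒢, B ≠ B' → Disjoint B B') ∧ (∀ B ∈ 𝒢, B ⊆ A ∧ 1 ≤ ∑ j ∈ B, w j) ∧
      ∑ j ∈ A, w j * v j ≤ 2 * (M + ∑ B ∈ 𝒢, minOn v B) ∧ ∑ j ∈ A, w j ≤ 2 * 𝒢.card + 1 ∧
      (𝒢.card : ℝ) ≤ ∑ j ∈ A, w j := by
  induction hc : A.card using Nat.strong_induction_on generalizing A M with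
  | _ m ih =>
    have hbd : ∀ (B : Finset E), B ⊆ A → ∑ j ∈ B, w j * v j ≤ (∑ j ∈ B, w j) * M := fun B hB => by
      rw [Finset.sum_mul]
      exact Finset.sum_le_sum fun j hj => mul_le_mul_of_nonneg_left (hM j (hB hj)) (hw j)
    by_cases h1 : 1 ≤ ∑ j ∈ A, w j
    · obtain ⟨B, hB, h3, h4, h5⟩ := exists_top_subset v w hw1 A h1
      have hne : B.Nonempty := by
        by_contra h
        rw [Finset.not_nonempty_iff_eq_empty] at h
        simp [h] at h3
        linarith
      obtain ⟨𝒢, g1, g2, g3, g4, g5⟩ := ih (A \ B).card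
        (by rw [← hc]; exact Finset.card_lt_card (Finset.sdiff_ssubset hB hne)) (A \ B)
        (minOn_nonneg hv B) (fun j hj => le_minOn hne fun i hi =>
          h5 i hi j (Finset.mem_sdiff.1 hj).1 (Finset.mem_sdiff.1 hj).2) rfl
      have hdisj : ∀ B' ∈ 𝒢, Disjoint B B' := fun B' hB' =>
        Finset.disjoint_of_subset_right (g2 B' hB').1 Finset.disjoint_sdiff
      have hnot : B ∉ 𝒢 := fun h => by
        have := hdisj B h
        rw [disjoint_self] at this
        exact hne.ne_empty this
      have hs1 := Finset.sum_sdiff (f := fun j => w j * v j) hB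
      have hs2 := Finset.sum_sdiff (f := w) hB
      have hBM : ∑ j ∈ B, w j * v j ≤ 2 * M :=
        (hbd B hB).trans (mul_le_mul_of_nonneg_right h4 hM0)
      refine ⟨insert B 𝒢, ?_, ?_, ?_, ?_, ?_⟩
      · intro B₁ h₁ B₂ h₂ hne'
        rw [Finset.mem_insert] at h₁ h₂
        rcases h₁ with rfl | h₁ <;> rcases h₂ with rfl | h₂
        · exact absurd rfl hne'
        · exact hdisj _ h₂
        · exact (hdisj _ h₁).symm
        · exact g1 _ h₁ _ h₂ hne'
      · intro B' h'
        rcases Finset.mem_insert.1 h' with rfl | h'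
        · exact ⟨hB, h3⟩
        · exact ⟨(g2 B' h').1.trans Finset.sdiff_subset, (g2 B' h').2⟩
      · rw [Finset.sum_insert hnot]; linarith
      · rw [Finset.card_insert_of_notMem hnot]; push_cast; linarith
      · rw [Finset.card_insert_of_notMem hnot]; push_cast; linarith
    · push Not at h1
      have := hbd A subset_rfl
      have hw0 : 0 ≤ ∑ j ∈ A, w j := Finset.sum_nonneg fun j _ => hw j
      refine ⟨∅, by simp, by simp, ?_, by simp; linarith, by simpa using hw0⟩
      simp only [Finset.sum_empty, add_zero]
      nlinarith

end

end AdaptiveSep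

/-! ### Exponential sampling weights and the ν₁ lower bound -/

namespace AdaptiveSep

variable {n p : ℕ}

/-- The sampling weights `|ξ_j| exp(-λ²/ξ_j²) / √(∑ ξ_i² exp(-λ²/ξ_i²))`. -/
noncomputable def expWeight (ξ : Fin p → ℝ) (l : ℝ) (j : Fin p) : ℝ :=
  |ξ j| * Real.exp (-l ^ 2 / ξ j ^ 2) / √(∑ i, ξ i ^ 2 * Real.exp (-l ^ 2 / ξ i ^ 2))

theorem expWeight_nonneg (ξ : Fin p → ℝ) (l : ℝ) (j : Fin p) : 0 ≤ expWeight ξ l j := by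
  unfold expWeight; positivity

theorem sum_filter_ne_zero (ξ : Fin p → ℝ) (f : Fin p → ℝ) (hf : ∀ j, ξ j = 0 → f j = 0) :
    ∑ j ∈ Finset.univ.filter (fun j => ξ j ≠ 0), f j = ∑ j, f j :=
  Finset.sum_filter_of_ne fun j _ h h' => h (hf j h')

theorem normalizer_pos {ξ : Fin p → ℝ} (hξ : ξ ≠ 0) (l : ℝ) : 0 < ∑ i, ξ i ^ 2 * Real.exp (-l ^ 2 / ξ i ^ 2) := by
  rw [← sum_filter_ne_zero ξ _ fun j h => by simp [h]]
  exact (profile_sums_pos hξ (l ^ 2)).2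

theorem expWeight_sq_mul {ξ : Fin p → ℝ} (hξ : ξ ≠ 0) (l : ℝ) (j : Fin p) :
    expWeight ξ l j ^ 2 * Real.exp (l ^ 2 / ξ j ^ 2) =
      ξ j ^ 2 * Real.exp (-l ^ 2 / ξ j ^ 2) / ∑ i, ξ i ^ 2 * Real.exp (-l ^ 2 / ξ i ^ 2) := by
  have h := normalizer_pos hξ l
  rw [expWeight, div_pow, Real.sq_sqrt h.le, mul_pow, sq_abs, div_mul_eq_mul_div]
  congr 1
  rw [mul_assoc, sq (Real.exp _), mul_assoc, ← Real.exp_add]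
  have : -l ^ 2 / ξ j ^ 2 + l ^ 2 / ξ j ^ 2 = 0 := by ring
  rw [this, Real.exp_zero, mul_one]

/-- The reason for the weights: a draw of coordinate j with entry of order λ/ξ_j costs w_j²
exp(λ²/ξ_j²) in χ², and this normalization makes the total cost equal to 1. -/
theorem sum_expWeight_sq_mul {ξ : Fin p → ℝ} (hξ : ξ ≠ 0) (l : ℝ) :
    ∑ j, expWeight ξ l j ^ 2 * Real.exp (l ^ 2 / ξ j ^ 2) = 1 := by
  simp only [expWeight_sq_mul hξ l, ← Finset.sum_div]
  exact div_self (normalizer_pos hξ l).ne'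

theorem expWeight_le_exp {ξ : Fin p → ℝ} (hξ : ξ ≠ 0) (l : ℝ) (j : Fin p) :
    expWeight ξ l j ≤ Real.exp (-(l ^ 2 / ξ j ^ 2) / 2) := by
  have h1 : expWeight ξ l j ^ 2 * Real.exp (l ^ 2 / ξ j ^ 2) ≤ 1 := by
    rw [← sum_expWeight_sq_mul hξ l]
    exact Finset.single_le_sum (f := fun j => expWeight ξ l j ^ 2 * Real.exp (l ^ 2 / ξ j ^ 2))
      (fun j _ => by positivity) (Finset.mem_univ j)
  refine abs_le_of_sq_le_sq' ?_ (Real.exp_pos _).le |>.2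
  rw [← Real.exp_nat_mul]
  have : ((2 : ℕ) : ℝ) * (-(l ^ 2 / ξ j ^ 2) / 2) = -(l ^ 2 / ξ j ^ 2) := by push_cast; ring
  rw [this, Real.exp_neg, ← one_div, le_div_iff₀ (Real.exp_pos _)]
  exact h1

theorem sum_expWeight_mul_abs {ξ : Fin p → ℝ} (hξ : ξ ≠ 0) (l : ℝ) :
    ∑ j, expWeight ξ l j * |ξ j| = √(∑ i, ξ i ^ 2 * Real.exp (-l ^ 2 / ξ i ^ 2)) := by
  have h := normalizer_pos hξ l
  have h1 : ∀ j, expWeight ξ l j * |ξ j| = ξ j ^ 2 * Real.exp (-l ^ 2 / ξ j ^ 2) /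
      √(∑ i, ξ i ^ 2 * Real.exp (-l ^ 2 / ξ i ^ 2)) := fun j => by
    rw [expWeight, ← sq_abs (ξ j)]; ring
  simp only [h1, ← Finset.sum_div]
  exact Real.div_sqrt

theorem sum_expWeight (ξ : Fin p → ℝ) (l : ℝ) : ∑ j, expWeight ξ l j = profile ξ (l ^ 2) := by
  unfold profile expWeight
  rw [sum_filter_ne_zero ξ _ fun j h => by simp [h], sum_filter_ne_zero ξ _ fun j h => by simp [h], Finset.sum_div]

theorem nu1_eq (ku : ℕ) {ξ : Fin p → ℝ} (hξ : ξ ≠ 0) :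
    nu1 ku ξ = lam ku ξ * ku + ∑ j, expWeight ξ (lam ku ξ) j * |ξ j| := by
  rw [sum_expWeight_mul_abs hξ, nu1, sum_filter_ne_zero ξ _ fun j h => by simp [h]]

/-- The profile is decreasing and λ² ≥ ζ, so truncating ζ at 0 can only reduce the mass k_u/2. -/
theorem sum_expWeight_lam_le {ku : ℕ} (hku : 1 ≤ ku) {ξ : Fin p → ℝ} (hξ : ξ ≠ 0) :
    ∑ j, expWeight ξ (lam ku ξ) j ≤ ku / 2 := by
  rw [sum_expWeight, lam, Real.sq_sqrt (le_max_right _ _), ← profile_zeta hku hξ]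
  exact (profile_strictAnti hξ).antitone (le_max_left _ _)

theorem sum_expWeight_lam_eq {ku : ℕ} (hku : 1 ≤ ku) {ξ : Fin p → ℝ} (hξ : ξ ≠ 0) (h : lam ku ξ ≠ 0) :
    ∑ j, expWeight ξ (lam ku ξ) j = ku / 2 := by
  have hz : 0 ≤ zeta ku ξ := by
    by_contra! h'
    exact h (by rw [lam, max_eq_right h'.le, Real.sqrt_zero])
  rw [sum_expWeight, lam, Real.sq_sqrt (le_max_right _ _), max_eq_left hz, profile_zeta hku hξ]

/-- Convexity of exp between 0 and x. It extracts the small factor b and leaves exp x to be absorbed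
by the weights. -/
theorem exp_mul_sub_one_le {b x : ℝ} (hb0 : 0 ≤ b) (hb1 : b ≤ 1) : Real.exp (b * x) - 1 ≤ b * Real.exp x := by
  have h := convexOn_exp.2 (Set.mem_univ x) (Set.mem_univ 0) hb0 (by linarith : 0 ≤ 1 - b) (by ring)
  simp only [smul_eq_mul, mul_zero, add_zero, Real.exp_zero, mul_one] at h
  linarith

set_option maxHeartbeats 1000000 in
-- The coordinates are grouped by `exists_groups`, with the largest one j₀ as an extra singleton
-- group. The group minima recover Σ w_j|ξ_j|, the square-root part of ν₁, and the number of groups,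
-- at least k_u/8 when λ ≠ 0, recovers λ k_u. Each of the two kinds of groups adds at most 3b to the
-- χ² exponent, hence the 6b in the hypothesis.
theorem le_tauAdap_nu1 {M₁ M₂ α η a t : ℝ} (hM₁ : 1 < M₁) (hM₂ : 0 < M₂) (hα : 0 ≤ α) {ku k : ℕ} (hk : 1 ≤ k)
    (hku : 12 ≤ ku) (hp : 2 ≤ p) (hn : 0 < n) (hL : ku * Real.log p ≤ n) {ξ : Fin p → ℝ} (hξ : IsLoading ξ)
    (t₀ : ℝ) (ha : 0 < a) (hb : 8 / M₂ ^ 2 * a ^ 2 ≤ 1) (haε : 24 * a ^ 2 ≤ ((1 - 1 / M₁) / 3) ^ 2 * M₂ ^ 2)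
    (ht : 0 < t) (htα : t < 1 - α - η) (hat : Real.exp (6 * (8 / M₂ ^ 2 * a ^ 2)) ≤ 1 + t ^ 2) :
    ENNReal.ofReal (a / 10 * (nu1 ku ξ / √n)) ≤ tauAdap n M₁ M₂ α η ku k ξ t₀ := by
  classical
  obtain ⟨hξ0, hanti⟩ := hξ
  have hn' : (0 : ℝ) < n := by exact_mod_cast hn
  set L := Real.log p with hLdef
  have hp' : (2 : ℝ) ≤ p := by exact_mod_cast hp
  have hL2 : 1 / 2 ≤ L := by
    have := Real.log_le_log (by norm_num) hp'
    have := Real.log_two_gt_d9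
    linarith
  set l := lam ku ξ with hl
  have hl0 : 0 ≤ l := Real.sqrt_nonneg _
  set b := 8 / M₂ ^ 2 * a ^ 2 with hbdef
  have hb0 : 0 ≤ b := by positivity
  let j₀ : Fin p := ⟨0, by omega⟩
  have hmax : ∀ j, |ξ j| ≤ |ξ j₀| := fun j => hanti (Fin.mk_le_of_le_val (Nat.zero_le _))
  have hj₀ : ξ j₀ ≠ 0 := fun h => hξ0 (funext fun j => by
    have := hmax j
    rw [h, abs_zero] at this
    exact abs_nonpos_iff.1 this)
  let w := expWeight ξ l
  have hw : ∀ j, 0 ≤ w j := expWeight_nonneg ξ l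
  have hw1 : ∀ j, w j ≤ 1 := fun j => (expWeight_le_exp hξ0 l j).trans (by
    rw [Real.exp_le_one_iff, neg_div, neg_nonpos]; positivity)
  -- Coordinates with λ² > 4 ξ_j² log p would require too large entries. Each carries weight at most
  -- 1/p, so dropping them loses mass at most 1.
  let A : Finset (Fin p) := Finset.univ.filter fun j => j ≠ j₀ ∧ ξ j ≠ 0 ∧ l ^ 2 ≤ 4 * L * ξ j ^ 2
  have hA : ∀ {j}, j ∈ A ↔ j ≠ j₀ ∧ ξ j ≠ 0 ∧ l ^ 2 ≤ 4 * L * ξ j ^ 2 := fun {j} => by simp [A]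
  have hj₀A : j₀ ∉ A := fun h => (hA.1 h).1 rfl
  have hbad : ∑ j ∈ Finset.univ \ insert j₀ A, w j ≤ 1 := by
    have h1 : ∀ j ∈ Finset.univ \ insert j₀ A, w j ≤ 1 / p := fun j hj => by
      rw [Finset.mem_sdiff, Finset.mem_insert, not_or, hA] at hj
      obtain ⟨-, hjj, hj⟩ := hj
      by_cases h0 : ξ j = 0
      · have : w j = 0 := by simp [w, expWeight, h0]
        rw [this]; positivity
      · have h2 : 4 * L * ξ j ^ 2 < l ^ 2 := by
          by_contra! h; exact hj ⟨hjj, h0, h⟩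
        refine (expWeight_le_exp hξ0 l j).trans ?_
        have h3 : 4 * L ≤ l ^ 2 / ξ j ^ 2 := by
          rw [le_div_iff₀ (by positivity)]; exact h2.le
        have h4 : (1 : ℝ) / p = Real.exp (-L) := by
          rw [Real.exp_neg, hLdef, Real.exp_log (by linarith), one_div]
        rw [h4]
        exact Real.exp_le_exp.2 (by linarith)
    refine (Finset.sum_le_card_nsmul _ _ _ h1).trans ?_
    rw [nsmul_eq_mul, mul_one_div, div_le_one (by linarith)]
    have := Finset.card_le_univ (Finset.univ \ insert j₀ A)
    rw [Fintype.card_fin] at this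
    exact_mod_cast this
  have hsplit : ∀ f : Fin p → ℝ, ∑ j, f j = ∑ j ∈ Finset.univ \ insert j₀ A, f j + (f j₀ + ∑ j ∈ A, f j) := fun f => by
    rw [← Finset.sum_insert hj₀A, Finset.sum_sdiff (Finset.subset_univ _)]
  obtain ⟨𝒢, g1, g2, g3, g4, g5⟩ := exists_groups (v := fun j => |ξ j|) (fun j => abs_nonneg _) hw hw1 A
    (abs_nonneg (ξ j₀)) fun j _ => hmax j
  have hku' : (12 : ℝ) ≤ ku := by exact_mod_cast hku
  have hsumle := sum_expWeight_lam_le (by omega : 1 ≤ ku) hξ0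
  have hcard : (𝒢.card : ℝ) ≤ ku / 2 := by
    have h1 := hsplit w
    have h2 : 0 ≤ ∑ j ∈ Finset.univ \ insert j₀ A, w j := Finset.sum_nonneg fun j _ => hw j
    linarith [hw j₀]
  let G : Option 𝒢 → Finset (Fin p) := fun o => o.elim {j₀} fun B => B.1
  -- The maximum serves both parts of ν₁. For j in the block it still satisfies κ²/ξ_j² ≤ a²(λ²/ξ_j²
  -- + 1), the extra 1 costing only a factor e ≤ 3.
  let κ : Option 𝒢 → ℝ := fun o => o.elim (a * |ξ j₀|) fun B => a * max l (minOn (fun j => |ξ j|) B.1)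
  let W : Option 𝒢 → Fin p → ℝ := fun o j => o.elim 1 fun B => w j / ∑ i ∈ B.1, w i
  let r : Option 𝒢 → ℝ := fun o => o.elim (3 * b) fun B => 3 * b * ∑ j ∈ B.1, w j ^ 2 * Real.exp (l ^ 2 / ξ j ^ 2)
  have hmass : ∀ B : 𝒢, 1 ≤ ∑ i ∈ B.1, w i := fun B => (g2 B.1 B.2).2
  have he3 : Real.exp 1 ≤ 3 := Real.exp_one_lt_three.le
  have hratio : ∀ (B : 𝒢), ∀ j ∈ B.1, max l (minOn (fun j => |ξ j|) B.1) ^ 2 / ξ j ^ 2 ≤ l ^ 2 / ξ j ^ 2 + 1 :=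
    fun B j hj => by
      have hjA := hA.1 ((g2 B.1 B.2).1 hj)
      have hpos : 0 < ξ j ^ 2 := by have := hjA.2.1; positivity
      rw [div_add_one hpos.ne']
      refine div_le_div_of_nonneg_right ?_ hpos.le
      rcases max_choice l (minOn (fun j => |ξ j|) B.1) with h | h <;> rw [h]
      · linarith
      · have h1 := pow_le_pow_left₀ (minOn_nonneg (fun j => abs_nonneg (ξ j)) B.1) (minOn_le hj) 2
        rw [sq_abs] at h1
        nlinarith [sq_nonneg l]
  have hsumκ : ∑ g, κ g = a * (|ξ j₀| + ∑ B ∈ 𝒢, max l (minOn (fun j => |ξ j|) B)) := by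
    rw [Fintype.sum_option, mul_add, Finset.mul_sum]
    congr 1
    exact Finset.sum_coe_sort 𝒢 fun B => a * max l (minOn (fun j => |ξ j|) B)
  have hnu : nu1 ku ξ ≤ 10 * (|ξ j₀| + ∑ B ∈ 𝒢, max l (minOn (fun j => |ξ j|) B)) := by
    rw [nu1_eq ku hξ0, ← hl]
    have h1 : ∑ j, w j * |ξ j| ≤ 4 * |ξ j₀| + 2 * ∑ B ∈ 𝒢, max l (minOn (fun j => |ξ j|) B) := by
      rw [hsplit fun j => w j * |ξ j|]
      have h2 : ∑ j ∈ Finset.univ \ insert j₀ A, w j * |ξ j| ≤ 1 * |ξ j₀| := by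
        refine le_trans (Finset.sum_le_sum fun j _ => mul_le_mul_of_nonneg_left (hmax j) (hw j)) ?_
        rw [← Finset.sum_mul]
        exact mul_le_mul_of_nonneg_right hbad (abs_nonneg _)
      have h3 : w j₀ * |ξ j₀| ≤ 1 * |ξ j₀| := mul_le_mul_of_nonneg_right (hw1 j₀) (abs_nonneg _)
      have h4 : ∑ B ∈ 𝒢, minOn (fun j => |ξ j|) B ≤ ∑ B ∈ 𝒢, max l (minOn (fun j => |ξ j|) B) :=
        Finset.sum_le_sum fun B _ => le_max_right _ _
      linarith
    have h5 : l * ku ≤ 8 * ∑ B ∈ 𝒢, max l (minOn (fun j => |ξ j|) B) := by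
      have h6 : l * 𝒢.card ≤ ∑ B ∈ 𝒢, max l (minOn (fun j => |ξ j|) B) := by
        have := Finset.card_nsmul_le_sum 𝒢 (fun B => max l (minOn (fun j => |ξ j|) B)) l fun B _ => le_max_left _ _
        rwa [nsmul_eq_mul, mul_comm] at this
      rcases eq_or_ne l 0 with h | h
      · rw [h, zero_mul] at h6 ⊢
        rw [h] at *
        linarith
      · have h7 : ∑ j, w j = ku / 2 := sum_expWeight_lam_eq (by omega : 1 ≤ ku) hξ0 h
        have h8 := hsplit w
        -- The mass of A is at least k_u/2 - 2 and at most 2 card + 1, so card ≥ k_u/4 - 3/2, which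
        -- is at least k_u/8 once k_u ≥ 12.
        have h9 : (ku : ℝ) ≤ 8 * 𝒢.card := by linarith [hw1 j₀]
        calc l * ku ≤ l * (8 * 𝒢.card) := mul_le_mul_of_nonneg_left h9 hl0
          _ ≤ _ := by linarith
    have := abs_nonneg (ξ j₀)
    change l * ku + ∑ j, w j * |ξ j| ≤ _
    linarith
  refine le_trans (ENNReal.ofReal_le_ofReal ?_) (le_tauAdap_of_groups hM₁ hM₂ hα (n := n) (ξ := ξ) (t₀ := t₀) hk hj₀ hn (G := G)
    (κ := κ) (w := W) (r := r) (K := a ^ 2 * (4 * L + 1)) ?_ ?_ ?_ ?_ ?_ ?_ ?_ ?_ ht htα ?_)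
  · rw [hsumκ, mul_div_assoc', div_le_div_iff_of_pos_right (Real.sqrt_pos.2 hn')]
    calc a / 10 * nu1 ku ξ ≤ a / 10 * (10 * (|ξ j₀| + ∑ B ∈ 𝒢, max l (minOn (fun j => |ξ j|) B))) :=
          mul_le_mul_of_nonneg_left hnu (by positivity)
      _ = _ := by ring
  · rintro (_ | B) (_ | B') h
    · exact absurd rfl h
    · exact Finset.disjoint_singleton_left.2 fun hh => hj₀A ((g2 B'.1 B'.2).1 hh)
    · exact Finset.disjoint_singleton_right.2 fun hh => hj₀A ((g2 B.1 B.2).1 hh)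
    · exact g1 B.1 B.2 B'.1 B'.2 fun e => h (by rw [Subtype.ext e])
  · rintro (_ | B) j hj
    · rw [Finset.mem_singleton.1 hj]; exact hj₀
    · exact (hA.1 ((g2 B.1 B.2).1 hj)).2.1
  · rintro (_ | B) j
    · exact zero_le_one
    · exact div_nonneg (hw j) (zero_le_one.trans (hmass B))
  · rintro (_ | B)
    · simp [G, W]
    · simp only [G, W, Option.elim, ← Finset.sum_div]
      exact div_self (by linarith [hmass B])
  · rintro (_ | B)
    · have h1 : a ^ 2 * ξ j₀ ^ 2 / ξ j₀ ^ 2 = a ^ 2 := by field_simp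
      simp only [G, W, κ, r, Option.elim, Finset.sum_singleton, mul_pow, sq_abs, h1, one_pow, one_mul]
      have := exp_mul_sub_one_le (x := 1) hb0 hb
      rw [mul_one] at this
      nlinarith
    · simp only [G, W, κ, r, Option.elim, Finset.mul_sum]
      refine Finset.sum_le_sum fun j hj => ?_
      have h1 : (w j / ∑ i ∈ B.1, w i) ^ 2 ≤ w j ^ 2 :=
        pow_le_pow_left₀ (div_nonneg (hw j) (zero_le_one.trans (hmass B))) (div_le_self (hw j) (hmass B)) 2
      have h2 : Real.exp (8 / M₂ ^ 2 * ((a * max l (minOn (fun j => |ξ j|) B.1)) ^ 2 / ξ j ^ 2)) - 1 ≤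
          b * (3 * Real.exp (l ^ 2 / ξ j ^ 2)) := by
        have e : 8 / M₂ ^ 2 * ((a * max l (minOn (fun j => |ξ j|) B.1)) ^ 2 / ξ j ^ 2) =
            b * (max l (minOn (fun j => |ξ j|) B.1) ^ 2 / ξ j ^ 2) := by rw [hbdef, mul_pow]; ring
        rw [e]
        refine (exp_mul_sub_one_le hb0 hb).trans (mul_le_mul_of_nonneg_left ?_ hb0)
        refine (Real.exp_le_exp.2 (hratio B j hj)).trans ?_
        rw [Real.exp_add, mul_comm]
        exact mul_le_mul_of_nonneg_right he3 (Real.exp_pos _).le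
      have h3 : 0 ≤ Real.exp (8 / M₂ ^ 2 * ((a * max l (minOn (fun j => |ξ j|) B.1)) ^ 2 / ξ j ^ 2)) - 1 := by
        rw [sub_nonneg]; exact Real.one_le_exp (by positivity)
      calc _ ≤ w j ^ 2 * (b * (3 * Real.exp (l ^ 2 / ξ j ^ 2))) := mul_le_mul h1 h2 h3 (sq_nonneg _)
        _ = _ := by ring
  · rintro (_ | B) j hj
    · rw [Finset.mem_singleton.1 hj]
      simp only [κ, Option.elim, mul_pow, sq_abs]
      rw [mul_div_assoc, div_self (pow_ne_zero 2 hj₀)]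
      exact mul_le_mul_of_nonneg_left (by linarith) (sq_nonneg a)
    · simp only [κ, Option.elim, mul_pow, mul_div_assoc]
      refine mul_le_mul_of_nonneg_left ((hratio B j hj).trans ?_) (sq_nonneg a)
      have hjA := hA.1 ((g2 B.1 B.2).1 hj)
      have hpos : 0 < ξ j ^ 2 := by have := hjA.2.1; positivity
      have : l ^ 2 / ξ j ^ 2 ≤ 4 * L := by rw [div_le_iff₀ hpos]; exact hjA.2.2
      linarith
  · rw [Fintype.card_option, Fintype.card_coe]
    push_cast
    have h1 : (𝒢.card + 1 : ℝ) ≤ ku := by linarith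
    have h2 : (𝒢.card + 1 : ℝ) * (a ^ 2 * (4 * L + 1)) ≤ ku * (a ^ 2 * (6 * L)) := by
      gcongr
      linarith
    have h3 : 4 * ((𝒢.card + 1 : ℝ) * (a ^ 2 * (4 * L + 1) / n)) ≤ 24 * a ^ 2 := by
      rw [mul_div_assoc', mul_div_assoc', div_le_iff₀ hn']
      have : a ^ 2 * (ku * L) ≤ a ^ 2 * n := mul_le_mul_of_nonneg_left hL (sq_nonneg a)
      calc 4 * ((𝒢.card + 1 : ℝ) * (a ^ 2 * (4 * L + 1))) ≤ 4 * (ku * (a ^ 2 * (6 * L))) := by linarith only [h2]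
        _ = 24 * (a ^ 2 * (ku * L)) := by ring
        _ ≤ 24 * (a ^ 2 * n) := by linarith only [this]
        _ = 24 * a ^ 2 * n := by ring
    exact h3.trans haε
  · rw [Fintype.card_option, Fintype.card_coe]
    have : (𝒢.card + 1 + 1 : ℝ) ≤ ku := by linarith
    exact_mod_cast this
  · refine le_trans (Real.exp_le_exp.2 ?_) hat
    rw [Fintype.sum_option]
    simp only [r, Option.elim]
    rw [Finset.sum_coe_sort 𝒢 fun B => 3 * b * ∑ j ∈ B, w j ^ 2 * Real.exp (l ^ 2 / ξ j ^ 2), ← Finset.mul_sum]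
    have h1 : ∑ B ∈ 𝒢, ∑ j ∈ B, w j ^ 2 * Real.exp (l ^ 2 / ξ j ^ 2) ≤ 1 := by
      rw [← sum_expWeight_sq_mul hξ0 l, ← Finset.sum_biUnion (t := fun B => B) fun B hB B' hB' h => g1 B hB B' hB' h]
      exact Finset.sum_le_sum_of_subset_of_nonneg (Finset.subset_univ _) fun j _ _ => by positivity
    have h2 : 3 * b * ∑ B ∈ 𝒢, ∑ j ∈ B, w j ^ 2 * Real.exp (l ^ 2 / ξ j ^ 2) ≤ 3 * b * 1 :=
      mul_le_mul_of_nonneg_left h1 (by positivity)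
    linarith

end AdaptiveSep

/-! ### The ν₂ lower bound -/

namespace AdaptiveSep

variable {n p : ℕ}

theorem exists_unit_orthogonal (x y : ℝ) : ∃ c s : ℝ, c ^ 2 + s ^ 2 = 1 ∧ x * c + y * s = 0 := by
  by_cases h : x ^ 2 + y ^ 2 = 0
  · have hx : x = 0 := by nlinarith [sq_nonneg x, sq_nonneg y]
    have hy : y = 0 := by nlinarith [sq_nonneg x, sq_nonneg y]
    exact ⟨1, 0, by norm_num, by rw [hx, hy]; ring⟩
  · have hpos : 0 < x ^ 2 + y ^ 2 := lt_of_le_of_ne (by positivity) (Ne.symm h)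
    refine ⟨y / √(x ^ 2 + y ^ 2), -x / √(x ^ 2 + y ^ 2), ?_, by ring⟩
    rw [div_pow, div_pow, Real.sq_sqrt hpos.le]
    field_simp
    ring

theorem l0_smul_le (x : ℝ) (v : Fin p → ℝ) : l0 (x • v) ≤ l0 v := by
  unfold l0
  refine Finset.card_le_card fun j hj => ?_
  simp only [Finset.mem_filter, Finset.mem_univ, true_and, Pi.smul_apply, smul_eq_mul] at hj ⊢
  exact right_ne_zero_of_mul hj

theorem card_filter_val_lt {m : ℕ} (hm : m ≤ p) : (Finset.univ.filter fun j : Fin p => (j : ℕ) < m).card = m := by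
  rw [Fin.card_filter_val_lt, min_eq_right hm]

theorem l0_le_of_support {m : ℕ} (hm : m ≤ p) {v : Fin p → ℝ} (hv : ∀ j : Fin p, m ≤ j → v j = 0) : l0 v ≤ m := by
  rw [← card_filter_val_lt hm]
  refine Finset.card_le_card fun j hj => ?_
  simp only [Finset.mem_filter, Finset.mem_univ, true_and] at hj ⊢
  by_contra! h
  exact hj (hv j h)

theorem head_dot_head (ξ : Fin p → ℝ) (m : ℕ) :
    head ξ m ⬝ᵥ head ξ m = ∑ j ∈ Finset.univ.filter (fun j : Fin p => (j : ℕ) < m), ξ j ^ 2 := by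
  rw [Finset.sum_filter]
  exact Finset.sum_congr rfl fun j _ => by simp only [head]; split_ifs <;> ring

theorem dot_head (ξ : Fin p → ℝ) (m : ℕ) : ξ ⬝ᵥ head ξ m = head ξ m ⬝ᵥ head ξ m :=
  Finset.sum_congr rfl fun j _ => by simp only [head]; split_ifs <;> ring

/-- The added entries are at most as many as the first m and none is larger than the m-th, so they
at most double the sum of squares. -/
theorem sum_head_le {ξ : Fin p → ℝ} (hξ : Antitone fun j => |ξ j|) {m k : ℕ} (hmk : m ≤ k) (hk : k ≤ 2 * m) (hkp : k ≤ p) :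
    head ξ k ⬝ᵥ head ξ k ≤ 2 * (head ξ m ⬝ᵥ head ξ m) := by
  rcases Nat.eq_zero_or_pos m with h0 | h0
  · have : k = m := by omega
    rw [this]; linarith [dot_self_nonneg (head ξ m)]
  rw [head_dot_head, head_dot_head]
  set S := Finset.univ.filter fun j : Fin p => (j : ℕ) < m with hS
  set S' := Finset.univ.filter fun j : Fin p => (j : ℕ) < k with hS'
  have hsub : S ⊆ S' := fun j hj => by
    simp only [hS, hS', Finset.mem_filter, Finset.mem_univ, true_and] at hj ⊢; omega
  set x := ξ ⟨m - 1, by omega⟩ ^ 2 with hx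
  have h1 : ∀ j ∈ S, x ≤ ξ j ^ 2 := fun j hj => by
    simp only [hS, Finset.mem_filter, Finset.mem_univ, true_and] at hj
    exact sq_le_sq.2 (hξ (Fin.le_def.2 (by simp only; omega)))
  have h2 : ∀ j ∈ S' \ S, ξ j ^ 2 ≤ x := fun j hj => by
    simp only [hS, hS', Finset.mem_sdiff, Finset.mem_filter, Finset.mem_univ, true_and] at hj
    exact sq_le_sq.2 (hξ (Fin.le_def.2 (by simp only; omega)))
  have h3 := Finset.card_nsmul_le_sum S _ _ h1
  have h4 := Finset.sum_le_card_nsmul (S' \ S) _ _ h2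
  have hcS : S.card = m := card_filter_val_lt (by omega)
  have hcS' : S'.card = k := card_filter_val_lt hkp
  rw [Finset.card_sdiff_of_subset hsub, hcS, hcS'] at h4
  rw [hcS] at h3
  have h5 : (k - m) • x ≤ m • x := nsmul_le_nsmul_left (sq_nonneg _) (by omega)
  rw [← Finset.sum_sdiff hsub]
  linarith

/-- The sheared design hides d, a sum of s orthogonal vectors of squared length a² log p / n, each
drawn uniformly from M candidates. As d is orthogonal to ξ and to its head, ξ·β moves only through
the regression coefficient along the head, of order |d|² = s a² log p / n. Sharing one of the s
vectors costs a factor p^(2a²) against the probability 1/M. -/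
theorem le_tauAdap_nu2 {M₁ M₂ α η a t : ℝ} (hM₁ : 1 < M₁) (hM₂ : 0 < M₂) (hα : 0 ≤ α) {ku k s M : ℕ} (hk : 1 ≤ k)
    (hs : 1 ≤ s) (hs4 : 4 * s ≤ ku) (hs8 : ku ≤ 8 * s) (hM : 1 ≤ M) (hMp : ku + 2 * (s * M) ≤ p)
    (hn : 0 < n) (hL : ku * Real.log p ≤ n) {ξ : Fin p → ℝ} (hξ : IsLoading ξ)
    (t₀ : ℝ) (ha : a ^ 2 ≤ ((1 - 1 / M₁) / 3) ^ 2)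
    (ht : 0 < t) (htα : t < 1 - α - η) (hat : Real.exp (s * (Real.exp (2 * a ^ 2 * Real.log p) / M)) ≤ 1 + t ^ 2) :
    ENNReal.ofReal (M₂ * a ^ 2 / 64 * (nu2 ku ξ * (ku * Real.log p / n))) ≤ tauAdap n M₁ M₂ α η ku k ξ t₀ := by
  classical
  obtain ⟨hξ0, hanti⟩ := hξ
  have hn' : (0 : ℝ) < n := by exact_mod_cast hn
  have hM' : (1 : ℝ) ≤ M := by exact_mod_cast hM
  have hs' : (1 : ℝ) ≤ s := by exact_mod_cast hs
  set L := Real.log p with hLdef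
  have hL0 : 0 ≤ L := Real.log_natCast_nonneg p
  have hi1 : 1 / M₁ < 1 := by rw [div_lt_one (by linarith)]; exact hM₁
  have hi0 : 0 < 1 / M₁ := by positivity
  -- The budget k_u is split into m head coordinates and 2s coordinates for d. Since 4s ≤ k_u, m is
  -- at least k_u/2, so the head keeps at least half of the squared norm `nu2`².
  set m := ku - 2 * s with hm
  let j₀ : Fin p := ⟨0, by omega⟩
  have hj₀ : ξ j₀ ≠ 0 := fun h => hξ0 (funext fun j => by
    have : |ξ j| ≤ |ξ j₀| := hanti (Fin.mk_le_of_le_val (Nat.zero_le _))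
    rw [h, abs_zero] at this
    exact abs_nonpos_iff.1 this)
  set H2 := head ξ m ⬝ᵥ head ξ m with hH2
  have hH : 0 < H2 := dot_self_pos fun h => hj₀ (by
    have := congrFun h j₀
    simpa [head, j₀, show 0 < m by omega] using this)
  -- the pairs
  have hcard : Fintype.card ((Fin s × Fin M) × Fin 2) ≤ Fintype.card (Fin (p - m)) := by
    simp only [Fintype.card_prod, Fintype.card_fin]; omega
  obtain ⟨f⟩ := Function.Embedding.nonempty_of_card_le hcard
  let idx : (Fin s × Fin M) × Fin 2 → Fin p := fun x => ⟨m + f x, by have := (f x).2; omega⟩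
  have hidx : Function.Injective idx := fun x y h => f.injective (Fin.ext (by
    have := congrArg Fin.val h
    simp only [idx] at this
    omega))
  have hidxm : ∀ x, m ≤ (idx x : ℕ) := fun x => Nat.le_add_right _ _
  -- Two coordinates per candidate leave one degree of freedom, spent on making it orthogonal to ξ.
  choose e₁ e₂ he heξ using fun x : Fin s × Fin M => exists_unit_orthogonal (ξ (idx (x, 0))) (ξ (idx (x, 1)))
  let v : Fin s × Fin M → Fin p → ℝ := fun x => Pi.single (idx (x, 0)) (e₁ x) + Pi.single (idx (x, 1)) (e₂ x)
  have hvv : ∀ x, v x ⬝ᵥ v x = 1 := fun x => by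
    have h1 : idx (x, 1) ≠ idx (x, 0) := fun h => by simpa using hidx h
    simp only [v, add_dotProduct, single_dotProduct, Pi.add_apply, Pi.single_eq_same, Pi.single_eq_of_ne h1,
      Pi.single_eq_of_ne h1.symm]
    rw [← he x]; ring
  have hvv' : ∀ x y, x ≠ y → v x ⬝ᵥ v y = 0 := fun x y h => by
    have h1 : ∀ i j, idx (x, i) ≠ idx (y, j) := fun i j hh => h (congrArg Prod.fst (hidx hh))
    have h2 : ∀ i j, idx (y, j) ≠ idx (x, i) := fun i j => (h1 i j).symm
    simp [v, h2]
  have hξv : ∀ x, ξ ⬝ᵥ v x = 0 := fun x => by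
    simp only [v, dotProduct_add, dotProduct_single]; exact heξ x
  have hhv : ∀ x, head ξ m ⬝ᵥ v x = 0 := fun x => by
    have h1 : ∀ i, head ξ m (idx (x, i)) = 0 := fun i => if_neg (by have := hidxm (x, i); omega)
    simp [v, dotProduct_add, dotProduct_single, h1]
  have hlv : ∀ x, l0 (v x) ≤ 2 := fun x => (l0_add_le _ _).trans (add_le_add (l0_single_le _ _) (l0_single_le _ _))
  set ρ := a * √(L / n) with hρ
  have hρ2 : ρ ^ 2 = a ^ 2 * (L / n) := by rw [hρ, mul_pow, Real.sq_sqrt (by positivity)]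
  let u : Fin s → Fin M → Fin p → ℝ := fun g c => ρ • v (g, c)
  let d : (Fin s → Fin M) → Fin p → ℝ := fun J => ∑ g, u g (J g)
  have hdd : ∀ J J', d J ⬝ᵥ d J' = ∑ g, if J g = J' g then ρ ^ 2 else 0 := fun J J' => by
    simp only [d]
    rw [dot_sum_orthogonal (C := fun _ : Fin s => Fin M)]
    · simp only [u, smul_dotProduct, dotProduct_smul, smul_eq_mul, hvv, mul_one, sq]
    · intro g c g' c' h
      simp only [u, smul_dotProduct, dotProduct_smul, smul_eq_mul]
      rw [hvv' _ _ fun hh => h (congrArg Prod.fst hh)]; simp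
    · intro g c c' h
      simp only [u, smul_dotProduct, dotProduct_smul, smul_eq_mul]
      rw [hvv' _ _ fun hh => h (congrArg Prod.snd hh)]; simp
  have hdd0 : ∀ J J', 0 ≤ d J ⬝ᵥ d J' := fun J J' => by
    rw [hdd]
    exact Finset.sum_nonneg fun g _ => by split_ifs <;> positivity
  -- All draws have the same squared norm D by orthogonality, so they share the shift of ξ·β and the
  -- noise level.
  set D := s * ρ ^ 2 with hD
  have hdD : ∀ J, d J ⬝ᵥ d J = D := fun J => by
    rw [hdd]; simp [hD]
  have hD0 : 0 ≤ D := by positivity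
  have hku' : (s : ℝ) ≤ ku := by exact_mod_cast (by omega : s ≤ ku)
  have hDa : D ≤ a ^ 2 := by
    rw [hD, hρ2]
    have : (s : ℝ) * L ≤ n := (mul_le_mul_of_nonneg_right hku' hL0).trans hL
    calc (s : ℝ) * (a ^ 2 * (L / n)) = a ^ 2 * (s * L / n) := by ring
      _ ≤ a ^ 2 * 1 := mul_le_mul_of_nonneg_left ((div_le_one hn').2 this) (sq_nonneg a)
      _ = a ^ 2 := mul_one _
  have ha1 : a ^ 2 ≤ 1 := ha.trans (pow_le_one₀ (by linarith) (by linarith))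
  have hξd : ∀ J, ξ ⬝ᵥ d J = 0 := fun J => by
    simp only [d, dotProduct_sum]
    exact Finset.sum_eq_zero fun g _ => by simp [u, hξv]
  have hhd : ∀ J, head ξ m ⬝ᵥ d J = 0 := fun J => by
    simp only [d, dotProduct_sum]
    exact Finset.sum_eq_zero fun g _ => by simp [u, hhv]
  have hld : ∀ J, l0 (d J) ≤ s * 2 := fun J => by
    have := l0_sum_le Finset.univ (fun g => u g (J g)) (m := 2) fun g _ => (l0_smul_le _ _).trans (hlv _)
    simpa using this
  -- the shear
  set c := √(1 / 2 : ℝ) with hc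
  have hc2 : c ^ 2 = 1 / 2 := Real.sq_sqrt (by norm_num)
  have hc0 : 0 ≤ c := Real.sqrt_nonneg _
  -- Of the unit vector g = (c, A), half of the squared norm lies on the noise and half along the
  -- head of ξ; both are needed, since the shift of ξ·β is proportional to c · (ξ·A).
  set A : Fin p → ℝ := (c / √H2) • head ξ m with hA
  have hAA : c ^ 2 + A ⬝ᵥ A = 1 := by
    simp only [hA, smul_dotProduct, dotProduct_smul, smul_eq_mul, ← hH2]
    have : c / √H2 * (c / √H2 * H2) = c ^ 2 * (H2 / √H2 ^ 2) := by ring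
    rw [this, Real.sq_sqrt hH.le, div_self hH.ne', hc2]; norm_num
  have hξA : ξ ⬝ᵥ A = c * √H2 := by
    simp only [hA, dotProduct_smul, smul_eq_mul, dot_head, ← hH2]
    rw [div_mul_eq_mul_div, mul_div_assoc, Real.div_sqrt]
  -- T is exactly the decrease of ξ·β caused by the shear, so an alternative with functional t₀ + T
  -- becomes a null.
  set T := M₂ * (c * D / (1 + c ^ 2 * D) * (c * √H2)) with hT
  set β : Fin p → ℝ := Pi.single j₀ ((t₀ + T) / ξ j₀) with hβ
  have hξβ : ξ ⬝ᵥ β = t₀ + T := by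
    rw [hβ, dotProduct_single]; field_simp
  refine le_trans (ENNReal.ofReal_le_ofReal (q := T) ?_) (le_tauAdap_of_shear hM₁ hM₂ hα
    (q := fun _ : Fin s → Fin M => ∏ _g : Fin s, (1 / M : ℝ)) (β := β) (c := c) (a := A) (d := d)
    (fun J => by positivity) (sum_prod_weights (C := fun _ : Fin s => Fin M) (w := fun _ _ => (1 / M : ℝ)) fun g => ?_)
    ((l0_single_le _ _).trans hk) ?_ hAA (fun J => ?_) hdd0 (fun J => ?_)
    (fun J => ?_) (fun J => ?_) ht htα ?_)
  · have h1 : nu2 ku ξ ≤ √2 * √H2 := by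
      rw [nu2, topNorm, Nat.ceil_natCast, ← head_dot_head, ← Real.sqrt_mul (by norm_num)]
      exact Real.sqrt_le_sqrt (sum_head_le hanti (by omega) (by omega) (by omega))
    have h2 : √2 ≤ 2 := by
      rw [Real.sqrt_le_left (by norm_num)]; norm_num
    have hku8 : (ku : ℝ) ≤ 8 * s := by exact_mod_cast hs8
    have h3 : a ^ 2 * (ku * L / n) ≤ 8 * D := by
      rw [hD, hρ2]
      calc a ^ 2 * (ku * L / n) = ku * (a ^ 2 * (L / n)) := by ring
        _ ≤ 8 * s * (a ^ 2 * (L / n)) := mul_le_mul_of_nonneg_right hku8 (by positivity)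
        _ = _ := by ring
    have h4 : nu2 ku ξ ≤ 2 * √H2 := h1.trans (mul_le_mul_of_nonneg_right h2 (Real.sqrt_nonneg _))
    have h5 : T = M₂ * (D / (2 + D) * √H2) := by
      have : c * D / (1 + c ^ 2 * D) * (c * √H2) = c ^ 2 * D / (1 + c ^ 2 * D) * √H2 := by ring
      rw [hT, this, hc2]
      congr 2
      field_simp
    have h6 : D / 4 ≤ D / (2 + D) := div_le_div_of_nonneg_left hD0 (by linarith) (by linarith)
    rw [h5]
    calc M₂ * a ^ 2 / 64 * (nu2 ku ξ * (ku * L / n)) = M₂ / 64 * (nu2 ku ξ * (a ^ 2 * (ku * L / n))) := by ring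
      _ ≤ M₂ / 64 * (2 * √H2 * (8 * D)) := by gcongr
      _ = M₂ * (D / 4 * √H2) := by ring
      _ ≤ _ := by gcongr
  · simp only [Finset.sum_const, Finset.card_univ, Fintype.card_fin, nsmul_eq_mul]
    field_simp
  · rw [hξβ, add_sub_cancel_left]; exact le_abs_self T
  · rw [hA, smul_dotProduct, hhd, smul_zero]
  · rw [hdD]; exact hDa.trans ha
  -- The vector β and the A-component live on the first m coordinates, which contain j₀; d adds at
  -- most 2s.
  · simp only [shearParam, smul_add, ← add_assoc]
    refine (l0_add_le _ _).trans (le_trans (add_le_add (l0_le_of_support (m := m) (by omega) fun j hj => ?_)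
      ((l0_smul_le _ _).trans ((l0_smul_le _ _).trans (hld J)))) (by omega))
    have h1 : j ≠ j₀ := fun h => by
      have := congrArg Fin.val h
      simp only [j₀] at this
      omega
    have h2 : head ξ m j = 0 := if_neg (by omega)
    simp [hβ, hA, h1, h2]
  · simp only [shearParam, dotProduct_add, dotProduct_smul, smul_eq_mul, hξd, hdD, hξβ, hξA, hT]
    ring
  · refine le_trans (le_of_eq ?_) ((sum_prior_exp_le (C := fun _ : Fin s => Fin M) (w := fun _ _ => (1 / M : ℝ))
      (y := fun _ _ => 2 * a ^ 2 * L) (r := fun _ => Real.exp (2 * a ^ 2 * L) / M) (fun _ _ => by positivity)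
      (fun g => ?_) fun g => ?_).trans ?_)
    · refine Finset.sum_congr rfl fun J _ => Finset.sum_congr rfl fun J' _ => ?_
      congr 2
      rw [hdd, Finset.mul_sum]
      refine Finset.sum_congr rfl fun g _ => ?_
      rw [hρ2]
      split_ifs
      · field_simp
      · simp
    · simp only [Finset.sum_const, Finset.card_univ, Fintype.card_fin, nsmul_eq_mul]
      field_simp
    · simp only [Finset.sum_const, Finset.card_univ, Fintype.card_fin, nsmul_eq_mul]
      have : (M : ℝ) * ((1 / M) ^ 2 * (Real.exp (2 * a ^ 2 * L) - 1)) = (Real.exp (2 * a ^ 2 * L) - 1) / M := by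
        field_simp
      rw [this]
      exact div_le_div_of_nonneg_right (by linarith) (by positivity)
    · rwa [Finset.sum_const, Finset.card_univ, Fintype.card_fin, nsmul_eq_mul]

end AdaptiveSep

/-! ### Dimension counting in the sparse regime -/

namespace AdaptiveSep

theorem nu1_nonneg {p : ℕ} (ku : ℕ) (ξ : Fin p → ℝ) : 0 ≤ nu1 ku ξ := by
  unfold nu1 lam; positivity

theorem nu2_nonneg {p : ℕ} (ku : ℕ) (ξ : Fin p → ℝ) : 0 ≤ nu2 ku ξ := Real.sqrt_nonneg _

theorem exists_pos_sq_le {x : ℝ} (hx : 0 < x) : ∃ a : ℝ, 0 < a ∧ a ^ 2 ≤ x :=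
  ⟨√x, Real.sqrt_pos.2 hx, (Real.sq_sqrt hx.le).le⟩

/-- Sparse regimes leave room for many disjoint blocks. -/
theorem exists_blocks {C₀ γ b u : ℝ} (hγ : γ < 1 / 2) (hb : b ≤ (1 - 2 * γ) / 2) (hu : 0 < u) :
    ∃ N : ℕ, ∀ p ku : ℕ, N ≤ p → 12 ≤ ku → (ku : ℝ) ≤ C₀ * (p : ℝ) ^ γ →
      ∃ s M : ℕ, 1 ≤ s ∧ 4 * s ≤ ku ∧ ku ≤ 8 * s ∧ 1 ≤ M ∧ ku + 2 * (s * M) ≤ p ∧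
        s * (Real.exp (b * Real.log p) / M) ≤ u := by
  have h1 : Filter.Tendsto (fun p : ℕ => 2 * C₀ * (p : ℝ) ^ (-(1 - γ))) Filter.atTop (nhds (2 * C₀ * 0)) :=
    ((tendsto_rpow_neg_atTop (by linarith : 0 < 1 - γ)).comp tendsto_natCast_atTop_atTop).const_mul _
  have h2 : Filter.Tendsto (fun p : ℕ => C₀ ^ 2 * (p : ℝ) ^ (-((1 - 2 * γ) / 2))) Filter.atTop (nhds (C₀ ^ 2 * 0)) :=
    ((tendsto_rpow_neg_atTop (by linarith : 0 < (1 - 2 * γ) / 2)).comp tendsto_natCast_atTop_atTop).const_mul _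
  rw [mul_zero] at h1 h2
  obtain ⟨N₁, hN₁⟩ := Filter.eventually_atTop.1 (h1.eventually_le_const one_pos)
  obtain ⟨N₂, hN₂⟩ := Filter.eventually_atTop.1 (h2.eventually_le_const hu)
  refine ⟨max 1 (max N₁ N₂), fun p ku hp hku hle => ?_⟩
  have hp1 : (1 : ℝ) ≤ p := by exact_mod_cast (by omega : 1 ≤ p)
  have hp0 : (0 : ℝ) < p := by linarith
  have g1 := hN₁ p (by omega)
  have g2 := hN₂ p (by omega)
  have hku0 : (12 : ℝ) ≤ ku := by exact_mod_cast hku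
  have h2ku : (2 * ku : ℝ) ≤ p := by
    have : (p : ℝ) ^ γ = (p : ℝ) ^ (-(1 - γ)) * p := by
      conv_rhs => rw [← Real.rpow_one (p : ℝ), ← Real.rpow_mul hp0.le, ← Real.rpow_add hp0]
      congr 1; ring
    rw [this] at hle
    calc (2 * ku : ℝ) ≤ 2 * C₀ * (p : ℝ) ^ (-(1 - γ)) * p := by linarith
      _ ≤ 1 * p := mul_le_mul_of_nonneg_right g1 hp0.le
      _ = p := one_mul _
  have h2ku' : 2 * ku ≤ p := by exact_mod_cast h2ku
  -- With s = ⌊k_u/4⌋ and M as large as the room beyond k_u permits, p ≤ 2k_u M and so s/M ≤ k_u²/p.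
  obtain ⟨s, hs⟩ : ∃ s, s = ku / 4 := ⟨_, rfl⟩
  have hs1 : 1 ≤ s := by omega
  obtain ⟨M, hM⟩ : ∃ M, M = (p - ku) / (2 * s) := ⟨_, rfl⟩
  have hM1 : 1 ≤ M := by
    rw [hM, Nat.one_le_div_iff (by omega)]; omega
  have hMle : 2 * s * M ≤ p - ku := by rw [hM]; exact Nat.mul_div_le _ _
  have hMlt : p - ku < 2 * s * (M + 1) := by
    rw [hM]; exact Nat.lt_mul_div_succ _ (by omega)
  refine ⟨s, M, hs1, by omega, by omega, hM1, by rw [← mul_assoc]; omega, le_trans ?_ g2⟩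
  have hsr : (4 * s : ℝ) ≤ ku := by exact_mod_cast (by omega : 4 * s ≤ ku)
  have hs1r : (1 : ℝ) ≤ s := by exact_mod_cast hs1
  have hM1r : (1 : ℝ) ≤ M := by exact_mod_cast hM1
  have hMr : (p : ℝ) < 2 * s * (M + 1) + ku := by exact_mod_cast (by omega : p < 2 * s * (M + 1) + ku)
  have hpM : (p : ℝ) ≤ 2 * ku * M := by nlinarith
  have hsM : (s : ℝ) / M ≤ ku ^ 2 / p := by
    rw [div_le_div_iff₀ (by linarith) hp0]
    nlinarith
  have hk2 : (ku : ℝ) ^ 2 ≤ C₀ ^ 2 * (p : ℝ) ^ (2 * γ) := by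
    have := pow_le_pow_left₀ (by linarith) hle 2
    rw [mul_pow, ← Real.rpow_mul_natCast hp0.le] at this
    rwa [mul_comm 2 γ]
  have he : Real.exp (b * Real.log p) = (p : ℝ) ^ b := by
    rw [Real.rpow_def_of_pos hp0, mul_comm]
  rw [he]
  have hpb : 0 ≤ (p : ℝ) ^ b := Real.rpow_nonneg hp0.le _
  -- The final exponent 2γ - 1 + b is at most -(1 - 2γ)/2, negative because γ < 1/2.
  calc (s : ℝ) * ((p : ℝ) ^ b / M) = s / M * (p : ℝ) ^ b := by ring
    _ ≤ ku ^ 2 / p * (p : ℝ) ^ b := mul_le_mul_of_nonneg_right hsM hpb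
    _ ≤ C₀ ^ 2 * (p : ℝ) ^ (2 * γ) / p * (p : ℝ) ^ b := by gcongr
    _ = C₀ ^ 2 * (p : ℝ) ^ (2 * γ - 1 + b) := by
      rw [Real.rpow_add hp0, Real.rpow_sub hp0, Real.rpow_one]; ring
    _ ≤ C₀ ^ 2 * (p : ℝ) ^ (-((1 - 2 * γ) / 2)) :=
      mul_le_mul_of_nonneg_left (Real.rpow_le_rpow_of_exponent_le hp1 (by linarith)) (sq_nonneg _)

end AdaptiveSep

/-! ### Uniform constants and assembly -/

namespace AdaptiveSep

/-- The regime, unpacked. -/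
theorem Regime.unpack {C₀ γ c : ℝ} {N n p ku : ℕ} (h : Regime C₀ γ c N n p ku) {c' : ℝ} (hc : c' ≤ c) :
    c' * (ku * Real.log p) ≤ n := by
  obtain ⟨-, -, -, -, h⟩ := h
  refine le_trans ?_ h
  rw [mul_assoc]
  exact mul_le_mul_of_nonneg_right hc (mul_nonneg (by positivity) (Real.log_natCast_nonneg p))

theorem attainment {M₁ M₂ γ C₀ α η c : ℝ} (hM₁ : 1 < M₁) (hM₂ : 0 < M₂) (hα₀ : 0 < α) (hη₀ : 0 < η)
    (hc : 10 ^ 6 * M₁ ^ 3 ≤ c) :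
    ∃ A : ℝ, 0 < A ∧
    (∀ δ : ℝ, 0 < δ → ∃ N : ℕ, ∀ n p ku : ℕ, Regime C₀ γ c N n p ku →
      ∀ θ ∈ paramSpace p M₁ M₂ ku, ENNReal.ofReal (1 - δ) ≤
        dataLaw n θ (accurate (4000 * M₁ ^ 2) (2000 * M₁ ^ 2) ku (betaHat n p ku) (sigmaHat n p ku) θ)) ∧
    ∃ N : ℕ, 2 ≤ N ∧ ∀ n p ku : ℕ, Regime C₀ γ c N n p ku →
      ∀ ξ : Fin p → ℝ, IsLoading ξ → ∀ t₀ : ℝ, ∀ m : ℕ,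
        mixedTest (8 * M₁) (2 * A) (64000 * M₁ ^ 3) (8000 * M₁ ^ 2) ku (betaHat n p ku)
          (sigmaHat n p ku) ξ t₀ m ∈ tests n α (nullSpace M₁ M₂ ku ξ t₀) ∧
        ∀ k : ℕ, k ≤ ku → ∀ θ ∈ altSpace M₁ M₂ k ξ t₀ (3 * radiusConst M₁ M₂ A * mixedRate n ku ξ m),
          ENNReal.ofReal (1 - η) ≤ power (mixedTest (8 * M₁) (2 * A) (64000 * M₁ ^ 3)
            (8000 * M₁ ^ 2) ku (betaHat n p ku) (sigmaHat n p ku) ξ t₀ m) θ := by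
  obtain ⟨A, hA, N₁, hN₁⟩ := exists_error_le (show 0 < min α η from lt_min hα₀ hη₀)
  obtain ⟨N₂, hN₂⟩ := exists_nat_ge (8 * M₁)
  refine ⟨A, hA, fun δ hδ => ?_, max 2 (max N₁ N₂), le_max_left _ _, fun n p ku h ξ hξ t₀ m => ?_⟩
  · obtain ⟨N, hN⟩ := exists_badProb_le hδ
    refine ⟨max 2 (max N N₂), fun n p ku h θ hθ => ?_⟩
    have hL := h.unpack hc
    obtain ⟨hn, hp, hku, -, -⟩ := h
    have hp8 : 8 * M₁ ≤ p := hN₂.trans (by exact_mod_cast (by omega : N₂ ≤ p))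
    have hlog : 0 ≤ Real.log p := Real.log_natCast_nonneg p
    have hM3 : 1 * (ku * Real.log p) ≤ M₁ ^ 3 * (ku * Real.log p) :=
      mul_le_mul_of_nonneg_right (one_le_pow₀ hM₁.le) (by positivity)
    have h1 := (measure_not_goodDesign hM₁ hθ (by omega) (by omega : 0 < n) hp8 (by
      have : 0 ≤ M₁ ^ 3 * (ku * Real.log p) := by positivity
      linarith)).trans (ENNReal.ofReal_le_ofReal (hN n p (by omega) (by omega)))
    refine (ofReal_one_sub_le hδ.le h1).trans (measure_mono fun z hz => ?_)
    exact accurate_of_goodDesign hM₁ hθ.2.2.1 hθ.1 (by omega) (by omega) hL hz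
  · have hL := h.unpack hc
    obtain ⟨hn, hp, hku, -, -⟩ := h
    exact mixedTest_size_power hM₁ hM₂ (by omega) (by omega)
      (hN₂.trans (by exact_mod_cast (by omega : N₂ ≤ p))) hL hA (hN₁ n p (by omega) (by omega))
      (min_le_left _ _) (min_le_right _ _) hξ t₀ m

theorem upper_bound {M₁ M₂ γ C₀ α η c : ℝ} (hM₁ : 1 < M₁) (hM₂ : 0 < M₂) (hα₀ : 0 < α) (hη₀ : 0 < η)
    (hc : 10 ^ 6 * M₁ ^ 3 ≤ c) :
    ∃ C : ℝ, 0 < C ∧ ∃ N : ℕ, ∀ n p ku : ℕ, Regime C₀ γ c N n p ku →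
      ∀ ξ : Fin p → ℝ, IsLoading ξ → ∀ t₀ : ℝ, ∀ k : ℕ, 1 ≤ k → k ≤ ku →
        tauAdap n M₁ M₂ α η ku k ξ t₀ ≤ ENNReal.ofReal (C * upperRate n ku ξ) := by
  obtain ⟨A, hA, -, N, hN2, hN⟩ := attainment (γ := γ) (C₀ := C₀) hM₁ hM₂ hα₀ hη₀ hc
  have hC : 0 < 3 * radiusConst M₁ M₂ A := by
    have : 0 < M₁ := by linarith
    unfold radiusConst; positivity
  refine ⟨_, hC, N, fun n p ku h ξ hξ t₀ k hk hku => ?_⟩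
  obtain ⟨m, hm, hmr⟩ := exists_mixedRate_eq_upperRate (n := n) ku ξ
  obtain ⟨h1, h2⟩ := hN n p ku h ξ hξ t₀ m
  rw [← hmr]
  obtain ⟨hn, hp, hku', -, -⟩ := h
  exact tauAdap_le_of_test (mul_pos hC (mixedRate_pos (by omega) (by omega) (by omega) hξ m)) h1 (h2 k hku)

theorem lower_bound {M₁ M₂ γ C₀ α η c : ℝ} (hM₁ : 1 < M₁) (hM₂ : 0 < M₂) (hγ : γ < 1 / 2)
    (hα₀ : 0 < α) (hη₀ : 0 < η) (hc : 10 ^ 6 * M₁ ^ 3 ≤ c) (hαη : α + η < 1) :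
    ∃ C' : ℝ, 0 < C' ∧ ∃ N : ℕ, ∀ n p ku : ℕ, Regime C₀ γ c N n p ku →
      ∀ ξ : Fin p → ℝ, IsLoading ξ → ∀ t₀ : ℝ, ∀ k : ℕ, 1 ≤ k → k ≤ ku →
        ENNReal.ofReal (C' * lowerRate n ku ξ) ≤ tauAdap n M₁ M₂ α η ku k ξ t₀ := by
  have hi1 : 1 / M₁ < 1 := by rw [div_lt_one (by linarith)]; exact hM₁
  have hε : 0 < (1 - 1 / M₁) / 3 := by linarith
  set t := (1 - α - η) / 2 with htdef
  have ht : 0 < t := by rw [htdef]; linarith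
  have htα : t < 1 - α - η := by rw [htdef]; linarith
  have hlog : 0 < Real.log (1 + t ^ 2) := Real.log_pos (by have := pow_pos ht 2; linarith)
  -- With b = 8a²/M₂², the three bounds ensure b ≤ 1, shears small enough for the spectral
  -- constraint, and exp(6b) ≤ 1 + t².
  obtain ⟨a, ha, ha2⟩ := exists_pos_sq_le (x := min (M₂ ^ 2 / 8)
    (min (((1 - 1 / M₁) / 3) ^ 2 * M₂ ^ 2 / 24) (M₂ ^ 2 / 48 * Real.log (1 + t ^ 2)))) (by positivity)
  -- The first bound is the spectral constraint; the second gives 2a'² ≤ (1 - 2γ)/2, the exponent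
  -- that `exists_blocks` allows.
  obtain ⟨a', ha', ha'2⟩ := exists_pos_sq_le (x := min (((1 - 1 / M₁) / 3) ^ 2) ((1 - 2 * γ) / 4))
    (lt_min (by positivity) (by linarith))
  simp only [le_min_iff] at ha2 ha'2
  obtain ⟨hb, haε, hat⟩ := ha2
  obtain ⟨N, hN⟩ := exists_blocks hγ (b := 2 * a' ^ 2) (by linarith [ha'2.2]) hlog
  refine ⟨min (a / 10) (M₂ * a' ^ 2 / 64), lt_min (by positivity) (by positivity), max 12 N,
    fun n p ku h ξ hξ t₀ k hk hkku => ?_⟩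
  have hL := h.unpack hc
  obtain ⟨hn, hp, hku, hγku, -⟩ := h
  have hL1 : ku * Real.log p ≤ n := by
    refine le_trans (le_mul_of_one_le_left (mul_nonneg (by positivity) (Real.log_natCast_nonneg p)) ?_) hL
    linarith [one_le_pow₀ hM₁.le (n := 3)]
  have hM₂2 : 0 < M₂ ^ 2 := by positivity
  rcases max_choice (nu1 ku ξ / √n) (nu2 ku ξ * (ku * Real.log p / n)) with hmax | hmax
  · refine le_trans (ENNReal.ofReal_le_ofReal ?_) (le_tauAdap_nu1 (t := t) hM₁ hM₂ hα₀.le hk (by omega) (by omega) (by omega)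
      hL1 hξ t₀ ha ?_ ?_ ht htα ?_)
    · rw [lowerRate, hmax]
      exact mul_le_mul_of_nonneg_right (min_le_left _ _) (div_nonneg (nu1_nonneg ku ξ) (Real.sqrt_nonneg _))
    · rw [div_mul_eq_mul_div, div_le_one hM₂2]; linarith
    · linarith
    · rw [← Real.le_log_iff_exp_le (by positivity)]
      rw [div_mul_eq_mul_div, mul_div_assoc', div_le_iff₀ hM₂2]
      linarith
  · obtain ⟨s, M, h1, h2, h3, h4, h5, h6⟩ := hN p ku (by omega) (by omega) hγku
    refine le_trans (ENNReal.ofReal_le_ofReal ?_) (le_tauAdap_nu2 (t := t) hM₁ hM₂ hα₀.le hk h1 h2 h3 h4 h5 (by omega)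
      hL1 hξ t₀ ha'2.1 ht htα ?_)
    · rw [lowerRate, hmax]
      exact mul_le_mul_of_nonneg_right (min_le_right _ _) (mul_nonneg (nu2_nonneg ku ξ)
        (div_nonneg (mul_nonneg (by positivity) (Real.log_natCast_nonneg p)) (by positivity)))
    · rw [← Real.le_log_iff_exp_le (by positivity)]
      exact h6

end AdaptiveSep

theorem mainTheorem1 (M₁ M₂ γ C₀ α η : ℝ) (hM₁ : 1 < M₁) (hM₂ : 0 < M₂)
    (hγ₀ : 0 ≤ γ) (hγ : γ < 1 / 2) (hC₀ : 0 < C₀)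
    (hα₀ : 0 < α) (hα₁ : α < 1) (hη₀ : 0 < η) (hη₁ : η < 1) :
    ∃ c : ℝ, 0 < c ∧
      -- upper bound
      (∃ C : ℝ, 0 < C ∧ ∃ N : ℕ, ∀ n p ku : ℕ, Regime C₀ γ c N n p ku →
        ∀ ξ : Fin p → ℝ, IsLoading ξ → ∀ t₀ : ℝ, ∀ k : ℕ, 1 ≤ k → k ≤ ku →
          tauAdap n M₁ M₂ α η ku k ξ t₀ ≤ ENNReal.ofReal (C * upperRate n ku ξ)) ∧
      -- lower bound
      (α + η < 1 →
        ∃ C' : ℝ, 0 < C' ∧ ∃ N : ℕ, ∀ n p ku : ℕ, Regime C₀ γ c N n p ku →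
        ∀ ξ : Fin p → ℝ, IsLoading ξ → ∀ t₀ : ℝ, ∀ k : ℕ, 1 ≤ k → k ≤ ku →
          ENNReal.ofReal (C' * lowerRate n ku ξ) ≤ tauAdap n M₁ M₂ α η ku k ξ t₀) ∧
      -- the upper bound is attained by the mixed test
      (∃ (bhat : ∀ n p : ℕ, ℕ → Data n p → Fin p → ℝ) (shat : ∀ n p : ℕ, ℕ → Data n p → ℝ)
        (cβ Cβ Cξ A₁ A₂ A₃ C : ℝ),
        0 < cβ ∧ 0 < Cβ ∧ 0 < Cξ ∧ 0 < A₁ ∧ 0 < A₂ ∧ 0 < A₃ ∧ 0 < C ∧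
        (∀ n p ku : ℕ, Measurable (bhat n p ku) ∧ Measurable (shat n p ku)) ∧
        (∀ δ : ℝ, 0 < δ → ∃ N : ℕ, ∀ n p ku : ℕ, Regime C₀ γ c N n p ku →
          ∀ θ ∈ paramSpace p M₁ M₂ ku, ENNReal.ofReal (1 - δ) ≤
            dataLaw n θ (accurate cβ Cβ ku (bhat n p ku) (shat n p ku) θ)) ∧
        ∃ N : ℕ, ∀ n p ku : ℕ, Regime C₀ γ c N n p ku →
          ∀ ξ : Fin p → ℝ, IsLoading ξ → ∀ t₀ : ℝ, ∀ m : ℕ, m ≤ p →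
            mixedTest Cξ A₁ A₂ A₃ ku (bhat n p ku) (shat n p ku) ξ t₀ m ∈
              tests n α (nullSpace M₁ M₂ ku ξ t₀) ∧
            ∀ k : ℕ, 1 ≤ k → k ≤ ku →
              ∀ θ ∈ altSpace M₁ M₂ k ξ t₀ (C * mixedRate n ku ξ m),
                ENNReal.ofReal (1 - η) ≤
                  power (mixedTest Cξ A₁ A₂ A₃ ku (bhat n p ku) (shat n p ku) ξ t₀ m) θ) := by
  have hc : 0 < 10 ^ 6 * M₁ ^ 3 := by
    have : 0 < M₁ := by linarith
    positivity
  refine ⟨10 ^ 6 * M₁ ^ 3, hc, upper_bound hM₁ hM₂ hα₀ hη₀ le_rfl,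
    lower_bound hM₁ hM₂ hγ hα₀ hη₀ le_rfl, ?_⟩
  obtain ⟨A, hA, h1, N, -, hN⟩ := attainment (γ := γ) (C₀ := C₀) hM₁ hM₂ hα₀ hη₀ le_rfl
  have hM0 : 0 < M₁ := by linarith
  have hC : 0 < 3 * radiusConst M₁ M₂ A := by unfold radiusConst; positivity
  refine ⟨betaHat, sigmaHat, 4000 * M₁ ^ 2, 2000 * M₁ ^ 2, 8 * M₁, 2 * A, 64000 * M₁ ^ 3,
    8000 * M₁ ^ 2, 3 * radiusConst M₁ M₂ A, by positivity, by positivity, by positivity,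
    by positivity, by positivity, by positivity, hC,
    fun n p ku => ⟨measurable_betaHat n p ku, measurable_sigmaHat n p ku⟩, h1, N,
    fun n p ku h ξ hξ t₀ m _ => ?_⟩
  obtain ⟨h2, h3⟩ := hN n p ku h ξ hξ t₀ m
  exact ⟨h2, fun k _ hk => h3 k hk⟩
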